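/- Let $d\ge 2$. Fix the following functions. * $\varphi\in C_c^\infty(\mathbb R^d)$ is non-negative and radial, with $\varphi(\xi)=0$ for $|\xi|>1$ and $\varphi\equiv 1$ near $0$. * $\psi\in C_c^\infty(\mathbb R^d)$ is non-negative and radial, with $\psi(\xi)=0$ if $|\xi|\notin[1/2,2]$ and $\int_0^\infty\psi(\sigma\xi)^2\frac{d\sigma}{\sigma}=1$ for $\xi\ne0$. * $\rho\in C_c^\infty(\mathbb R^d)$ satisfies $\rho(\xi)=1$ for $|\xi|\le2$. * $(\psi_k)_{k\ge0}\subseteq C_c^\infty(\mathbb R^d)$ is a Littlewood–Paley decomposition: $\operatorname{supp}\psi_k\subseteq\{2^{k-1}\le|\xi|\le2^{k+1}\}$ for $k\ge1$, $\sum_{k\ge0}\psi_k(\xi)=1$ for $\xi\neq0$, and for each $n\ge 0$ the $n$-th derivatives of $\psi_k$ are bounded by $C_n2^{-kn}$, uniformly in $k$. For $\omega\in S^{d-1}$, $\sigma>0$ and $\xi\ne0$ put $$\varphi_{\omega,\sigma}(\xi)=c_\sigma\,\varphi\Big(\frac{\xi/|\xi|-\omega}{\sigma^{1/2}}\Big),\qquad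 c_\sigma=\Big(\int_{S^{d-1}}\varphi\Big(\frac{e_1-\nu}{\sigma^{1/2}}\Big)^2d\nu\Big)^{-1/2},\qquad \varphi_{\omega,\sigma}(0)=0,$$ and $\varphi_\omega(\xi)=\int_0^4\psi(\sigma\xi)\varphi_{\omega,\sigma}(\xi)\frac{d\sigma}{\sigma}$. For $p\in[1,\infty]$, $q\in[1,\infty)$ and $s\in\mathbb R$ let $$\|f\|_{B^s_{p,q}}=\Big(\sum_{k=0}^\infty2^{sqk}\|\psi_k(D)f\|_{L^p}^q\Big)^{1/q},\qquad \|f\|_{\mathcal B^s_{p,q,q}}=\|\rho(D)f\|_{L^p}+\Big(\int_{S^{d-1}}\|\varphi_\omega(D)f\|_{B^s_{p,q}}^q\,d\omega\Big)^{1/q},$$ and let $\mathcal B^s_{p,q,q}(\mathbb R^d)$ be the set of all $f\in\mathcal S'(\mathbb R^d)$ with $\|f\|_{\mathcal B^s_{p,q,q}}<\infty$. Put $s(p)=\frac{d-1}{2}\big|\frac12-\frac1p\big|$. Let $\phi:\mathbb R^d\setminus\{0\}\to\mathbb R$ be smooth and positively homogeneous of order $1$, that is, $\phi(\lambda\xi)=\lambda\phi(\xi)$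 for $\lambda>0$. For $f\in\mathcal B^s_{p,q,q}(\mathbb R^d)$ and $t\in\mathbb R$, the distribution $e^{it\phi(D)}f$ is defined by $$e^{it\phi(D)}f=\big((1-\rho)e^{it\phi}\big)(D)f+e^{it\phi(D)}\big(\rho(D)f\big),$$ where the first symbol is smooth with polynomially bounded derivatives, and the second term is defined by duality, $\langle e^{it\phi(D)}h,u\rangle=\int h\,\mathcal F\big(e^{it\phi}\mathcal F^{-1}u\big)\,dx$ for $h=\rho(D)f\in L^p(\mathbb R^d)$ and $u\in\mathcal S(\mathbb R^d)$. Then, for all $p\in[1,\infty]$, $q\in[1,\infty)$ and $s\in\mathbb R$, there is a constant $C\ge0$ such that, for all $t\in\mathbb R$ and $f\in\mathcal B^s_{p,q,q}(\mathbb R^d)$, $e^{it\phi(D)}f$ is a well-defined tempered distribution (the integrals above converge absolutely), it belongs to $\mathcal B^s_{p,q,q}(\mathbb R^d)$, and $$\|e^{it\phi(D)}f\|_{\mathcal B^s_{p,q,q}(\mathbb R^d)}\le C(1+|t|)^{2s(p)}\|f\|_{\mathcal B^s_{p,q,q}(\mathbb R^d)}.$$ -/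

import Mathlib

open MeasureTheory FourierTransform
open scoped SchwartzMap ENNReal NNReal ContDiff

noncomputable section

namespace AdaptedBesov

/-- The Euclidean space `ℝ^d`. -/
abbrev Eucl (d : ℕ) : Type := EuclideanSpace ℝ (Fin d)

/-- The unit sphere `S^{d-1}` of `ℝ^d`. -/
abbrev Sph (d : ℕ) : Type := Metric.sphere (0 : Eucl d) 1

/-- The surface measure of the unit sphere. -/
def surf (d : ℕ) : Measure (Sph d) := (volume : Measure (Eucl d)).toSphere

/-- The first standard basis vector `(1, 0, …, 0)`. -/
def e₁ (d : ℕ) : Eucl d := WithLp.toLp 2 (fun i => if (i : ℕ) = 0 then 1 else 0)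

/-- The cut-off functions that are fixed once and for all in the definition of the spaces. -/
structure Cutoffs (d : ℕ) where
  /-- the angular cut-off `φ` -/
  phi : Eucl d → ℝ
  phi_smooth : ContDiff ℝ ∞ phi
  phi_nonneg : ∀ ξ, 0 ≤ phi ξ
  phi_radial : ∀ ξ η : Eucl d, ‖ξ‖ = ‖η‖ → phi ξ = phi η
  phi_support : ∀ ξ : Eucl d, 1 < ‖ξ‖ → phi ξ = 0
  phi_one : ∀ᶠ ξ in nhds (0 : Eucl d), phi ξ = 1
  /-- the radial cut-off `ψ` of the Calderón reproducing formula -/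
  psi : Eucl d → ℝ
  psi_smooth : ContDiff ℝ ∞ psi
  psi_nonneg : ∀ ξ, 0 ≤ psi ξ
  psi_radial : ∀ ξ η : Eucl d, ‖ξ‖ = ‖η‖ → psi ξ = psi η
  psi_support : ∀ ξ : Eucl d, ‖ξ‖ ∉ Set.Icc (1 / 2 : ℝ) 2 → psi ξ = 0
  psi_calderon : ∀ ξ : Eucl d, ξ ≠ 0 → ∫ σ in Set.Ioi (0 : ℝ), psi (σ • ξ) ^ 2 / σ = 1
  /-- the low-frequency cut-off `ρ` -/
  rho : Eucl d → ℂ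
  rho_smooth : ContDiff ℝ ∞ rho
  rho_compact : HasCompactSupport rho
  rho_one : ∀ ξ : Eucl d, ‖ξ‖ ≤ 2 → rho ξ = 1
  /-- the Littlewood–Paley decomposition `(ψ_k)_{k ≥ 0}` -/
  lp : ℕ → Eucl d → ℂ
  lp_smooth : ∀ k, ContDiff ℝ ∞ (lp k)
  lp_compact : ∀ k, HasCompactSupport (lp k)
  lp_support : ∀ k : ℕ, 1 ≤ k → ∀ ξ : Eucl d, lp k ξ ≠ 0 →
    (2 : ℝ) ^ ((k : ℤ) - 1) ≤ ‖ξ‖ ∧ ‖ξ‖ ≤ (2 : ℝ) ^ ((k : ℤ) + 1)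
  lp_sum : ∀ ξ : Eucl d, ξ ≠ 0 → HasSum (fun k => lp k ξ) 1
  lp_bounds : ∀ n : ℕ, ∃ C : ℝ, ∀ (k : ℕ) (ξ : Eucl d),
    ((2 : ℝ) ^ k) ^ n * ‖iteratedFDeriv ℝ n (lp k) ξ‖ ≤ C

variable {d : ℕ}

/-- `c_σ = (∫_{S^{d-1}} φ((e₁ - ν) / σ^{1/2})² dν)^{-1/2}`. -/
def angNorm (c : Cutoffs d) (σ : ℝ) : ℝ :=
  (∫ ν : Sph d, c.phi ((√σ)⁻¹ • (e₁ d - (ν : Eucl d))) ^ 2 ∂(surf d)) ^ (-(1 / 2) : ℝ)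

open Classical in
/-- `φ_{θ,σ}(ξ) = c_σ φ((ξ/|ξ| - θ) / σ^{1/2})` for `ξ ≠ 0`, and `φ_{θ,σ}(0) = 0`. -/
def angCut (c : Cutoffs d) (θ : Sph d) (σ : ℝ) (ξ : Eucl d) : ℝ :=
  if ξ = 0 then 0
  else angNorm c σ * c.phi ((√σ)⁻¹ • (‖ξ‖⁻¹ • ξ - (θ : Eucl d)))

/-- `φ_θ(ξ) = ∫_0^4 ψ(σξ) φ_{θ,σ}(ξ) dσ/σ`. -/
def packet (c : Cutoffs d) (θ : Sph d) (ξ : Eucl d) : ℝ :=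
  ∫ σ in (0 : ℝ)..4, c.psi (σ • ξ) * angCut c θ σ ξ / σ

/-- The Fourier multiplier `m(D)`, `D = -i∇`, on tempered distributions, for a smooth symbol `m`
all of whose derivatives are polynomially bounded. The Fourier transform of Mathlib
has the kernel `exp (-2πi x·ξ)`, whence the dilation of the symbol. -/
def mult (m : Eucl d → ℂ) (f : 𝓢'(Eucl d, ℂ)) : 𝓢'(Eucl d, ℂ) :=
  TemperedDistribution.fourierMultiplierCLM ℂ (fun x => m ((2 * Real.pi) • x)) f

/-- The `L^p` norm of a tempered distribution; it is `∞` if the distribution is not in `L^p`. -/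
def lpNorm (p : ℝ≥0∞) [Fact (1 ≤ p)] (f : 𝓢'(Eucl d, ℂ)) : ℝ≥0∞ :=
  ⨅ (h : Lp ℂ p (volume : Measure (Eucl d))) (_ : Lp.toTemperedDistribution h = f), ‖h‖ₑ

/-- The norm of the Besov space `B^s_{p,r}`, for finite `r`. -/
def besovNorm (c : Cutoffs d) (s : ℝ) (p : ℝ≥0∞) [Fact (1 ≤ p)] (r : ℝ)
    (f : 𝓢'(Eucl d, ℂ)) : ℝ≥0∞ :=
  (∑' k : ℕ, (2 : ℝ≥0∞) ^ (s * r * k) * lpNorm p (mult (c.lp k) f) ^ r) ^ (1 / r)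

/-- The norm of the adapted Besov space `𝓑^s_{p,q,r}`, for finite `q` and `r`. -/
def adaptedNorm (c : Cutoffs d) (s : ℝ) (p : ℝ≥0∞) [Fact (1 ≤ p)] (q r : ℝ)
    (f : 𝓢'(Eucl d, ℂ)) : ℝ≥0∞ :=
  lpNorm p (mult c.rho f) +
    (∫⁻ θ : Sph d, besovNorm c s p r (mult (fun ξ => (packet c θ ξ : ℂ)) f) ^ q ∂(surf d))
      ^ (1 / q)

/-- The adapted Besov space `𝓑^s_{p,q,r}`. -/
def adaptedSpace (c : Cutoffs d) (s : ℝ) (p : ℝ≥0∞) [Fact (1 ≤ p)] (q r : ℝ) :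
    Set 𝓢'(Eucl d, ℂ) :=
  {f | adaptedNorm c s p q r f < ⊤}

/-- The transpose of `m(D)` applied to a test function; `m` may be singular at the origin. -/
def multTranspose (m : Eucl d → ℂ) (u : 𝓢(Eucl d, ℂ)) : Eucl d → ℂ :=
  𝓕 (fun x : Eucl d => m ((2 * Real.pi) • x) * (𝓕⁻ u : 𝓢(Eucl d, ℂ)) x)

/-- `g = m(D) f`, for a bounded symbol `m` that may be singular at the origin, and for
`f ∈ 𝓢'` with low-frequency part `h = ρ(D) f` in `L^p`: the high-frequency part has the regular
symbol `(1 - ρ) m`, and `m(D) h` is defined by duality with test functions,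
`⟨m(D) h, u⟩ = ∫ h · m(D)ᵗ u`. -/
def IsMultOf (c : Cutoffs d) (p : ℝ≥0∞) [Fact (1 ≤ p)] (m : Eucl d → ℂ)
    (f g : 𝓢'(Eucl d, ℂ)) : Prop :=
  ∃ h : Lp ℂ p (volume : Measure (Eucl d)),
    Lp.toTemperedDistribution h = mult c.rho f ∧
    ∀ u : 𝓢(Eucl d, ℂ),
      Integrable (fun x => h x * multTranspose m u x) ∧
      g u = mult (fun ξ => (1 - c.rho ξ) * m ξ) f u + ∫ x, h x * multTranspose m u x

/-- The symbol `e^{itφ}`. -/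
def propSymbol (t : ℝ) (φ : Eucl d → ℝ) (ξ : Eucl d) : ℂ :=
  Complex.exp (Complex.I * t * φ ξ)

/-- The exponent `s(p) = (d-1)/2 · |1/2 - 1/p|`. -/
def sExp (d : ℕ) (p : ℝ≥0∞) : ℝ := ((d : ℝ) - 1) / 2 * |1 / 2 - (p⁻¹).toReal|

end AdaptedBesov

end

/-! ### Convolution operators on `L^p` -/

section Young

variable {V : Type*} [NormedAddCommGroup V] [InnerProductSpace ℝ V] [FiniteDimensional ℝ V]
  [MeasurableSpace V] [BorelSpace V]

/-! The propagator commutes with the wave packet projections and with the Littlewood–Paley pieces.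
It therefore suffices to bound it on `L^p`, uniformly in `k` and `θ`, on frequencies where both
`c.lp k` and `packet c θ` are nonzero. The constant then passes through the sum over `k` and the
integral over the sphere.

For large `k` that set has radius about `R = 2^k` and angular width `R^(-1/2)` (`packet_support`).
It is filled with caps of angular size `δ = R^(-1/2) (1+|t|)^(-1/2)`. On a cap, Taylor expansion of
the homogeneous phase gives a linear function plus an error of order `|t| R δ² ≤ 1`. The linear part
only translates the kernel, and an invertible linear change of variables, which leaves the `L¹` norm
of the kernel unchanged, turns the rest into a smooth family of symbols over a compact parameter set
(`exists_kerBound_cap`). Each cap thus contributes `O(1)` to the `L¹` norm of the kernel, and about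
`(1+|t|)^((d-1)/2)` caps fill the sector (`exists_kerBound_sector`, `exists_sectorSymbol`).

The localised symbols are bounded by one, so Plancherel gives a uniform `L²` bound. Riesz–Thorin
(`norm_multLp_le`) raises the kernel bound to the power `|1 - 2/p|`, and `(d-1)/2 · |1 - 2/p| = 2
s(p)`.

At low frequencies the phase is singular at the origin. There `e^{itφ} - 1` is decomposed over
annuli of radius `R₀ 4^(-j)`. An annulus of radius `R` costs a constant times `√(|t|R)
√(1+|t|R)^(d-2)`, which sums geometrically to the same power of `1+|t|` (`exists_kerBound_low`).
This controls `ρ(D)` of the evolved distribution, gives existence by duality, and covers the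
finitely many small `k`. -/

theorem lintegral_lintegral_conv_eq {k g : V → ℝ≥0∞} (hk : Measurable k) (hg : Measurable g) :
    ∫⁻ x, ∫⁻ y, k (x - y) * g y = (∫⁻ x, k x) * ∫⁻ y, g y := by
  rw [lintegral_lintegral_swap (by fun_prop)]
  have h : ∀ y, ∫⁻ x, k (x - y) * g y = (∫⁻ x, k x) * g y := fun y => by
    rw [lintegral_mul_const _ (by fun_prop), lintegral_sub_right_eq_self]
  simp_rw [h]
  rw [lintegral_const_mul _ hg]

/-- Young's inequality for convolutions with an integrable kernel. -/
theorem lintegral_conv_rpow_le {k g : V → ℝ≥0∞} (hk : Measurable k) (hg : Measurable g)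
    {p : ℝ} (hp : 1 ≤ p) :
    ∫⁻ x, (∫⁻ y, k (x - y) * g y) ^ p ≤ (∫⁻ x, k x) ^ p * ∫⁻ y, g y ^ p := by
  rcases hp.eq_or_lt with rfl | hp
  · simp only [ENNReal.rpow_one]
    exact (lintegral_lintegral_conv_eq hk hg).le
  set q := p.conjExponent
  have hpq : p.HolderConjugate q := Real.HolderConjugate.conjExponent hp
  have hp0 : 0 < p := hpq.pos
  have hq0 : 0 < q := hpq.symm.pos
  have hexp : (1 / q) * p = p - 1 := by
    have := hpq.inv_add_inv_eq_one
    have h2 : 1 / q = 1 - p⁻¹ := by rw [one_div]; linarith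
    rw [h2]; field_simp
  -- Hölder for the factorisation `k = k^(1/q) · k^(1/p)`, with `g` attached to the second factor.
  -- What remains after this is Tonelli.
  have hpt : ∀ x, (∫⁻ y, k (x - y) * g y) ^ p ≤
      (∫⁻ x, k x) ^ (p - 1) * ∫⁻ y, k (x - y) * g y ^ p := by
    intro x
    have h1 : ∀ y, k (x - y) * g y = ((fun y => k (x - y) ^ (1 / q)) *
        fun y => k (x - y) ^ (1 / p) * g y) y := by
      intro y
      simp only [Pi.mul_apply]
      rw [← mul_assoc, ← ENNReal.rpow_add_of_nonneg _ _ (by positivity) (by positivity)]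
      have : 1 / q + 1 / p = 1 := by
        rw [one_div, one_div]; exact hpq.symm.inv_add_inv_eq_one
      rw [this, ENNReal.rpow_one]
    have h2 := ENNReal.lintegral_mul_le_Lp_mul_Lq volume hpq.symm
      (f := fun y => k (x - y) ^ (1 / q)) (g := fun y => k (x - y) ^ (1 / p) * g y)
      (by fun_prop) (by fun_prop)
    have h3 : ∀ y, (k (x - y) ^ (1 / q)) ^ q = k (x - y) := fun y => by
      rw [← ENNReal.rpow_mul, one_div_mul_cancel hq0.ne', ENNReal.rpow_one]
    have h4 : ∀ y, (k (x - y) ^ (1 / p) * g y) ^ p = k (x - y) * g y ^ p := fun y => by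
      rw [ENNReal.mul_rpow_of_nonneg _ _ hp0.le, ← ENNReal.rpow_mul,
        one_div_mul_cancel hp0.ne', ENNReal.rpow_one]
    simp_rw [h3, h4, ← h1] at h2
    rw [lintegral_sub_left_eq_self] at h2
    calc _ ≤ ((∫⁻ y, k y) ^ (1 / q) * (∫⁻ y, k (x - y) * g y ^ p) ^ (1 / p)) ^ p := by gcongr
      _ = _ := by
        rw [ENNReal.mul_rpow_of_nonneg _ _ hp0.le, ← ENNReal.rpow_mul, ← ENNReal.rpow_mul, hexp,
          one_div_mul_cancel hp0.ne', ENNReal.rpow_one]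
  calc _ ≤ ∫⁻ x, (∫⁻ x, k x) ^ (p - 1) * ∫⁻ y, k (x - y) * g y ^ p := lintegral_mono hpt
    _ = (∫⁻ x, k x) ^ (p - 1) * ((∫⁻ x, k x) * ∫⁻ y, g y ^ p) := by
      rw [lintegral_const_mul _ (by fun_prop), lintegral_lintegral_conv_eq hk (by fun_prop)]
    _ = _ := by
      rw [← mul_assoc]
      congr 1
      nth_rewrite 2 [← ENNReal.rpow_one (∫⁻ x, k x)]
      rw [← ENNReal.rpow_add_of_nonneg _ _ (by linarith) zero_le_one]
      congr 1; ring

theorem eLpNorm_lintegral_conv_le {k g : V → ℝ≥0∞} (hk : Measurable k) (hg : Measurable g)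
    {p : ℝ≥0∞} (hp : 1 ≤ p) :
    eLpNorm (fun x => ∫⁻ y, k (x - y) * g y) p volume ≤ (∫⁻ x, k x) * eLpNorm g p volume := by
  have hp0 : p ≠ 0 := (zero_lt_one.trans_le hp).ne'
  by_cases hpt : p = ⊤
  · subst hpt
    rw [eLpNorm_exponent_top, eLpNorm_exponent_top]
    refine eLpNormEssSup_le_of_ae_enorm_bound (ae_of_all _ fun x => ?_)
    have h : ∀ᵐ y, g y ≤ eLpNormEssSup g volume := enorm_ae_le_eLpNormEssSup g volume
    calc _ ≤ ∫⁻ y, k (x - y) * eLpNormEssSup g volume := by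
          simp only [enorm_eq_self]
          refine lintegral_mono_ae ?_
          filter_upwards [h] with y hy
          gcongr
      _ = _ := by rw [lintegral_mul_const _ (by fun_prop), lintegral_sub_left_eq_self]
  · have hr : 1 ≤ p.toReal := by
      rw [← ENNReal.toReal_one]; exact ENNReal.toReal_mono hpt hp
    rw [eLpNorm_eq_lintegral_rpow_enorm_toReal hp0 hpt,
      eLpNorm_eq_lintegral_rpow_enorm_toReal hp0 hpt]
    simp only [enorm_eq_self]
    calc _ ≤ ((∫⁻ x, k x) ^ p.toReal * ∫⁻ y, g y ^ p.toReal) ^ (1 / p.toReal) := by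
          gcongr; exact lintegral_conv_rpow_le hk hg hr
      _ = _ := by
        rw [ENNReal.mul_rpow_of_nonneg _ _ (by positivity), ← ENNReal.rpow_mul,
          mul_one_div_cancel (by linarith), ENNReal.rpow_one]

/-- The convolution of `K` and `h`, defined pointwise by an integral. -/
noncomputable def convFun (K h : V → ℂ) (x : V) : ℂ := ∫ y, K (x - y) * h y

theorem convFun_congr_ae {K h h' : V → ℂ} (hh : h =ᵐ[volume] h') :
    convFun K h = convFun K h' := by
  funext x
  refine integral_congr_ae ?_
  filter_upwards [hh] with y hy
  rw [hy]

theorem enorm_convFun_le (K h : V → ℂ) (x : V) :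
    ‖convFun K h x‖ₑ ≤ ∫⁻ y, ‖K (x - y)‖ₑ * ‖h y‖ₑ := by
  refine (enorm_integral_le_lintegral_enorm _).trans_eq ?_
  simp_rw [enorm_mul]

theorem stronglyMeasurable_convFun {K h : V → ℂ} (hK : Continuous K) (hh : StronglyMeasurable h) :
    StronglyMeasurable (convFun K h) := by
  refine StronglyMeasurable.integral_prod_right (f := fun x y => K (x - y) * h y) ?_
  exact ((hK.comp (continuous_fst.sub continuous_snd)).stronglyMeasurable).mul
    (hh.comp_measurable measurable_snd)

theorem aestronglyMeasurable_convFun {K h : V → ℂ} (hK : Continuous K)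
    (hh : AEStronglyMeasurable h volume) : AEStronglyMeasurable (convFun K h) volume := by
  rw [convFun_congr_ae hh.ae_eq_mk]
  exact (stronglyMeasurable_convFun hK hh.stronglyMeasurable_mk).aestronglyMeasurable

theorem eLpNorm_enorm_conv_le {K h : V → ℂ} (hK : Continuous K)
    (hh : AEStronglyMeasurable h volume) {p : ℝ≥0∞} (hp : 1 ≤ p) :
    eLpNorm (fun x => ∫⁻ y, ‖K (x - y)‖ₑ * ‖h y‖ₑ) p volume ≤
      (∫⁻ x, ‖K x‖ₑ) * eLpNorm h p volume := by
  have h1 : ∀ x, ∫⁻ y, ‖K (x - y)‖ₑ * ‖h y‖ₑ = ∫⁻ y, ‖K (x - y)‖ₑ * ‖hh.mk h y‖ₑ := by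
    intro x
    refine lintegral_congr_ae ?_
    filter_upwards [hh.ae_eq_mk] with y hy
    rw [← hy]
  simp_rw [h1]
  refine (eLpNorm_lintegral_conv_le (k := fun x => ‖K x‖ₑ) (g := fun y => ‖hh.mk h y‖ₑ)
    (by fun_prop) hh.stronglyMeasurable_mk.enorm hp).trans_eq ?_
  rw [eLpNorm_enorm, eLpNorm_congr_ae hh.ae_eq_mk]

theorem eLpNorm_convFun_le {K h : V → ℂ} (hK : Continuous K)
    (hh : AEStronglyMeasurable h volume) {p : ℝ≥0∞} (hp : 1 ≤ p) :
    eLpNorm (convFun K h) p volume ≤ (∫⁻ x, ‖K x‖ₑ) * eLpNorm h p volume := by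
  refine le_trans ?_ (eLpNorm_enorm_conv_le hK hh hp)
  rw [← eLpNorm_enorm (convFun K h)]
  exact eLpNorm_mono_enorm fun x => by simpa using enorm_convFun_le K h x

theorem memLp_convFun {K h : V → ℂ} (hK : Continuous K) (hKi : Integrable K)
    {p : ℝ≥0∞} (hp : 1 ≤ p) (hh : MemLp h p volume) : MemLp (convFun K h) p volume :=
  ⟨aestronglyMeasurable_convFun hK hh.1, (eLpNorm_convFun_le hK hh.1 hp).trans_lt
    (ENNReal.mul_lt_top hKi.2 hh.2)⟩

/-- Young's inequality for `|K|` and `|h|` puts their convolution in `L^p`, so it is finite almost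
everywhere. Additivity of the operator on `L^p` and Fubini both rest on this. -/
theorem ae_integrable_conv {K h : V → ℂ} (hK : Continuous K) (hKi : Integrable K)
    {p : ℝ≥0∞} (hp : 1 ≤ p) (hh : MemLp h p volume) :
    ∀ᵐ x, Integrable fun y => K (x - y) * h y := by
  have h1 := (eLpNorm_enorm_conv_le hK hh.1 hp).trans_lt (ENNReal.mul_lt_top hKi.2 hh.2)
  have h2 : ∀ᵐ x, ∫⁻ y, ‖K (x - y)‖ₑ * ‖h y‖ₑ < ⊤ := by
    have h3 : AEStronglyMeasurable (fun x => ∫⁻ y, ‖K (x - y)‖ₑ * ‖h y‖ₑ) volume := by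
      have h1 : ∀ x, ∫⁻ y, ‖K (x - y)‖ₑ * ‖h y‖ₑ = ∫⁻ y, ‖K (x - y)‖ₑ * ‖hh.1.mk h y‖ₑ := by
        intro x
        refine lintegral_congr_ae ?_
        filter_upwards [hh.1.ae_eq_mk] with y hy
        rw [← hy]
      simp_rw [h1]
      have := hh.1.stronglyMeasurable_mk.enorm
      exact (Measurable.lintegral_prod_right' (f := fun z : V × V => ‖K (z.1 - z.2)‖ₑ *
        ‖hh.1.mk h z.2‖ₑ) ((hK.measurable.comp (measurable_fst.sub measurable_snd)).enorm.mul
        (this.comp measurable_snd))).aestronglyMeasurable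
    have hp0 : p ≠ 0 := (zero_lt_one.trans_le hp).ne'
    by_cases hpt : p = ⊤
    · subst hpt
      rw [eLpNorm_exponent_top] at h1
      filter_upwards [enorm_ae_le_eLpNormEssSup
        (fun x => ∫⁻ y, ‖K (x - y)‖ₑ * ‖h y‖ₑ) volume] with x hx
      exact hx.trans_lt h1
    · have h4 := lintegral_rpow_enorm_lt_top_of_eLpNorm_lt_top hp0 hpt h1
      have h5 := ae_lt_top' (h3.enorm.pow_const _) h4.ne
      filter_upwards [h5] with x hx
      simp only [enorm_eq_self] at hx
      by_contra hcon
      rw [not_lt, top_le_iff] at hcon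
      rw [hcon, ENNReal.top_rpow_of_pos (ENNReal.toReal_pos hp0 hpt)] at hx
      exact lt_irrefl _ hx
  filter_upwards [h2] with x hx
  refine ⟨((hK.comp (continuous_const.sub continuous_id)).aestronglyMeasurable).mul hh.1, ?_⟩
  simpa [hasFiniteIntegral_iff_enorm, enorm_mul] using hx

/-- Convolution with a continuous integrable kernel as an operator on `L^p`. -/
noncomputable def convLp (K : V → ℂ) (hK : Continuous K) (hKi : Integrable K)
    (p : ℝ≥0∞) [hp : Fact (1 ≤ p)] :
    Lp ℂ p (volume : Measure V) →L[ℂ] Lp ℂ p (volume : Measure V) :=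
  LinearMap.mkContinuous
    { toFun := fun h => (memLp_convFun hK hKi hp.out (Lp.memLp h)).toLp _
      map_add' := fun f g => by
        rw [← MemLp.toLp_add, MemLp.toLp_eq_toLp_iff]
        filter_upwards [ae_integrable_conv hK hKi hp.out (Lp.memLp f),
          ae_integrable_conv hK hKi hp.out (Lp.memLp g)] with x hf hg
        rw [convFun_congr_ae (Lp.coeFn_add f g)]
        simp only [convFun, Pi.add_apply, mul_add]
        exact integral_add hf hg
      map_smul' := fun c f => by
        rw [RingHom.id_apply, ← MemLp.toLp_const_smul, MemLp.toLp_eq_toLp_iff]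
        refine ae_of_all _ fun x => ?_
        rw [convFun_congr_ae (Lp.coeFn_smul c f)]
        simp only [convFun, Pi.smul_apply, smul_eq_mul, ← integral_const_mul]
        congr 1; funext y; ring }
    (∫ x, ‖K x‖) fun h => by
      simp only [LinearMap.coe_mk, AddHom.coe_mk, Lp.norm_toLp]
      rw [Lp.norm_def, ← ENNReal.toReal_ofReal (integral_nonneg fun x => norm_nonneg (K x)),
        ← ENNReal.toReal_mul, ofReal_integral_norm_eq_lintegral_enorm hKi]
      exact ENNReal.toReal_mono (ENNReal.mul_ne_top hKi.2.ne (Lp.eLpNorm_ne_top h))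
        (eLpNorm_convFun_le hK (Lp.aestronglyMeasurable h) hp.out)

variable {K : V → ℂ} (hK : Continuous K) (hKi : Integrable K) (p : ℝ≥0∞) [hp : Fact (1 ≤ p)]

theorem coeFn_convLp (h : Lp ℂ p (volume : Measure V)) :
    convLp K hK hKi p h =ᵐ[volume] convFun K h :=
  MemLp.coeFn_toLp (memLp_convFun hK hKi hp.out (Lp.memLp h))

theorem norm_convLp_le (h : Lp ℂ p (volume : Measure V)) :
    ‖convLp K hK hKi p h‖ ≤ (∫ x, ‖K x‖) * ‖h‖ :=
  LinearMap.mkContinuous_norm_le _ (integral_nonneg fun x => norm_nonneg (K x)) _ |>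
    (convLp K hK hKi p).le_of_opNorm_le <| h

end Young

/-! ### The Riesz–Thorin theorem for finite bilinear forms -/

section RieszThorin

/-- The analytic family `|a|^z · a / |a|`. -/
noncomputable def anFamily (a z : ℂ) : ℂ := Complex.exp (Real.log ‖a‖ * z) * (a / ‖a‖)

theorem anFamily_zero (z : ℂ) : anFamily 0 z = 0 := by simp [anFamily]

theorem norm_anFamily {a : ℂ} (ha : a ≠ 0) (z : ℂ) : ‖anFamily a z‖ = ‖a‖ ^ z.re := by
  have h : 0 < ‖a‖ := norm_pos_iff.2 ha
  rw [anFamily, norm_mul, Complex.norm_exp, norm_div, Complex.norm_real, norm_norm,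
    div_self h.ne', mul_one, Real.rpow_def_of_pos h]
  simp

/-- Only an inequality at `a = 0`: the left side vanishes there, while `0 ^ 0 = 1` on the line `z.re
= 0`. -/
theorem norm_anFamily_le (a z : ℂ) : ‖anFamily a z‖ ≤ ‖a‖ ^ z.re := by
  rcases eq_or_ne a 0 with rfl | ha
  · rw [anFamily_zero, norm_zero]; positivity
  · exact (norm_anFamily ha z).le

theorem anFamily_one (a : ℂ) : anFamily a 1 = a := by
  rcases eq_or_ne a 0 with rfl | ha
  · exact anFamily_zero 1
  · have h : 0 < ‖a‖ := norm_pos_iff.2 ha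
    rw [anFamily, mul_one, ← Complex.ofReal_exp, Real.exp_log h,
      mul_div_cancel₀ _ (by exact_mod_cast h.ne')]

theorem differentiable_anFamily (a : ℂ) : Differentiable ℂ (anFamily a) := by
  unfold anFamily; fun_prop

theorem norm_anFamily_le_exp {a z : ℂ} {R : ℝ} (hz : |z.re| ≤ R) :
    ‖anFamily a z‖ ≤ Real.exp (|Real.log ‖a‖| * R) := by
  rcases eq_or_ne a 0 with rfl | ha
  · rw [anFamily_zero, norm_zero]; positivity
  · rw [norm_anFamily ha, Real.rpow_def_of_pos (norm_pos_iff.2 ha)]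
    refine Real.exp_le_exp.2 ((le_abs_self _).trans ?_)
    rw [abs_mul]
    gcongr

variable {ι κ : Type*} [Fintype ι] [Fintype κ]

/-- Hadamard's three lines theorem for an analytic deformation of the coefficients. On `Re z = 0`
the deformed pair lies in the unit balls of `L¹` and `L^∞`, on `Re z = 1` in those of `L²` and `L²`.
-/
theorem norm_sum_sum_le_of_normalized {μ : ι → ℝ} {ν : κ → ℝ} {N : ι → κ → ℂ} {A B : ℝ}
    (hμ : ∀ i, 0 ≤ μ i) (hν : ∀ j, 0 ≤ ν j) (hA : 0 ≤ A) (hB : 0 ≤ B)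
    (h1 : ∀ (c : ι → ℂ) (e : κ → ℂ), (∀ j, ‖e j‖ ≤ 1) →
      ‖∑ i, ∑ j, c i * e j * N i j‖ ≤ A * ∑ i, ‖c i‖ * μ i)
    (h2 : ∀ (c : ι → ℂ) (e : κ → ℂ), ‖∑ i, ∑ j, c i * e j * N i j‖ ≤
      B * √(∑ i, ‖c i‖ ^ 2 * μ i) * √(∑ j, ‖e j‖ ^ 2 * ν j))
    {p q : ℝ} (hpq : p.HolderConjugate q) (hp2 : p < 2) (c : ι → ℂ) (e : κ → ℂ)
    (hc : ∑ i, ‖c i‖ ^ p * μ i ≤ 1) (he : ∑ j, ‖e j‖ ^ q * ν j ≤ 1) :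
    ‖∑ i, ∑ j, c i * e j * N i j‖ ≤ A ^ (2 / p - 1) * B ^ (2 / q) := by
  have hp0 : 0 < p := hpq.pos
  have hq0 : 0 < q := hpq.symm.pos
  have hinv := hpq.inv_add_inv_eq_one
  have hq2 : 2 / q ≤ 1 := by
    have : (2 : ℝ)⁻¹ ≤ p⁻¹ := (inv_le_inv₀ two_pos hp0).2 hp2.le
    rw [div_eq_mul_inv]; linarith
  -- The exponents `p(1 - z/2)` and `qz/2` are both `1` at `z = 2/q`, where `F` is the original
  -- form; `p < 2` puts this point in the strip.
  set F : ℂ → ℂ := fun z => ∑ i, ∑ j, anFamily (c i) (p * (1 - z / 2)) *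
    anFamily (e j) (q * z / 2) * N i j with hF
  have hre1 : ∀ z : ℂ, ((p : ℂ) * (1 - z / 2)).re = p * (1 - z.re / 2) := fun z => by
    have : z / 2 = ((1 / 2 : ℝ) : ℂ) * z := by push_cast; ring
    simp [this]; left; ring
  have hre2 : ∀ z : ℂ, ((q : ℂ) * z / 2).re = q * z.re / 2 := fun z => by
    have : (q : ℂ) * z / 2 = ((q / 2 : ℝ) : ℂ) * z := by push_cast; ring
    simp [this]; ring
  have hval : F (2 / q : ℝ) = ∑ i, ∑ j, c i * e j * N i j := by
    have e1 : (p : ℂ) * (1 - ((2 / q : ℝ) : ℂ) / 2) = 1 := by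
      have : p * (1 - 2 / q / 2) = 1 := by
        have : 2 / q / 2 = 1 - p⁻¹ := by rw [← hinv]; field_simp; ring
        rw [this]; field_simp; ring
      exact_mod_cast this
    have e2 : (q : ℂ) * ((2 / q : ℝ) : ℂ) / 2 = 1 := by
      have : q * (2 / q) / 2 = 1 := by field_simp
      exact_mod_cast this
    simp only [hF, e1, e2, anFamily_one]
  have hdiff : Differentiable ℂ F := by
    have d1 : ∀ i, Differentiable ℂ fun z : ℂ => anFamily (c i) (p * (1 - z / 2)) := fun i =>
      (differentiable_anFamily (c i)).comp (by fun_prop)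
    have d2 : ∀ j, Differentiable ℂ fun z : ℂ => anFamily (e j) (q * z / 2) := fun j =>
      (differentiable_anFamily (e j)).comp (by fun_prop)
    refine Differentiable.fun_sum fun i _ => Differentiable.fun_sum fun j _ => ?_
    exact ((d1 i).mul (d2 j)).mul_const _
  have key := Complex.HadamardThreeLines.norm_le_interp_of_mem_verticalClosedStrip₀₁' F
    (z := ((2 / q : ℝ) : ℂ)) (a := A) (b := B) ?_ hdiff.diffContOnCl ?_ ?_ ?_
  · rw [hval, Complex.ofReal_re] at key
    refine key.trans_eq ?_
    congr 2
    rw [div_eq_mul_inv, div_eq_mul_inv]; linarith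
  · exact ⟨by rw [Complex.ofReal_re]; positivity, by rw [Complex.ofReal_re]; exact hq2⟩
  · refine ⟨∑ i, ∑ j, Real.exp (|Real.log ‖c i‖| * p) * Real.exp (|Real.log ‖e j‖| * q) *
      ‖N i j‖, ?_⟩
    rintro _ ⟨z, hz, rfl⟩
    have hz0 : 0 ≤ z.re := hz.1
    have hz1 : z.re ≤ 1 := hz.2
    refine (norm_sum_le _ _).trans (Finset.sum_le_sum fun i _ => (norm_sum_le _ _).trans
      (Finset.sum_le_sum fun j _ => ?_))
    rw [norm_mul, norm_mul]
    have b1 := norm_anFamily_le_exp (a := c i) (z := p * (1 - z / 2)) (R := p) (by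
      rw [hre1, abs_of_nonneg (by nlinarith)]; nlinarith)
    have b2 := norm_anFamily_le_exp (a := e j) (z := q * z / 2) (R := q) (by
      rw [hre2, abs_of_nonneg (by positivity)]; nlinarith)
    gcongr
  · intro z hz
    have hz0 : z.re = 0 := hz
    refine (h1 _ _ fun j => ?_).trans ?_
    · refine (norm_anFamily_le _ _).trans_eq ?_
      rw [hre2, hz0]; simp
    · refine mul_le_of_le_one_right hA (le_trans (Finset.sum_le_sum fun i _ => ?_) hc)
      refine mul_le_mul_of_nonneg_right ((norm_anFamily_le _ _).trans_eq ?_) (hμ i)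
      rw [hre1, hz0]; simp
  · intro z hz
    have hz1 : z.re = 1 := hz
    have s1 : √(∑ i, ‖anFamily (c i) (p * (1 - z / 2))‖ ^ 2 * μ i) ≤ 1 := by
      rw [Real.sqrt_le_iff, one_pow]
      refine ⟨zero_le_one, ?_⟩
      refine le_trans (Finset.sum_le_sum fun i _ => ?_) hc
      refine mul_le_mul_of_nonneg_right ?_ (hμ i)
      refine (pow_le_pow_left₀ (norm_nonneg _) (norm_anFamily_le _ _) 2).trans_eq ?_
      rw [hre1, hz1, ← Real.rpow_natCast, ← Real.rpow_mul (norm_nonneg _)]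
      congr 1; push_cast; ring
    have s2 : √(∑ j, ‖anFamily (e j) (q * z / 2)‖ ^ 2 * ν j) ≤ 1 := by
      rw [Real.sqrt_le_iff, one_pow]
      refine ⟨zero_le_one, ?_⟩
      refine le_trans (Finset.sum_le_sum fun j _ => ?_) he
      refine mul_le_mul_of_nonneg_right ?_ (hν j)
      refine (pow_le_pow_left₀ (norm_nonneg _) (norm_anFamily_le _ _) 2).trans_eq ?_
      rw [hre2, hz1, ← Real.rpow_natCast, ← Real.rpow_mul (norm_nonneg _)]
      congr 1; push_cast; ring
    refine (h2 _ _).trans ?_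
    calc _ ≤ B * 1 * 1 := by gcongr
      _ = B := by ring

/-- The Riesz–Thorin interpolation theorem between `L¹ × L^∞` and `L² × L²`, for finite forms. -/
theorem norm_sum_sum_le_interpolation {μ : ι → ℝ} {ν : κ → ℝ} {N : ι → κ → ℂ} {A B : ℝ}
    (hμ : ∀ i, 0 < μ i) (hν : ∀ j, 0 < ν j) (hA : 0 ≤ A) (hB : 0 ≤ B)
    (h1 : ∀ (c : ι → ℂ) (e : κ → ℂ), (∀ j, ‖e j‖ ≤ 1) →
      ‖∑ i, ∑ j, c i * e j * N i j‖ ≤ A * ∑ i, ‖c i‖ * μ i)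
    (h2 : ∀ (c : ι → ℂ) (e : κ → ℂ), ‖∑ i, ∑ j, c i * e j * N i j‖ ≤
      B * √(∑ i, ‖c i‖ ^ 2 * μ i) * √(∑ j, ‖e j‖ ^ 2 * ν j))
    {p q : ℝ} (hpq : p.HolderConjugate q) (hp2 : p < 2) (c : ι → ℂ) (e : κ → ℂ) :
    ‖∑ i, ∑ j, c i * e j * N i j‖ ≤ A ^ (2 / p - 1) * B ^ (2 / q) *
      (∑ i, ‖c i‖ ^ p * μ i) ^ (1 / p) * (∑ j, ‖e j‖ ^ q * ν j) ^ (1 / q) := by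
  have hp0 : 0 < p := hpq.pos
  have hq0 : 0 < q := hpq.symm.pos
  set S := ∑ i, ‖c i‖ ^ p * μ i with hS
  set T := ∑ j, ‖e j‖ ^ q * ν j with hT
  have hS0 : 0 ≤ S := Finset.sum_nonneg fun i _ => mul_nonneg (by positivity) (hμ i).le
  have hT0 : 0 ≤ T := Finset.sum_nonneg fun j _ => mul_nonneg (by positivity) (hν j).le
  -- Degenerate cases, where normalisation would divide by zero. The weights are strictly positive,
  -- so a vanishing norm forces vanishing coefficients.
  rcases hS0.eq_or_lt with h0 | hSpos
  · have : ∀ i, c i = 0 := fun i => by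
      have := (Finset.sum_eq_zero_iff_of_nonneg (fun i _ =>
        mul_nonneg (by positivity) (hμ i).le)).1 (hS ▸ h0.symm) i (Finset.mem_univ i)
      rcases mul_eq_zero.1 this with h | h
      · rw [Real.rpow_eq_zero (norm_nonneg _) hp0.ne'] at h; exact norm_eq_zero.1 h
      · exact absurd h (hμ i).ne'
    simp only [this, zero_mul, Finset.sum_const_zero, norm_zero]
    positivity
  rcases hT0.eq_or_lt with h0 | hTpos
  · have : ∀ j, e j = 0 := fun i => by
      have := (Finset.sum_eq_zero_iff_of_nonneg (fun i _ =>
        mul_nonneg (by positivity) (hν i).le)).1 (hT ▸ h0.symm) i (Finset.mem_univ i)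
      rcases mul_eq_zero.1 this with h | h
      · rw [Real.rpow_eq_zero (norm_nonneg _) hq0.ne'] at h; exact norm_eq_zero.1 h
      · exact absurd h (hν i).ne'
    simp only [this, zero_mul, mul_zero, Finset.sum_const_zero, norm_zero]
    positivity
  set a := S ^ (1 / p) with ha
  set b := T ^ (1 / q) with hb
  have ha0 : 0 < a := by positivity
  have hb0 : 0 < b := by positivity
  have hap : a ^ p = S := by rw [ha, ← Real.rpow_mul hS0, one_div_mul_cancel hp0.ne', Real.rpow_one]
  have hbq : b ^ q = T := by rw [hb, ← Real.rpow_mul hT0, one_div_mul_cancel hq0.ne', Real.rpow_one]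
  have key := norm_sum_sum_le_of_normalized (fun i => (hμ i).le) (fun j => (hν j).le) hA hB h1 h2
    hpq hp2 (fun i => c i / a) (fun j => e j / b) ?_ ?_
  · have : ∑ i, ∑ j, c i / a * (e j / b) * N i j = (∑ i, ∑ j, c i * e j * N i j) / (a * b) := by
      simp_rw [Finset.sum_div]
      refine Finset.sum_congr rfl fun i _ => Finset.sum_congr rfl fun j _ => ?_
      ring
    rw [this, norm_div, norm_mul, Complex.norm_real, Complex.norm_real, Real.norm_of_nonneg ha0.le,
      Real.norm_of_nonneg hb0.le, div_le_iff₀ (by positivity)] at key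
    linarith
  · have : ∀ i, ‖c i / (a : ℂ)‖ ^ p * μ i = ‖c i‖ ^ p * μ i / S := fun i => by
      rw [norm_div, Complex.norm_real, Real.norm_of_nonneg ha0.le,
        Real.div_rpow (norm_nonneg _) ha0.le, hap]; ring
    simp_rw [this]
    rw [← Finset.sum_div, ← hS, div_self hSpos.ne']
  · have : ∀ j, ‖e j / (b : ℂ)‖ ^ q * ν j = ‖e j‖ ^ q * ν j / T := fun i => by
      rw [norm_div, Complex.norm_real, Real.norm_of_nonneg hb0.le,
        Real.div_rpow (norm_nonneg _) hb0.le, hbq]; ring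
    simp_rw [this]
    rw [← Finset.sum_div, ← hT, div_self hTpos.ne']

end RieszThorin

/-! ### Plancherel's theorem for convolution operators -/

section Plancherel

variable {V : Type*} [NormedAddCommGroup V] [InnerProductSpace ℝ V] [FiniteDimensional ℝ V]
  [MeasurableSpace V] [BorelSpace V]

theorem integral_fourier_mul_flip {f g : V → ℂ} (hf : Integrable f) (hg : Integrable g) :
    ∫ ξ, 𝓕 f ξ * g ξ = ∫ x, f x * 𝓕 g x := by
  have := VectorFourier.integral_fourierIntegral_smul_eq_flip (L := innerₗ V) (μ := volume)
    (ν := volume) Real.continuous_fourierChar continuous_inner hf hg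
  rwa [flip_innerₗ] at this

theorem continuous_fourier_of_integrable {f : V → ℂ} (hf : Integrable f) : Continuous (𝓕 f) :=
  VectorFourier.fourierIntegral_continuous Real.continuous_fourierChar
    (by exact continuous_inner) hf

theorem continuous_fourierInv_of_integrable {f : V → ℂ} (hf : Integrable f) :
    Continuous (𝓕⁻ f) := by
  have : 𝓕⁻ f = fun x => 𝓕 f (-x) := funext fun x => Real.fourierInv_eq_fourier_neg f x
  rw [this]
  exact (continuous_fourier_of_integrable hf).comp continuous_neg

theorem norm_fourier_le_integral (f : V → ℂ) (x : V) : ‖𝓕 f x‖ ≤ ∫ y, ‖f y‖ :=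
  VectorFourier.norm_fourierIntegral_le_integral_norm _ _ _ _ _

theorem integral_fourierInv_mul_flip {f g : V → ℂ} (hf : Integrable f) (hg : Integrable g) :
    ∫ ξ, 𝓕⁻ f ξ * g ξ = ∫ x, f x * 𝓕⁻ g x := by
  have h1 : ∀ ξ, 𝓕⁻ f ξ = 𝓕 (fun x => f (-x)) ξ := fun ξ => by
    rw [Real.fourierInv_eq_fourier_comp_neg]
  simp_rw [h1]
  rw [integral_fourier_mul_flip hf.comp_neg hg,
    ← integral_neg_eq_self (fun x => f (-x) * 𝓕 g x) volume]
  simp_rw [neg_neg, Real.fourierInv_eq_fourier_neg]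

/-- The `L²` transform and the Fourier integral define the same distribution; testing against smooth
compactly supported functions identifies them almost everywhere. -/
theorem fourierInv_toLp_ae_eq {w : V → ℂ} (hw : Integrable w) (hw2 : MemLp w 2 volume) :
    ((𝓕⁻ (hw2.toLp w) : Lp ℂ 2 (volume : Measure V)) : V → ℂ) =ᵐ[volume] 𝓕⁻ w := by
  refine ae_eq_of_integral_contDiff_smul_eq ?_ ?_ ?_
  · exact (Lp.memLp _).locallyIntegrable one_le_two
  · exact (continuous_fourierInv_of_integrable hw).locallyIntegrable
  · intro g hg hgc
    have hg₁ : HasCompactSupport (Complex.ofRealCLM ∘ g) := hgc.comp_left rfl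
    have hg₂ : ContDiff ℝ ∞ (Complex.ofRealCLM ∘ g) := by fun_prop
    set u : 𝓢(V, ℂ) := hg₁.toSchwartzMap hg₂ with hu
    have hu' : ∀ x, u x = (g x : ℂ) := fun x => rfl
    have h1 := congrArg (fun T : 𝓢'(V, ℂ) => T u) (Lp.fourierInv_toTemperedDistribution_eq
      (hw2.toLp w))
    simp only [TemperedDistribution.fourierInv_apply, Lp.toTemperedDistribution_apply,
      hu', smul_eq_mul] at h1
    simp only [Complex.real_smul]
    rw [← h1]
    have h2 : ∫ x, (𝓕⁻ u : 𝓢(V, ℂ)) x * (hw2.toLp w) x = ∫ x, 𝓕⁻ (u : V → ℂ) x * w x := by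
      refine integral_congr_ae ?_
      filter_upwards [hw2.coeFn_toLp] with x hx
      rw [hx, SchwartzMap.fourierInv_coe]
    rw [h2, integral_fourierInv_mul_flip u.integrable hw]
    rfl

theorem eLpNorm_fourierInv_two {w : V → ℂ} (hw : Integrable w) (hw2 : MemLp w 2 volume) :
    eLpNorm (𝓕⁻ w) 2 volume = eLpNorm w 2 volume := by
  rw [← eLpNorm_congr_ae (fourierInv_toLp_ae_eq hw hw2), ← Lp.enorm_def,
    ← Lp.enorm_toLp hw2]
  have : ‖𝓕⁻ (hw2.toLp w)‖ = ‖hw2.toLp w‖ := by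
    rw [← Lp.norm_fourier_eq, FourierTransform.fourier_fourierInv_eq]
  rw [← ofReal_norm, ← ofReal_norm, this]

theorem eLpNorm_fourier_two {w : V → ℂ} (hw : Integrable w) (hw2 : MemLp w 2 volume) :
    eLpNorm (𝓕 w) 2 volume = eLpNorm w 2 volume := by
  have h : 𝓕 w = (𝓕⁻ w) ∘ Neg.neg := funext fun x => by
    simp [Real.fourierInv_eq_fourier_neg]
  rw [h, eLpNorm_comp_measurePreserving
    (continuous_fourierInv_of_integrable hw).aestronglyMeasurable (Measure.measurePreserving_neg _),
    eLpNorm_fourierInv_two hw hw2]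

/-- The multiplication formula is applied to `u` and the symbol modulated by the character of `x`,
so the kernel itself need not be integrable. -/
theorem convFun_fourierInv_eq {m u : V → ℂ} (hm : Integrable m) (hu : Integrable u) (x : V) :
    convFun (𝓕⁻ m) u x = 𝓕⁻ (fun ξ => m ξ * 𝓕 u ξ) x := by
  have h1 : Integrable fun ξ => Real.fourierChar (inner ℝ ξ x) • m ξ := by
    have := (VectorFourier.fourierIntegral_convergent_iff (L := innerₗ V) (μ := volume) (f := m)
      Real.continuous_fourierChar continuous_inner (-x)).2 hm
    simpa using this
  have h2 := integral_fourier_mul_flip hu h1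
  rw [Real.fourierInv_eq]
  have h3 : ∀ ξ, Real.fourierChar (inner ℝ ξ x) • (m ξ * 𝓕 u ξ) =
      𝓕 u ξ * Real.fourierChar (inner ℝ ξ x) • m ξ := fun ξ => by
    rw [Circle.smul_def, Circle.smul_def, smul_eq_mul, smul_eq_mul]; ring
  simp_rw [h3]
  rw [h2, convFun]
  refine integral_congr_ae (ae_of_all _ fun y => ?_)
  simp only
  rw [mul_comm, Real.fourierInv_eq, Real.fourier_eq]
  congr 1
  refine integral_congr_ae (ae_of_all _ fun ξ => ?_)
  simp only
  rw [smul_smul, ← AddChar.map_add_eq_mul, inner_sub_right]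
  congr 3; ring

/-- The transpose of the convolution with `𝓕⁻ m`, applied to an integrable function. -/
theorem fourier_mul_fourierInv_eq {m u : V → ℂ} (hm : Integrable m) (hu : Integrable u) (y : V) :
    𝓕 (fun ξ => m ξ * 𝓕⁻ u ξ) y = ∫ x, 𝓕⁻ m (x - y) * u x := by
  have h1 : 𝓕 (fun ξ => m ξ * 𝓕⁻ u ξ) y = convFun (𝓕⁻ m) (fun x => u (-x)) (-y) := by
    rw [convFun_fourierInv_eq hm hu.comp_neg, Real.fourierInv_eq_fourier_neg, neg_neg,
      Real.fourierInv_eq_fourier_comp_neg]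
  rw [h1, convFun, ← integral_neg_eq_self (fun x => 𝓕⁻ m (x - y) * u x) volume]
  congr 1; funext x
  rw [show -y - x = -x - y by abel]

/-- The Fourier multiplier operator on `L^p` with an integrable symbol that has an integrable
kernel. -/
noncomputable def multLp {m : V → ℂ} (hm : Integrable m) (hK : Integrable (𝓕⁻ m)) (p : ℝ≥0∞) [Fact (1 ≤ p)] :
    Lp ℂ p (volume : Measure V) →L[ℂ] Lp ℂ p (volume : Measure V) :=
  convLp (𝓕⁻ m) (continuous_fourierInv_of_integrable hm) hK p

theorem coeFn_multLp {m : V → ℂ} (hm : Integrable m) (hK : Integrable (𝓕⁻ m)) (p : ℝ≥0∞)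
    [Fact (1 ≤ p)] (h : Lp ℂ p (volume : Measure V)) :
    multLp hm hK p h =ᵐ[volume] convFun (𝓕⁻ m) h :=
  coeFn_convLp (continuous_fourierInv_of_integrable hm) hK p h

theorem eLpNorm_mul_fourier_le {m : V → ℂ} (hm : Integrable m) {B : ℝ} (hmB : ∀ᵐ ξ, ‖m ξ‖ ≤ B)
    (u : 𝓢(V, ℂ)) :
    Integrable (fun ξ => m ξ * 𝓕 (u : V → ℂ) ξ) ∧
    AEStronglyMeasurable (fun ξ => m ξ * 𝓕 (u : V → ℂ) ξ) volume ∧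
    eLpNorm (fun ξ => m ξ * 𝓕 (u : V → ℂ) ξ) 2 volume ≤
      ENNReal.ofReal B * eLpNorm (u : V → ℂ) 2 volume := by
  have hu : Integrable (u : V → ℂ) := u.integrable
  have hwm : AEStronglyMeasurable (fun ξ => m ξ * 𝓕 (u : V → ℂ) ξ) volume :=
    hm.1.mul (continuous_fourier_of_integrable hu).aestronglyMeasurable
  refine ⟨?_, hwm, ?_⟩
  · refine Integrable.mono' (hm.norm.mul_const (∫ y, ‖u y‖)) hwm (ae_of_all _ fun ξ => ?_)
    rw [norm_mul]
    gcongr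
    exact norm_fourier_le_integral _ _
  · rw [← eLpNorm_fourier_two hu (u.memLp 2)]
    refine eLpNorm_le_mul_eLpNorm_of_ae_le_mul ?_ 2
    filter_upwards [hmB] with ξ hξ
    rw [norm_mul]
    gcongr

variable {m : V → ℂ} (hm : Integrable m) (hK : Integrable (𝓕⁻ m))

theorem norm_multLp_two_toLp_le {B : ℝ} (hB : 0 ≤ B) (hmB : ∀ᵐ ξ, ‖m ξ‖ ≤ B) (u : 𝓢(V, ℂ)) :
    ‖multLp hm hK 2 (u.toLp 2 volume)‖ ≤ B * ‖u.toLp 2 volume‖ := by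
  obtain ⟨hwi, hwm, hle⟩ := eLpNorm_mul_fourier_le hm hmB u
  have hw2 : MemLp (fun ξ => m ξ * 𝓕 (u : V → ℂ) ξ) 2 volume := by
    refine ⟨hwm, hle.trans_lt (ENNReal.mul_lt_top ENNReal.ofReal_lt_top ?_)⟩
    exact (u.memLp 2 volume).eLpNorm_lt_top
  have hT : multLp hm hK 2 (u.toLp 2 volume) =ᵐ[volume] 𝓕⁻ fun ξ => m ξ * 𝓕 (u : V → ℂ) ξ := by
    refine (coeFn_multLp hm hK 2 _).trans ?_
    rw [convFun_congr_ae (u.coeFn_toLp 2 volume)]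
    exact ae_of_all _ fun x => convFun_fourierInv_eq hm u.integrable x
  have h1 : eLpNorm (multLp hm hK 2 (u.toLp 2 volume)) 2 volume ≤
      ENNReal.ofReal B * eLpNorm (u.toLp 2 volume) 2 volume := by
    rw [eLpNorm_congr_ae hT, eLpNorm_fourierInv_two hwi hw2,
      eLpNorm_congr_ae (u.coeFn_toLp 2 volume)]
    exact hle
  have h2 := ENNReal.toReal_mono
    (ENNReal.mul_ne_top ENNReal.ofReal_ne_top (Lp.eLpNorm_ne_top _)) h1
  rw [ENNReal.toReal_mul, ENNReal.toReal_ofReal hB] at h2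
  rw [Lp.norm_def, Lp.norm_def]
  exact h2

theorem norm_multLp_two_le {B : ℝ} (hB : 0 ≤ B) (hmB : ∀ᵐ ξ, ‖m ξ‖ ≤ B)
    (h : Lp ℂ 2 (volume : Measure V)) : ‖multLp hm hK 2 h‖ ≤ B * ‖h‖ := by
  have hc : IsClosed {h : Lp ℂ 2 (volume : Measure V) | ‖multLp hm hK 2 h‖ ≤ B * ‖h‖} :=
    isClosed_le (multLp hm hK 2).continuous.norm (continuous_const.mul continuous_norm)
  have hd : DenseRange (SchwartzMap.toLpCLM ℝ ℂ 2 (volume : Measure V)) :=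
    SchwartzMap.denseRange_toLpCLM (by simp)
  exact hd.induction_on h hc fun u => norm_multLp_two_toLp_le hm hK hB hmB u

end Plancherel

/-! ### Interpolation of Fourier multipliers between `L^1`, `L^2` and `L^∞` -/

section Step

variable {α : Type*} {ι : Type*} [Fintype ι]

/-- The step function `∑ i, c i • 1_{A i}`. -/
noncomputable def stepFun (A : ι → Set α) (c : ι → ℂ) (x : α) : ℂ :=
  ∑ i, (A i).indicator (fun _ => c i) x

theorem stepFun_eq_sum_mul (A : ι → Set α) (c : ι → ℂ) (x : α) :
    stepFun A c x = ∑ i, c i * (A i).indicator (fun _ => 1) x := by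
  refine Finset.sum_congr rfl fun i _ => ?_
  by_cases h : x ∈ A i <;> simp [h]

theorem comp_stepFun {β : Type*} [AddCommMonoid β] {A : ι → Set α}
    (hd : Pairwise fun i j => Disjoint (A i) (A j)) (c : ι → ℂ) (φ : ℂ → β) (h0 : φ 0 = 0) (x : α) :
    φ (stepFun A c x) = ∑ i, (A i).indicator (fun _ => φ (c i)) x := by
  classical
  by_cases h : ∃ i, x ∈ A i
  · obtain ⟨i, hi⟩ := h
    have hne : ∀ j, j ≠ i → x ∉ A j := fun j hj hx =>
      Set.disjoint_left.1 (hd hj) hx hi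
    rw [stepFun, Finset.sum_eq_single i (fun j _ hj => by simp [hne j hj]) (by simp),
      Finset.sum_eq_single i (fun j _ hj => by simp [hne j hj]) (by simp)]
    simp [hi]
  · push Not at h
    simp [stepFun, h, h0]

theorem norm_stepFun_le {A : ι → Set α} (hd : Pairwise fun i j => Disjoint (A i) (A j))
    {c : ι → ℂ} {M : ℝ} (hM : 0 ≤ M) (hc : ∀ i, ‖c i‖ ≤ M) (x : α) : ‖stepFun A c x‖ ≤ M := by
  classical
  by_cases h : ∃ i, x ∈ A i
  · obtain ⟨i, hi⟩ := h
    have hne : ∀ j, j ≠ i → x ∉ A j := fun j hj hx =>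
      Set.disjoint_left.1 (hd hj) hx hi
    rw [stepFun, Finset.sum_eq_single i (fun j _ hj => by simp [hne j hj]) (by simp)]
    simpa [hi] using hc i
  · push Not at h
    simpa [stepFun, h] using hM

variable [MeasurableSpace α] {μ : Measure α}

theorem memLp_stepFun {A : ι → Set α} (hA : ∀ i, MeasurableSet (A i)) (hfin : ∀ i, μ (A i) ≠ ⊤)
    (c : ι → ℂ) (p : ℝ≥0∞) : MemLp (stepFun A c) p μ :=
  memLp_finsetSum _ fun i _ => memLp_indicator_const p (hA i) (c i) (Or.inr (hfin i))

theorem eLpNorm_stepFun {A : ι → Set α} (hA : ∀ i, MeasurableSet (A i))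
    (hfin : ∀ i, μ (A i) ≠ ⊤) (hd : Pairwise fun i j => Disjoint (A i) (A j)) (c : ι → ℂ)
    {p : ℝ≥0∞} (hp0 : p ≠ 0) (hpt : p ≠ ⊤) :
    eLpNorm (stepFun A c) p μ =
      ENNReal.ofReal ((∑ i, ‖c i‖ ^ p.toReal * μ.real (A i)) ^ (1 / p.toReal)) := by
  have hr : 0 < p.toReal := ENNReal.toReal_pos hp0 hpt
  rw [eLpNorm_eq_lintegral_rpow_enorm_toReal hp0 hpt,
    ← ENNReal.ofReal_rpow_of_nonneg (Finset.sum_nonneg fun i _ => by positivity) (by positivity)]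
  congr 1
  have h1 : ∀ x, ‖stepFun A c x‖ₑ ^ p.toReal =
      ∑ i, (A i).indicator (fun _ => ‖c i‖ₑ ^ p.toReal) x :=
    comp_stepFun hd c (fun z => ‖z‖ₑ ^ p.toReal) (by simp [hr])
  simp_rw [h1]
  rw [lintegral_finsetSum _ fun i _ => measurable_const.indicator (hA i),
    ENNReal.ofReal_sum_of_nonneg fun i _ => by positivity]
  refine Finset.sum_congr rfl fun i _ => ?_
  rw [lintegral_indicator_const (hA i), ENNReal.ofReal_mul (by positivity),
    ← ENNReal.ofReal_rpow_of_nonneg (norm_nonneg _) hr.le, ofReal_norm, Measure.real,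
    ENNReal.ofReal_toReal (hfin i)]

/-- Fibres of measure zero are dropped, because `norm_sum_sum_le_interpolation` needs strictly
positive weights. The equality is therefore only almost everywhere. -/
theorem exists_stepFun_ae_eq (f : SimpleFunc α ℂ) (hf : f.FinMeasSupp μ) :
    ∃ (s : Finset ℂ) (A : s → Set α) (c : s → ℂ), (∀ i, MeasurableSet (A i)) ∧
      (∀ i, μ (A i) ≠ ⊤) ∧ (∀ i, μ (A i) ≠ 0) ∧ (Pairwise fun i j => Disjoint (A i) (A j)) ∧
      f =ᵐ[μ] stepFun A c := by
  classical
  refine ⟨f.range.filter fun a => a ≠ 0 ∧ μ (f ⁻¹' {a}) ≠ 0, fun a => f ⁻¹' {a.1}, fun a => a.1,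
    fun a => f.measurableSet_fiber _, fun a => ?_, fun a => ?_, fun a b hab => ?_, ?_⟩
  · exact (hf.meas_preimage_singleton_ne_zero (Finset.mem_filter.1 a.2).2.1).ne
  · exact (Finset.mem_filter.1 a.2).2.2
  · refine Set.disjoint_left.2 fun x hx hy => hab (Subtype.ext ?_)
    rw [← show f x = a from hx, ← show f x = b from hy]
  · have h0 : ∀ᵐ x ∂μ, ∀ a ∈ f.range.filter fun a => μ (f ⁻¹' {a}) = 0, f x ≠ a := by
      refine (Finset.eventually_all _).2 fun a ha => ?_
      have := (Finset.mem_filter.1 ha).2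
      exact measure_eq_zero_iff_ae_notMem.1 this
    filter_upwards [h0] with x hx
    by_cases hz : f x = 0
    · rw [hz, stepFun]
      refine (Finset.sum_eq_zero fun a _ => Set.indicator_of_notMem (fun hxa => ?_) _).symm
      exact (Finset.mem_filter.1 a.2).2.1 (by rw [← show f x = a from hxa, hz])
    · have hm : μ (f ⁻¹' {f x}) ≠ 0 := fun h =>
        hx (f x) (Finset.mem_filter.2 ⟨f.mem_range_self x, h⟩) rfl
      have hmem : f x ∈ f.range.filter fun a => a ≠ 0 ∧ μ (f ⁻¹' {a}) ≠ 0 :=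
        Finset.mem_filter.2 ⟨f.mem_range_self x, hz, hm⟩
      rw [stepFun, Finset.sum_eq_single ⟨f x, hmem⟩ (fun b _ hb => ?_) (by simp)]
      · simp
      · refine Set.indicator_of_notMem (fun hxb => hb (Subtype.ext ?_)) _
        exact (show f x = b from hxb).symm

theorem enorm_integral_mul_le {F g : α → ℂ} (hF : AEStronglyMeasurable F μ)
    (hg : AEStronglyMeasurable g μ) (p q : ℝ≥0∞) [ENNReal.HolderConjugate p q] :
    ‖∫ x, F x * g x ∂μ‖ₑ ≤ eLpNorm F p μ * eLpNorm g q μ := by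
  refine (enorm_integral_le_lintegral_enorm _).trans ?_
  rw [← eLpNorm_one_eq_lintegral_enorm]
  have h := eLpNorm_smul_le_mul_eLpNorm (p := p) (q := q) (r := 1) hg hF
  rwa [show (F • g : α → ℂ) = fun x => F x * g x from rfl] at h

theorem norm_integral_mul_le {F g : α → ℂ} {p q : ℝ≥0∞} [ENNReal.HolderConjugate p q]
    (hF : MemLp F p μ) (hg : MemLp g q μ) {a b : ℝ} (ha : 0 ≤ a) (hb : 0 ≤ b)
    (hFa : eLpNorm F p μ ≤ ENNReal.ofReal a) (hgb : eLpNorm g q μ ≤ ENNReal.ofReal b) :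
    ‖∫ x, F x * g x ∂μ‖ ≤ a * b := by
  have h : ‖∫ x, F x * g x ∂μ‖ₑ ≤ ENNReal.ofReal (a * b) := by
    rw [ENNReal.ofReal_mul ha]
    refine (enorm_integral_mul_le hF.aestronglyMeasurable hg.aestronglyMeasurable p q).trans ?_
    gcongr
  rwa [← ofReal_norm, ENNReal.ofReal_le_ofReal_iff (mul_nonneg ha hb)] at h

/-- The converse of Hölder's inequality, tested on a dense set. -/
theorem norm_le_of_forall_integral_mul_le {p q : ℝ≥0∞} [Fact (1 ≤ p)] [Fact (1 ≤ q)]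
    [ENNReal.HolderConjugate p q] (hp1 : 1 < p) (hpt : p ≠ ⊤) (F : Lp ℂ p μ) {M : ℝ} (hM : 0 ≤ M)
    (h : ∀ g : Lp ℂ q μ, ‖∫ x, F x * g x ∂μ‖ ≤ M * ‖g‖) : ‖F‖ ≤ M := by
  have hp0 : p ≠ 0 := (zero_lt_one.trans hp1).ne'
  have hr1 : 1 < p.toReal := by
    rw [← ENNReal.toReal_one]; exact (ENNReal.toReal_lt_toReal ENNReal.one_ne_top hpt).2 hp1
  have hpq : p.toReal.HolderConjugate q.toReal := ENNReal.HolderConjugate.toReal hr1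
  have hq0 : q ≠ 0 := fun hq => by have := hpq.symm.pos; simp [hq] at this
  have hqt : q ≠ ⊤ := fun hq => by have := hpq.symm.pos; simp [hq] at this
  set r := p.toReal
  set r' := q.toReal
  have hr0 : 0 < r := hpq.pos
  -- The extremal function in Hölder's inequality: `F g = |F|^r` and `|g|^r' = |F|^r`.
  set g : α → ℂ := fun x => (starRingEnd ℂ) (F x) * ((‖F x‖ ^ (r - 2) : ℝ) : ℂ) with hg
  have hFm : AEStronglyMeasurable F μ := Lp.aestronglyMeasurable F
  have hgm : AEStronglyMeasurable g μ := by
    refine (Complex.continuous_conj.comp_aestronglyMeasurable hFm).mul ?_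
    exact (Complex.measurable_ofReal.comp_aemeasurable
      (hFm.norm.aemeasurable.pow_const _)).aestronglyMeasurable
  have hgn : ∀ x, ‖g x‖ = ‖F x‖ ^ (r - 1) := fun x => by
    rcases (norm_nonneg (F x)).eq_or_lt with h0 | h0
    · have : F x = 0 := norm_eq_zero.1 h0.symm
      rw [hg]; simp only [this, map_zero, zero_mul, norm_zero]
      rw [Real.zero_rpow (by linarith)]
    · rw [hg]; simp only [norm_mul, RCLike.norm_conj, Complex.norm_real]
      rw [Real.norm_of_nonneg (by positivity)]
      nth_rewrite 1 [← Real.rpow_one ‖F x‖]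
      rw [← Real.rpow_add h0]; congr 1; ring
  have hgq : ∀ x, ‖g x‖ ^ r' = ‖F x‖ ^ r := fun x => by
    rw [hgn, ← Real.rpow_mul (norm_nonneg _), hpq.sub_one_mul_conj]
  have hint : Integrable (fun x => ‖F x‖ ^ r) μ := (Lp.memLp F).integrable_norm_rpow hp0 hpt
  have hgL : MemLp g q μ := by
    rw [← integrable_norm_rpow_iff hgm hq0 hqt]
    refine hint.congr (ae_of_all _ fun x => (hgq x).symm)
  set S := ∫ x, ‖F x‖ ^ r ∂μ with hS
  have hS0 : 0 ≤ S := integral_nonneg fun x => by positivity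
  have h1 := h (hgL.toLp g)
  have h2 : ∫ x, F x * (hgL.toLp g) x ∂μ = (S : ℂ) := by
    rw [hS, ← integral_complex_ofReal]
    refine integral_congr_ae ?_
    filter_upwards [hgL.coeFn_toLp] with x hx
    rw [hx, hg]
    simp only
    rw [← mul_assoc, Complex.mul_conj, Complex.normSq_eq_norm_sq, ← Complex.ofReal_mul]
    congr 1
    rcases (norm_nonneg (F x)).eq_or_lt with h0 | h0
    · rw [← h0, Real.zero_rpow hr0.ne']; simp
    · rw [← Real.rpow_natCast, ← Real.rpow_add h0]; congr 1; push_cast; ring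
  have hFn : ‖F‖ = S ^ r⁻¹ := by
    rw [Lp.norm_def, (Lp.memLp F).eLpNorm_eq_integral_rpow_norm hp0 hpt,
      ENNReal.toReal_ofReal (by positivity)]
  have hgN : ‖hgL.toLp g‖ = S ^ r'⁻¹ := by
    rw [Lp.norm_toLp, hgL.eLpNorm_eq_integral_rpow_norm hq0 hqt,
      ENNReal.toReal_ofReal (by positivity)]
    congr 1
    exact integral_congr_ae (ae_of_all _ hgq)
  rw [h2, hgN, Complex.norm_real, Real.norm_of_nonneg hS0] at h1
  rcases hS0.eq_or_lt with h0 | hSpos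
  · rw [hFn, ← h0, Real.zero_rpow (inv_ne_zero hr0.ne')]
    exact hM
  · rw [hFn]
    have h3 : S = S ^ r⁻¹ * S ^ r'⁻¹ := by
      rw [← Real.rpow_add hSpos, hpq.inv_add_inv_eq_one, Real.rpow_one]
    have h4 : S ^ r⁻¹ * S ^ r'⁻¹ ≤ M * S ^ r'⁻¹ := h3 ▸ h1
    exact le_of_mul_le_mul_right h4 (by positivity)

end Step

section Interpolation

variable {V : Type*} [NormedAddCommGroup V] [InnerProductSpace ℝ V] [FiniteDimensional ℝ V]
  [MeasurableSpace V] [BorelSpace V]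

theorem convFun_stepFun {K : V → ℂ} (hKi : Integrable K) {ι : Type*} [Fintype ι] {A : ι → Set V}
    (hA : ∀ i, MeasurableSet (A i)) (c : ι → ℂ) (x : V) :
    convFun K (stepFun A c) x = ∑ i, c i * convFun K ((A i).indicator fun _ => 1) x := by
  have hint : ∀ i, Integrable fun y => K (x - y) * (A i).indicator (fun _ => (1 : ℂ)) y := by
    intro i
    refine ((hKi.comp_sub_left x).indicator (hA i)).congr (ae_of_all _ fun y => ?_)
    by_cases h : y ∈ A i <;> simp [h]
  simp only [convFun, stepFun_eq_sum_mul, Finset.mul_sum]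
  rw [integral_finsetSum]
  · refine Finset.sum_congr rfl fun i _ => ?_
    rw [← integral_const_mul]
    congr 1; funext y; ring
  · intro i _
    refine ((hint i).const_mul (c i)).congr (ae_of_all _ fun y => ?_)
    simp only; ring

variable {m : V → ℂ} (hm : Integrable m) (hK : Integrable (𝓕⁻ m))

include hm hK

/-- Exhibits the pairing as a finite bilinear form in the coefficients, the shape to which
Riesz–Thorin applies. -/
theorem integral_convFun_stepFun {ι κ : Type*} [Fintype ι] [Fintype κ]
    {A : ι → Set V} (hA : ∀ i, MeasurableSet (A i)) (hAf : ∀ i, volume (A i) ≠ ⊤)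
    {A' : κ → Set V} (hA' : ∀ i, MeasurableSet (A' i)) (c : ι → ℂ) (e : κ → ℂ) :
    ∫ x, convFun (𝓕⁻ m) (stepFun A c) x * stepFun A' e x =
      ∑ i, ∑ j, c i * e j * ∫ x, convFun (𝓕⁻ m) ((A i).indicator fun _ => 1) x *
        (A' j).indicator (fun _ => 1) x := by
  have hKc := continuous_fourierInv_of_integrable hm
  have hint : ∀ i j, Integrable fun x => convFun (𝓕⁻ m) ((A i).indicator fun _ => 1) x *
        (A' j).indicator (fun _ => (1 : ℂ)) x := by
    intro i j
    have h1 : Integrable (convFun (𝓕⁻ m) ((A i).indicator fun _ => 1)) :=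
      memLp_one_iff_integrable.1 (memLp_convFun hKc hK le_rfl
        (memLp_indicator_const 1 (hA i) 1 (Or.inr (hAf i))))
    refine (h1.indicator (hA' j)).congr (ae_of_all _ fun y => ?_)
    by_cases h : y ∈ A' j <;> simp [h]
  simp_rw [convFun_stepFun hK hA, stepFun_eq_sum_mul A' e, Finset.sum_mul_sum]
  rw [integral_finsetSum]
  · refine Finset.sum_congr rfl fun i _ => ?_
    rw [integral_finsetSum]
    · refine Finset.sum_congr rfl fun j _ => ?_
      rw [← integral_const_mul]
      congr 1; funext y; ring
    · intro j _
      refine ((hint i j).const_mul (c i * e j)).congr (ae_of_all _ fun y => ?_)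
      simp only; ring
  · intro i _
    refine integrable_finsetSum _ fun j _ => ?_
    refine ((hint i j).const_mul (c i * e j)).congr (ae_of_all _ fun y => ?_)
    simp only; ring

/-- The endpoint bounds are Young's inequality on `L¹` and `L^∞`, both with constant `a`, and
Plancherel with constant `B`. The exponent of `a` is the distance of `1/p` from `1/2`, doubled. -/
theorem norm_integral_convFun_stepFun_le {a B : ℝ} (ha : ∫ x, ‖𝓕⁻ m x‖ ≤ a) (hB : 0 ≤ B)
    (hmB : ∀ᵐ ξ, ‖m ξ‖ ≤ B) {p q : ℝ≥0∞} [ENNReal.HolderConjugate p q]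
    (hp1 : 1 < p.toReal) (hp2 : p.toReal ≠ 2) {ι κ : Type*} [Fintype ι] [Fintype κ]
    {A : ι → Set V} (hA : ∀ i, MeasurableSet (A i)) (hAf : ∀ i, volume (A i) ≠ ⊤)
    (hA0 : ∀ i, volume (A i) ≠ 0) (hAd : Pairwise fun i j => Disjoint (A i) (A j))
    {A' : κ → Set V} (hA' : ∀ i, MeasurableSet (A' i)) (hAf' : ∀ i, volume (A' i) ≠ ⊤)
    (hA0' : ∀ i, volume (A' i) ≠ 0) (hAd' : Pairwise fun i j => Disjoint (A' i) (A' j))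
    (c : ι → ℂ) (e : κ → ℂ) :
    ‖∫ x, convFun (𝓕⁻ m) (stepFun A c) x * stepFun A' e x‖ ≤
      a ^ |1 - 2 * (p⁻¹).toReal| * B ^ (1 - |1 - 2 * (p⁻¹).toReal|) *
        (∑ i, ‖c i‖ ^ p.toReal * volume.real (A i)) ^ (1 / p.toReal) *
        (∑ j, ‖e j‖ ^ q.toReal * volume.real (A' j)) ^ (1 / q.toReal) := by
  have hKc := continuous_fourierInv_of_integrable hm
  have ha0 : 0 ≤ a := (integral_nonneg fun x => norm_nonneg _).trans ha
  have haK : ∫⁻ x, ‖𝓕⁻ m x‖ₑ ≤ ENNReal.ofReal a := by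
    rw [← ofReal_integral_norm_eq_lintegral_enorm hK]
    exact ENNReal.ofReal_le_ofReal ha
  have hpq : p.toReal.HolderConjugate q.toReal := ENNReal.HolderConjugate.toReal hp1
  have hμ : ∀ i, 0 < volume.real (A i) := fun i => ENNReal.toReal_pos (hA0 i) (hAf i)
  have hν : ∀ i, 0 < volume.real (A' i) := fun i => ENNReal.toReal_pos (hA0' i) (hAf' i)
  have L1 : ∀ (c : ι → ℂ), eLpNorm (stepFun A c) 1 volume =
      ENNReal.ofReal (∑ i, ‖c i‖ * volume.real (A i)) := fun c => by
    simpa using eLpNorm_stepFun (μ := volume) hA hAf hAd c (p := 1) one_ne_zero (by simp)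
  have L1' : ∀ (c : κ → ℂ), eLpNorm (stepFun A' c) 1 volume =
      ENNReal.ofReal (∑ i, ‖c i‖ * volume.real (A' i)) := fun c => by
    simpa using eLpNorm_stepFun (μ := volume) hA' hAf' hAd' c (p := 1) one_ne_zero (by simp)
  have L2 : ∀ (c : ι → ℂ), eLpNorm (stepFun A c) 2 volume =
      ENNReal.ofReal √(∑ i, ‖c i‖ ^ 2 * volume.real (A i)) := fun c => by
    rw [eLpNorm_stepFun hA hAf hAd c (by simp) (by simp), Real.sqrt_eq_rpow]
    simp
  have L2' : ∀ (c : κ → ℂ), eLpNorm (stepFun A' c) 2 volume =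
      ENNReal.ofReal √(∑ i, ‖c i‖ ^ 2 * volume.real (A' i)) := fun c => by
    rw [eLpNorm_stepFun hA' hAf' hAd' c (by simp) (by simp), Real.sqrt_eq_rpow]
    simp
  have hLt : ∀ (c : ι → ℂ) {M : ℝ} (_ : 0 ≤ M) (_ : ∀ i, ‖c i‖ ≤ M),
      eLpNorm (stepFun A c) ⊤ volume ≤ ENNReal.ofReal M := fun c M hM hc => by
    refine (eLpNorm_le_of_ae_bound (ae_of_all _ (norm_stepFun_le hAd hM hc))).trans_eq ?_
    simp
  have hLt' : ∀ (c : κ → ℂ) {M : ℝ} (_ : 0 ≤ M) (_ : ∀ i, ‖c i‖ ≤ M),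
      eLpNorm (stepFun A' c) ⊤ volume ≤ ENNReal.ofReal M := fun c M hM hc => by
    refine (eLpNorm_le_of_ae_bound (ae_of_all _ (norm_stepFun_le hAd' hM hc))).trans_eq ?_
    simp
  have hS := fun (c : ι → ℂ) (r : ℝ≥0∞) => memLp_stepFun (μ := volume) hA hAf c r
  have hS' := fun (c : κ → ℂ) (r : ℝ≥0∞) => memLp_stepFun (μ := volume) hA' hAf' c r
  have hT := fun (c : ι → ℂ) {r : ℝ≥0∞} (hr : 1 ≤ r) => memLp_convFun hKc hK hr (hS c r)
  have hTle : ∀ (c : ι → ℂ) {r : ℝ≥0∞} (hr : 1 ≤ r) {M : ℝ} (_ : 0 ≤ M),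
      eLpNorm (stepFun A c) r volume ≤ ENNReal.ofReal M →
      eLpNorm (convFun (𝓕⁻ m) (stepFun A c)) r volume ≤ ENNReal.ofReal (a * M) := by
    intro c r hr M hM h
    rw [ENNReal.ofReal_mul ha0]
    exact (eLpNorm_convFun_le hKc (hS c r).aestronglyMeasurable hr).trans (mul_le_mul' haK h)
  have hT2 : ∀ (c : ι → ℂ), eLpNorm (convFun (𝓕⁻ m) (stepFun A c)) 2 volume ≤
      ENNReal.ofReal (B * √(∑ i, ‖c i‖ ^ 2 * volume.real (A i))) := by
    intro c
    have h1 := norm_multLp_two_le hm hK hB hmB ((hS c 2).toLp _)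
    have h2 : eLpNorm (multLp hm hK 2 ((hS c 2).toLp _)) 2 volume =
        eLpNorm (convFun (𝓕⁻ m) (stepFun A c)) 2 volume := by
      refine eLpNorm_congr_ae ((coeFn_multLp hm hK 2 _).trans ?_)
      rw [convFun_congr_ae (hS c 2).coeFn_toLp]
    rw [Lp.norm_toLp, L2, ENNReal.toReal_ofReal (Real.sqrt_nonneg _), Lp.norm_def, h2] at h1
    rw [← ENNReal.ofReal_toReal (hT c one_le_two).eLpNorm_lt_top.ne]
    exact ENNReal.ofReal_le_ofReal h1
  have h2 : ∀ (c : ι → ℂ) (e : κ → ℂ),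
      ‖∫ x, convFun (𝓕⁻ m) (stepFun A c) x * stepFun A' e x‖ ≤
      B * √(∑ i, ‖c i‖ ^ 2 * volume.real (A i)) * √(∑ j, ‖e j‖ ^ 2 * volume.real (A' j)) :=
    fun c e => norm_integral_mul_le (p := 2) (q := 2) (hT c one_le_two) (hS' e 2) (by positivity)
      (by positivity) (hT2 c) (L2' e).le
  have h1 : ∀ (c : ι → ℂ) (e : κ → ℂ), (∀ j, ‖e j‖ ≤ 1) →
      ‖∫ x, convFun (𝓕⁻ m) (stepFun A c) x * stepFun A' e x‖ ≤
      a * ∑ i, ‖c i‖ * volume.real (A i) := fun c e he => by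
    have := norm_integral_mul_le (p := 1) (q := ⊤) (hT c le_rfl) (hS' e ⊤)
      (mul_nonneg ha0 (Finset.sum_nonneg fun i _ => mul_nonneg (norm_nonneg _) (hμ i).le))
      zero_le_one (hTle c le_rfl (Finset.sum_nonneg fun i _ => mul_nonneg (norm_nonneg _)
        (hμ i).le) (L1 c).le) (hLt' e zero_le_one he)
    rwa [mul_one] at this
  have h1' : ∀ (c : ι → ℂ) (e : κ → ℂ), (∀ j, ‖c j‖ ≤ 1) →
      ‖∫ x, convFun (𝓕⁻ m) (stepFun A c) x * stepFun A' e x‖ ≤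
      a * ∑ i, ‖e i‖ * volume.real (A' i) := fun c e hc => by
    have := norm_integral_mul_le (p := ⊤) (q := 1) (hT c le_top) (hS' e 1)
      (mul_nonneg ha0 zero_le_one)
      (Finset.sum_nonneg fun i _ => mul_nonneg (norm_nonneg _) (hν i).le)
      (hTle c le_top zero_le_one (hLt c zero_le_one hc)) (L1' e).le
    rwa [mul_one] at this
  have hinv : (p⁻¹).toReal = p.toReal⁻¹ := ENNReal.toReal_inv p
  have hpinv := hpq.inv_add_inv_eq_one
  have hp0 := hpq.pos
  have hq0 := hpq.symm.pos
  rw [hinv]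
  simp_rw [integral_convFun_stepFun hm hK hA hAf hA'] at h1 h1' h2 ⊢
  rcases lt_or_gt_of_ne hp2 with hlt | hgt
  · refine (norm_sum_sum_le_interpolation hμ hν ha0 hB h1 h2 hpq hlt c e).trans_eq ?_
    have e1 : |1 - 2 * p.toReal⁻¹| = 2 / p.toReal - 1 := by
      have : (2 : ℝ)⁻¹ ≤ p.toReal⁻¹ := (inv_le_inv₀ two_pos hp0).2 hlt.le
      rw [abs_of_nonpos (by linarith)]; ring
    have e2 : 1 - (2 / p.toReal - 1) = 2 / q.toReal := by
      rw [div_eq_mul_inv, div_eq_mul_inv]; linarith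
    rw [e1, e2]
  · have e1 : |1 - 2 * p.toReal⁻¹| = 2 / q.toReal - 1 := by
      have : p.toReal⁻¹ ≤ (2 : ℝ)⁻¹ := (inv_le_inv₀ hp0 two_pos).2 hgt.le
      rw [abs_of_nonneg (by linarith), div_eq_mul_inv]; linarith
    have e2 : 1 - (2 / q.toReal - 1) = 2 / p.toReal := by
      rw [div_eq_mul_inv, div_eq_mul_inv]; linarith
    have hq2 : q.toReal < 2 := by
      have h3 : p.toReal⁻¹ < (2 : ℝ)⁻¹ := (inv_lt_inv₀ hp0 two_pos).2 hgt
      have h4 : (2 : ℝ)⁻¹ < q.toReal⁻¹ := by linarith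
      exact (inv_lt_inv₀ two_pos hq0).1 h4
    -- For `p > 2` the form is transposed: the conjugate exponent is below `2`, and the `L^∞` bound
    -- takes the place of the `L¹` bound.
    have hsw : ∀ (c : ι → ℂ) (e : κ → ℂ), ∑ i, ∑ j, c i * e j *
        ∫ x, convFun (𝓕⁻ m) ((A i).indicator fun _ => 1) x * (A' j).indicator (fun _ => 1) x =
        ∑ j, ∑ i, e j * c i *
        ∫ x, convFun (𝓕⁻ m) ((A i).indicator fun _ => 1) x * (A' j).indicator (fun _ => 1) x := by
      intro c e
      rw [Finset.sum_comm]
      simp_rw [mul_comm (e _) (c _)]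
    rw [hsw, e1, e2]
    refine (norm_sum_sum_le_interpolation hν hμ ha0 hB (fun e c hc => ?_) (fun e c => ?_)
      hpq.symm hq2 e c).trans_eq (by ring)
    · rw [← hsw]; exact h1' c e hc
    · rw [← hsw]; exact (h2 c e).trans_eq (by ring)

theorem norm_multLp_le_integral (p : ℝ≥0∞) [Fact (1 ≤ p)] (h : Lp ℂ p (volume : Measure V)) :
    ‖multLp hm hK p h‖ ≤ (∫ x, ‖𝓕⁻ m x‖) * ‖h‖ :=
  norm_convLp_le (continuous_fourierInv_of_integrable hm) hK p h

/-- Both exponents are finite here, so simple functions are dense on either side and the estimate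
for step functions passes to the limit. -/
theorem norm_integral_multLp_mul_le {a B : ℝ} (ha : ∫ x, ‖𝓕⁻ m x‖ ≤ a) (hB : 0 ≤ B)
    (hmB : ∀ᵐ ξ, ‖m ξ‖ ≤ B) {p q : ℝ≥0∞} [Fact (1 ≤ p)] [Fact (1 ≤ q)]
    [ENNReal.HolderConjugate p q] (hp1 : 1 < p.toReal) (hp2 : p.toReal ≠ 2)
    (h : Lp ℂ p (volume : Measure V)) (g : Lp ℂ q (volume : Measure V)) :
    ‖∫ x, multLp hm hK p h x * g x‖ ≤
      a ^ |1 - 2 * (p⁻¹).toReal| * B ^ (1 - |1 - 2 * (p⁻¹).toReal|) * ‖h‖ * ‖g‖ := by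
  have hpq : p.toReal.HolderConjugate q.toReal := ENNReal.HolderConjugate.toReal hp1
  have hp0 : p ≠ 0 := fun hp => by have := hpq.pos; simp [hp] at this
  have hpt : p ≠ ⊤ := fun hp => by have := hpq.pos; simp [hp] at this
  have hq0 : q ≠ 0 := fun hp => by have := hpq.symm.pos; simp [hp] at this
  have hqt : q ≠ ⊤ := fun hp => by have := hpq.symm.pos; simp [hp] at this
  set C := a ^ |1 - 2 * (p⁻¹).toReal| * B ^ (1 - |1 - 2 * (p⁻¹).toReal|) with hC
  set P := (ContinuousLinearMap.mul ℂ ℂ).lpPairing (volume : Measure V) p q with hP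
  have hPe : ∀ F G, P F G = ∫ x, F x * G x := fun F G => by
    rw [hP, ContinuousLinearMap.lpPairing_eq_integral]; rfl
  rw [← hPe]
  refine (Lp.simpleFunc.denseRange hpt).induction_on
    (p := fun h => ‖P (multLp hm hK p h) g‖ ≤ C * ‖h‖ * ‖g‖) h
    (isClosed_le ?_ ?_) fun h => ?_
  · exact ((P.flip g).continuous.comp (multLp hm hK p).continuous).norm
  · exact (continuous_const.mul continuous_norm).mul continuous_const
  refine (Lp.simpleFunc.denseRange hqt).induction_on
    (p := fun g => ‖P (multLp hm hK p h) g‖ ≤ C * ‖(h : Lp ℂ p (volume : Measure V))‖ * ‖g‖) g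
    (isClosed_le ?_ ?_) fun g => ?_
  · exact (P (multLp hm hK p h)).continuous.norm
  · exact continuous_const.mul continuous_norm
  obtain ⟨s, A, c, hA, hAf, hA0, hAd, hAe⟩ := exists_stepFun_ae_eq (μ := volume)
    (Lp.simpleFunc.toSimpleFunc h)
    ((SimpleFunc.memLp_iff_finMeasSupp hp0 hpt).1 (Lp.simpleFunc.memLp h))
  obtain ⟨s', A', e, hA', hAf', hA0', hAd', hAe'⟩ := exists_stepFun_ae_eq (μ := volume)
    (Lp.simpleFunc.toSimpleFunc g)
    ((SimpleFunc.memLp_iff_finMeasSupp hq0 hqt).1 (Lp.simpleFunc.memLp g))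
  have hh := (Lp.simpleFunc.toSimpleFunc_eq_toFun h).symm.trans hAe
  have hg := (Lp.simpleFunc.toSimpleFunc_eq_toFun g).symm.trans hAe'
  have key := norm_integral_convFun_stepFun_le (p := p) (q := q) hm hK ha hB hmB hp1 hp2 hA hAf hA0 hAd hA' hAf'
    hA0' hAd' c e
  have hi : ∫ x, convFun (𝓕⁻ m) (stepFun A c) x * stepFun A' e x =
      ∫ x, multLp hm hK p h x * (g : Lp ℂ q (volume : Measure V)) x := by
    refine integral_congr_ae ?_
    filter_upwards [coeFn_multLp hm hK p h, hg] with x hx hgx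
    rw [hx, hgx, convFun_congr_ae hh]
  have n1 : ‖(h : Lp ℂ p (volume : Measure V))‖ =
      (∑ i, ‖c i‖ ^ p.toReal * volume.real (A i)) ^ (1 / p.toReal) := by
    rw [Lp.norm_def, eLpNorm_congr_ae hh, eLpNorm_stepFun hA hAf hAd c hp0 hpt,
      ENNReal.toReal_ofReal (by positivity)]
  have n2 : ‖(g : Lp ℂ q (volume : Measure V))‖ =
      (∑ i, ‖e i‖ ^ q.toReal * volume.real (A' i)) ^ (1 / q.toReal) := by
    rw [Lp.norm_def, eLpNorm_congr_ae hg, eLpNorm_stepFun hA' hAf' hAd' e hq0 hqt,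
      ENNReal.toReal_ofReal (by positivity)]
  rw [hPe, n1, n2, ← hi]
  exact key

/-- `L^p` bounds for Fourier multipliers, interpolated between the `L^1` norm of the kernel and
the supremum of the symbol. -/
theorem norm_multLp_le {a B : ℝ} (ha : ∫ x, ‖𝓕⁻ m x‖ ≤ a) (hB : 0 ≤ B)
    (hmB : ∀ᵐ ξ, ‖m ξ‖ ≤ B) (p : ℝ≥0∞) [hp : Fact (1 ≤ p)] (h : Lp ℂ p (volume : Measure V)) :
    ‖multLp hm hK p h‖ ≤
      a ^ |1 - 2 * (p⁻¹).toReal| * B ^ (1 - |1 - 2 * (p⁻¹).toReal|) * ‖h‖ := by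
  have ha0 : 0 ≤ a := (integral_nonneg fun x => norm_nonneg _).trans ha
  have hsimple := (norm_multLp_le_integral hm hK p h).trans
    (mul_le_mul_of_nonneg_right ha (norm_nonneg h))
  -- At `p = ∞` and `p = 1` the exponent of `a` is one and Young's inequality suffices; at `p = 2`
  -- it is zero and the bound is Plancherel. Only the remaining `p` need interpolation.
  by_cases hpt : p = ⊤
  · subst hpt; simpa using hsimple
  by_cases hp1 : p = 1
  · subst hp1; norm_num; exact hsimple
  by_cases hp2 : p = 2
  · subst hp2; simpa using norm_multLp_two_le hm hK hB hmB h
  have hlt : 1 < p := lt_of_le_of_ne hp.out (Ne.symm hp1)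
  have hr : 1 < p.toReal := by
    rw [← ENNReal.toReal_one]; exact (ENNReal.toReal_lt_toReal ENNReal.one_ne_top hpt).2 hlt
  have hr2 : p.toReal ≠ 2 := fun h => hp2 (by
    rw [← ENNReal.ofReal_toReal hpt, h]; simp)
  have : Fact (1 ≤ (1 - p⁻¹)⁻¹) := by simp [fact_iff]
  have hpq : ENNReal.HolderConjugate p (1 - p⁻¹)⁻¹ :=
    ENNReal.HolderConjugate.inv_one_sub_inv' hp.out
  refine norm_le_of_forall_integral_mul_le (q := (1 - p⁻¹)⁻¹) hlt hpt _ (by positivity) fun g => ?_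
  exact norm_integral_multLp_mul_le hm hK ha hB hmB hr hr2 h g

end Interpolation

/-! ### Bounded Fourier multipliers on `L^p` -/

section MultBound

variable {V : Type*} [NormedAddCommGroup V] [InnerProductSpace ℝ V] [FiniteDimensional ℝ V]
  [MeasurableSpace V] [BorelSpace V]

/-- The symbol `m` is integrable, with an integrable kernel whose `L^1` norm is at most `A`. -/
structure KerBound (m : V → ℂ) (A : ℝ) : Prop where
  integrable : Integrable m
  integrable_ker : Integrable (𝓕⁻ m)
  integral_le : ∫ x, ‖𝓕⁻ m x‖ ≤ A

theorem KerBound.nonneg {m : V → ℂ} {A : ℝ} (h : KerBound m A) : 0 ≤ A :=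
  (integral_nonneg fun _ => norm_nonneg _).trans h.integral_le

theorem KerBound.mono {m : V → ℂ} {A A' : ℝ} (h : KerBound m A) (hA : A ≤ A') : KerBound m A' :=
  ⟨h.1, h.2, h.3.trans hA⟩

/-- The symbol `m` is a Fourier multiplier on `L^p`, with norm at most `C`. -/
def MultBound (p : ℝ≥0∞) [Fact (1 ≤ p)] (m : V → ℂ) (C : ℝ) : Prop :=
  ∀ h : Lp ℂ p (volume : Measure V), ∃ g : Lp ℂ p (volume : Measure V), ‖g‖ ≤ C * ‖h‖ ∧
    ∀ u : 𝓢(V, ℂ), Integrable (fun x => h x * 𝓕 (fun ξ => m ξ * 𝓕⁻ (u : V → ℂ) ξ) x) ∧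
      ∫ x, g x * u x = ∫ x, h x * 𝓕 (fun ξ => m ξ * 𝓕⁻ (u : V → ℂ) ξ) x

variable {p : ℝ≥0∞} [hp : Fact (1 ≤ p)]

theorem MultBound.mono {m : V → ℂ} {C C' : ℝ} (h : MultBound p m C) (hC : C ≤ C') :
    MultBound p m C' := fun f => by
  obtain ⟨g, hg, hu⟩ := h f
  exact ⟨g, hg.trans (by gcongr), hu⟩

/-- Young's inequality followed by Hölder's. This licenses the use of Fubini that moves a
convolution onto the test function. -/
theorem integrable_prod_conv {K h u : V → ℂ} (hK : Continuous K) (hKi : Integrable K)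
    (hh : MemLp h p volume) {q : ℝ≥0∞} [ENNReal.HolderConjugate p q] (hu : MemLp u q volume) :
    Integrable (fun z : V × V => K (z.1 - z.2) * h z.2 * u z.1) (volume.prod volume) := by
  have hm : AEStronglyMeasurable (fun z : V × V => K (z.1 - z.2) * h z.2 * u z.1)
      (volume.prod volume) :=
    ((hK.comp (continuous_fst.sub continuous_snd)).aestronglyMeasurable.mul
      hh.aestronglyMeasurable.comp_snd).mul hu.aestronglyMeasurable.comp_fst
  refine ⟨hm, ?_⟩
  rw [hasFiniteIntegral_iff_enorm, lintegral_prod _ hm.enorm]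
  have h1 : ∀ x, ∫⁻ y, ‖K (x - y) * h y * u x‖ₑ =
      (∫⁻ y, ‖K (x - y)‖ₑ * ‖h y‖ₑ) * ‖u x‖ₑ := fun x => by
    simp_rw [enorm_mul]
    rw [lintegral_mul_const'' ]
    exact ((hK.comp (continuous_const.sub continuous_id)).aestronglyMeasurable.enorm).mul
      hh.aestronglyMeasurable.enorm
  simp_rw [h1]
  have h2 : ∀ x, ∫⁻ y, ‖K (x - y)‖ₑ * ‖h y‖ₑ =
      ∫⁻ y, ‖K (x - y)‖ₑ * ‖hh.aestronglyMeasurable.mk h y‖ₑ := by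
    intro x
    refine lintegral_congr_ae ?_
    filter_upwards [hh.aestronglyMeasurable.ae_eq_mk] with y hy
    rw [← hy]
  set F : V → ℝ := fun x => (∫⁻ y, ‖K (x - y)‖ₑ * ‖h y‖ₑ).toReal with hF
  have hFm' : AEMeasurable (fun x => ∫⁻ y, ‖K (x - y)‖ₑ * ‖h y‖ₑ) volume := by
    simp_rw [h2]
    have := hh.aestronglyMeasurable.stronglyMeasurable_mk.enorm
    exact (Measurable.lintegral_prod_right' (f := fun z : V × V => ‖K (z.1 - z.2)‖ₑ *
      ‖hh.aestronglyMeasurable.mk h z.2‖ₑ)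
      ((hK.measurable.comp (measurable_fst.sub measurable_snd)).enorm.mul
      (this.comp measurable_snd))).aemeasurable
  have hfin : ∀ᵐ x, ∫⁻ y, ‖K (x - y)‖ₑ * ‖h y‖ₑ ≠ ⊤ := by
    filter_upwards [ae_integrable_conv hK hKi hp.out hh] with x hx
    have := hx.hasFiniteIntegral
    rw [hasFiniteIntegral_iff_enorm] at this
    simpa [enorm_mul] using this.ne
  have hFe : ∀ᵐ x, ‖F x‖ₑ = ∫⁻ y, ‖K (x - y)‖ₑ * ‖h y‖ₑ := by
    filter_upwards [hfin] with x hx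
    rw [hF, Real.enorm_of_nonneg ENNReal.toReal_nonneg, ENNReal.ofReal_toReal hx]
  have hFm : AEStronglyMeasurable F volume := hFm'.ennreal_toReal.aestronglyMeasurable
  have hFn : eLpNorm F p volume < ⊤ := by
    have h3 : eLpNorm F p volume = eLpNorm (fun x => ∫⁻ y, ‖K (x - y)‖ₑ * ‖h y‖ₑ) p volume := by
      refine eLpNorm_congr_enorm_ae ?_
      filter_upwards [hFe] with x hx
      rw [hx, enorm_eq_self]
    rw [h3]
    exact (eLpNorm_enorm_conv_le hK hh.aestronglyMeasurable hp.out).trans_lt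
      (ENNReal.mul_lt_top hKi.hasFiniteIntegral hh.eLpNorm_lt_top)
  have h4 := eLpNorm_smul_le_mul_eLpNorm (p := p) (q := q) (r := 1) hu.aestronglyMeasurable hFm
  have h5 : eLpNorm (F • u) 1 volume = ∫⁻ x, (∫⁻ y, ‖K (x - y)‖ₑ * ‖h y‖ₑ) * ‖u x‖ₑ := by
    rw [eLpNorm_one_eq_lintegral_enorm]
    refine lintegral_congr_ae ?_
    filter_upwards [hFe] with x hx
    rw [Pi.smul_apply', enorm_smul, hx]
  rw [← h5]
  exact h4.trans_lt (ENNReal.mul_lt_top hFn hu.eLpNorm_lt_top)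

/-- The operator is convolution with `𝓕⁻ m`. Fubini identifies it with the dual definition, which
makes sense for symbols that are not smooth, as is needed at the origin. -/
theorem KerBound.multBound {m : V → ℂ} {a B : ℝ} (hm : KerBound m a) (hB : 0 ≤ B)
    (hmB : ∀ᵐ ξ, ‖m ξ‖ ≤ B) :
    MultBound p m (a ^ |1 - 2 * (p⁻¹).toReal| * B ^ (1 - |1 - 2 * (p⁻¹).toReal|)) := by
  intro h
  refine ⟨multLp hm.1 hm.2 p h, norm_multLp_le hm.1 hm.2 hm.3 hB hmB p h, fun u => ?_⟩
  have : Fact (1 ≤ (1 - p⁻¹)⁻¹) := by simp [fact_iff]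
  have hpq : ENNReal.HolderConjugate p (1 - p⁻¹)⁻¹ :=
    ENNReal.HolderConjugate.inv_one_sub_inv' hp.out
  have hint := integrable_prod_conv (continuous_fourierInv_of_integrable hm.1) hm.2 (Lp.memLp h)
    (u.memLp (1 - p⁻¹)⁻¹ volume)
  have h1 : ∀ y, h y * 𝓕 (fun ξ => m ξ * 𝓕⁻ (u : V → ℂ) ξ) y =
      ∫ x, 𝓕⁻ m (x - y) * h y * u x := fun y => by
    rw [fourier_mul_fourierInv_eq hm.1 u.integrable, ← integral_const_mul]
    congr 1; funext x; ring
  simp_rw [h1]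
  refine ⟨hint.integral_prod_right, ?_⟩
  rw [← integral_integral_swap (f := fun x y => 𝓕⁻ m (x - y) * h y * u x) hint]
  refine integral_congr_ae ?_
  filter_upwards [coeFn_multLp hm.1 hm.2 p h] with x hx
  rw [hx, convFun, integral_mul_const]

/-- The Schwartz function `𝓕 (m · 𝓕⁻ u)`, for `m` of temperate growth. -/
theorem coe_fourier_smulLeft_fourierInv {m : V → ℂ} (hm : m.HasTemperateGrowth) (u : 𝓢(V, ℂ)) :
    ((𝓕 (SchwartzMap.smulLeftCLM ℂ m (𝓕⁻ u)) : 𝓢(V, ℂ)) : V → ℂ) =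
      𝓕 (fun ξ => m ξ * 𝓕⁻ (u : V → ℂ) ξ) := by
  rw [SchwartzMap.fourier_coe]
  congr 1
  funext ξ
  rw [SchwartzMap.smulLeftCLM_apply_apply hm, SchwartzMap.fourierInv_coe, smul_eq_mul]

theorem MultBound.fourierMultiplier {m : V → ℂ} {C : ℝ} (h : MultBound p m C)
    (hm : m.HasTemperateGrowth) (f : Lp ℂ p (volume : Measure V)) :
    ∃ g : Lp ℂ p (volume : Measure V), ‖g‖ ≤ C * ‖f‖ ∧ Lp.toTemperedDistribution g =
      TemperedDistribution.fourierMultiplierCLM ℂ m (Lp.toTemperedDistribution f) := by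
  obtain ⟨g, hg, H⟩ := h f
  refine ⟨g, hg, ?_⟩
  ext u
  rw [TemperedDistribution.fourierMultiplierCLM_apply_apply, Lp.toTemperedDistribution_apply,
    Lp.toTemperedDistribution_apply, coe_fourier_smulLeft_fourierInv hm]
  simpa only [smul_eq_mul, mul_comm] using (H u).2

end MultBound

/-! ### `L^p` norms of tempered distributions -/

namespace AdaptedBesov

variable {d : ℕ} {p : ℝ≥0∞} [hp : Fact (1 ≤ p)]

theorem toTemperedDistribution_injective :
    Function.Injective (Lp.toTemperedDistribution :
      Lp ℂ p (volume : Measure (Eucl d)) → 𝓢'(Eucl d, ℂ)) :=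
  LinearMap.ker_eq_bot.1 (Lp.ker_toTemperedDistributionCLM_eq_bot (F := ℂ)
    (μ := (volume : Measure (Eucl d))) (p := p))

/-- The infimum runs over a single element, since a distribution determines its `L^p`
representative. -/
theorem lpNorm_toTemperedDistribution (h : Lp ℂ p (volume : Measure (Eucl d))) :
    lpNorm p (Lp.toTemperedDistribution h) = ‖h‖ₑ := by
  refine le_antisymm (iInf₂_le_of_le h rfl le_rfl) (le_iInf₂ fun h' hh' => ?_)
  rw [toTemperedDistribution_injective hh']

theorem exists_of_lpNorm_lt_top {f : 𝓢'(Eucl d, ℂ)} (hf : lpNorm p f < ⊤) :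
    ∃ h : Lp ℂ p (volume : Measure (Eucl d)), Lp.toTemperedDistribution h = f ∧
      lpNorm p f = ‖h‖ₑ := by
  obtain ⟨h, hh⟩ := iInf_lt_iff.1 hf
  obtain ⟨e, -⟩ := iInf_lt_iff.1 hh
  exact ⟨h, e, e ▸ lpNorm_toTemperedDistribution h⟩

/-- Finiteness of the norm matters when `C = 0`, because `0 * ⊤ = 0` in `ℝ≥0∞`. -/
theorem lpNorm_fourierMultiplier_le {m : Eucl d → ℂ} {C : ℝ} (h : MultBound p m C)
    (hC : 0 ≤ C) (hm : m.HasTemperateGrowth) (f : 𝓢'(Eucl d, ℂ)) (hf : lpNorm p f < ⊤) :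
    lpNorm p (TemperedDistribution.fourierMultiplierCLM ℂ m f) ≤
      ENNReal.ofReal C * lpNorm p f := by
  obtain ⟨h₀, e, hn⟩ := exists_of_lpNorm_lt_top hf
  obtain ⟨g, hg, hge⟩ := h.fourierMultiplier hm h₀
  rw [← e, ← hge, lpNorm_toTemperedDistribution, lpNorm_toTemperedDistribution, ← ofReal_norm,
    ← ofReal_norm, ← ENNReal.ofReal_mul hC]
  exact ENNReal.ofReal_le_ofReal hg

theorem lpNorm_add_le (f g : 𝓢'(Eucl d, ℂ)) : lpNorm p (f + g) ≤ lpNorm p f + lpNorm p g := by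
  by_cases hf : lpNorm p f < ⊤
  · by_cases hg : lpNorm p g < ⊤
    · obtain ⟨f₀, e, hn⟩ := exists_of_lpNorm_lt_top hf
      obtain ⟨g₀, e', hn'⟩ := exists_of_lpNorm_lt_top hg
      have h1 : f + g = Lp.toTemperedDistribution (f₀ + g₀) := by
        rw [← e, ← e']
        exact ((Lp.toTemperedDistributionCLM ℂ (volume : Measure (Eucl d)) p).map_add f₀ g₀).symm
      rw [h1, lpNorm_toTemperedDistribution, hn, hn']
      exact enorm_add_le _ _
    · rw [not_lt, top_le_iff] at hg
      rw [hg, add_top]; exact le_top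
  · rw [not_lt, top_le_iff] at hf
    rw [hf, top_add]; exact le_top

end AdaptedBesov

/-! ### Kernel bounds -/

/-- Uniform bounds for the derivatives of a smooth family over a compact set of parameters. -/
theorem exists_iteratedFDeriv_le_of_isCompact {V W G : Type*} [NormedAddCommGroup V]
    [InnerProductSpace ℝ V] [FiniteDimensional ℝ V] [NormedAddCommGroup W]
    [NormedSpace ℝ W] [NormedAddCommGroup G] [NormedSpace ℝ G] {F : W × V → G}
    (hF : ContDiff ℝ ∞ F) {S : Set W} (hS : IsCompact S) (ρ : ℝ)
    (n : ℕ) : ∃ M : ℝ, ∀ w ∈ S, ∀ ξ, ‖ξ‖ ≤ ρ →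
      ‖iteratedFDeriv ℝ n (fun ξ => F (w, ξ)) ξ‖ ≤ M := by
  have hc : Continuous fun z => ‖iteratedFDeriv ℝ n F z‖ :=
    (hF.continuous_iteratedFDeriv (mod_cast le_top)).norm
  obtain ⟨M, hM⟩ := (hS.prod (isCompact_closedBall (0 : V) ρ)).bddAbove_image hc.continuousOn
  refine ⟨M, fun w hw ξ hξ => ?_⟩
  have h1 : (fun ξ => F (w, ξ)) = (fun z => F ((w, 0) + z)) ∘ ContinuousLinearMap.inr ℝ W V := by
    funext ξ; simp
  rw [h1, ContinuousLinearMap.iteratedFDeriv_comp_right (n := ∞) (ContinuousLinearMap.inr ℝ W V)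
    (by fun_prop) ξ (mod_cast le_top), iteratedFDeriv_comp_add_left]
  refine (ContinuousMultilinearMap.norm_compContinuousLinearMap_le _ _).trans ?_
  have h2 : ∏ _i : Fin n, ‖ContinuousLinearMap.inr ℝ W V‖ ≤ 1 :=
    Finset.prod_le_one (fun _ _ => norm_nonneg (ContinuousLinearMap.inr ℝ W V)) fun _ _ =>
      ContinuousLinearMap.norm_inr_le_one ℝ W V
  have h3 : ‖iteratedFDeriv ℝ n F ((w, 0) + ContinuousLinearMap.inr ℝ W V ξ)‖ ≤ M := by
    refine hM ⟨(w, ξ), ⟨hw, mem_closedBall_zero_iff.2 hξ⟩, ?_⟩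
    simp
  exact (mul_le_of_le_one_right (norm_nonneg _) h2).trans h3

theorem det_adjoint_real {V : Type*} [NormedAddCommGroup V]
    [InnerProductSpace ℝ V] [FiniteDimensional ℝ V] (A : V →ₗ[ℝ] V) :
    LinearMap.det A.adjoint = LinearMap.det A := by
  have v := stdOrthonormalBasis ℝ V
  rw [← LinearMap.det_toMatrix v.toBasis, LinearMap.toMatrix_adjoint v v, Matrix.det_conjTranspose,
    LinearMap.det_toMatrix, star_trivial]

section KerBound

variable {V : Type*} [NormedAddCommGroup V] [InnerProductSpace ℝ V] [FiniteDimensional ℝ V]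
  [MeasurableSpace V] [BorelSpace V]

theorem map_linearEquiv_volume (A : V ≃ₗ[ℝ] V) :
    ∃ c : ℝ≥0∞, c ≠ 0 ∧ c ≠ ⊤ ∧ (volume : Measure V).map A = c • volume := by
  have hdet : LinearMap.det (A : V →ₗ[ℝ] V) ≠ 0 := A.isUnit_det'.ne_zero
  refine ⟨ENNReal.ofReal |(LinearMap.det (A : V →ₗ[ℝ] V))⁻¹|, ?_, ENNReal.ofReal_ne_top,
    Measure.map_linearMap_addHaar_eq_smul_addHaar volume hdet⟩
  simpa using hdet

theorem measurableEmbedding_linearEquiv (A : V ≃ₗ[ℝ] V) : MeasurableEmbedding A :=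
  A.toContinuousLinearEquiv.toHomeomorph.measurableEmbedding

theorem integral_comp_linearEquiv {F : Type*} [NormedAddCommGroup F] [NormedSpace ℝ F]
    (A : V ≃ₗ[ℝ] V) {c : ℝ≥0∞} (hc : (volume : Measure V).map A = c • volume) (f : V → F) :
    ∫ x, f (A x) = c.toReal • ∫ x, f x := by
  rw [← (measurableEmbedding_linearEquiv A).integral_map (μ := volume) f, hc, integral_smul_measure]

theorem integrable_comp_linearEquiv {F : Type*} [NormedAddCommGroup F] [NormedSpace ℝ F]
    (A : V ≃ₗ[ℝ] V) {f : V → F} (hf : Integrable f) : Integrable fun x => f (A x) := by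
  obtain ⟨c, -, hct, hc⟩ := map_linearEquiv_volume A
  have h1 : Integrable f ((volume : Measure V).map A) := hc ▸ hf.smul_measure hct
  exact h1.comp_measurable (measurableEmbedding_linearEquiv A).measurable

/-- The kernel of `m ∘ A` is `|det A|⁻¹ K((A*)⁻¹ x)`, whose `L¹` norm equals that of `K`. This
invariance allows thin caps to be rescaled, anisotropically, to unit size at no cost. -/
theorem KerBound.comp_linearEquiv {m : V → ℂ} {C : ℝ} (hm : KerBound m C) (A : V ≃ₗ[ℝ] V) :
    KerBound (fun ξ => m (A ξ)) C := by
  have hdet : LinearMap.det (A : V →ₗ[ℝ] V) ≠ 0 := A.isUnit_det'.ne_zero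
  have hdet' : LinearMap.det (A : V →ₗ[ℝ] V).adjoint ≠ 0 := by rwa [det_adjoint_real]
  set B : V ≃ₗ[ℝ] V := LinearMap.equivOfDetNeZero _ hdet' with hB
  have hBA : ∀ x y, inner ℝ (A x) y = inner ℝ x (B y) := fun x y =>
    (LinearMap.adjoint_inner_right (A : V →ₗ[ℝ] V) x y).symm
  have hBd : LinearMap.det (B : V →ₗ[ℝ] V) = LinearMap.det (A : V →ₗ[ℝ] V) :=
    det_adjoint_real (A : V →ₗ[ℝ] V)
  set D : ℝ := |(LinearMap.det (A : V →ₗ[ℝ] V))⁻¹| with hD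
  have hD0 : 0 < D := abs_pos.2 (inv_ne_zero hdet)
  have hc : (volume : Measure V).map A = ENNReal.ofReal D • volume :=
    Measure.map_linearMap_addHaar_eq_smul_addHaar volume hdet
  have hc' : (volume : Measure V).map B = ENNReal.ofReal D • volume := by
    have := Measure.map_linearMap_addHaar_eq_smul_addHaar volume (f := (B : V →ₗ[ℝ] V))
      (hBd ▸ hdet)
    rw [hBd] at this
    exact this
  have hK : 𝓕⁻ (fun ξ => m (A ξ)) = fun x => D • 𝓕⁻ m (B.symm x) := by
    funext x
    rw [Real.fourierInv_eq, Real.fourierInv_eq, ← ENNReal.toReal_ofReal hD0.le,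
      ← integral_comp_linearEquiv A hc]
    congr 1
    funext ξ
    rw [hBA, B.apply_symm_apply]
  refine ⟨integrable_comp_linearEquiv A hm.1, ?_, ?_⟩
  · rw [hK]; exact (integrable_comp_linearEquiv B.symm hm.2).fun_smul _
  · rw [hK]
    have h1 := integral_comp_linearEquiv B hc' (fun x => ‖D • 𝓕⁻ m (B.symm x)‖)
    simp only [B.symm_apply_apply] at h1
    have h2 : ∫ x, ‖D • 𝓕⁻ m (B.symm x)‖ = D⁻¹ * ∫ x, ‖D • 𝓕⁻ m x‖ := by
      rw [h1, ENNReal.toReal_ofReal hD0.le, smul_eq_mul, inv_mul_cancel_left₀ hD0.ne']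
    rw [h2]
    simp_rw [norm_smul, integral_const_mul, Real.norm_of_nonneg hD0.le]
    rw [inv_mul_cancel_left₀ hD0.ne']
    exact hm.3

theorem KerBound.of_comp_linearEquiv {m : V → ℂ} {C : ℝ} (A : V ≃ₗ[ℝ] V)
    (hm : KerBound (fun ξ => m (A ξ)) C) : KerBound m C := by
  simpa using hm.comp_linearEquiv A.symm

theorem KerBound.smul_comp {m : V → ℂ} {C r : ℝ} (hm : KerBound m C) (hr : r ≠ 0) :
    KerBound (fun ξ => m (r • ξ)) C :=
  hm.comp_linearEquiv (LinearEquiv.smulOfNeZero ℝ V r hr)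

/-- A linear phase translates the kernel. The factor `(2π)⁻¹` converts to the normalisation of
`Real.fourierChar`. -/
theorem KerBound.modulate {m : V → ℂ} {C : ℝ} (hm : KerBound m C) (v : V) :
    KerBound (fun ξ => Complex.exp (Complex.I * (inner ℝ ξ v : ℝ)) * m ξ) C := by
  set w : V := (2 * Real.pi)⁻¹ • v with hw
  have he : ∀ ξ, Complex.exp (Complex.I * (inner ℝ ξ v : ℝ)) * m ξ =
      Real.fourierChar (inner ℝ ξ w) • m ξ := fun ξ => by
    rw [Circle.smul_def, Real.fourierChar_apply, smul_eq_mul, hw, inner_smul_right]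
    congr 2
    have : (2 * Real.pi * ((2 * Real.pi)⁻¹ * inner ℝ ξ v) : ℝ) = inner ℝ ξ v := by
      field_simp
    rw [this, mul_comm]
  simp_rw [he]
  have hK : 𝓕⁻ (fun ξ => Real.fourierChar (inner ℝ ξ w) • m ξ) = fun x => 𝓕⁻ m (x + w) := by
    funext x
    rw [Real.fourierInv_eq, Real.fourierInv_eq]
    congr 1; funext ξ
    rw [smul_smul, ← AddChar.map_add_eq_mul, inner_add_right]
  refine ⟨?_, ?_, ?_⟩
  · have := (VectorFourier.fourierIntegral_convergent_iff (L := innerₗ V) (μ := volume) (f := m)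
      Real.continuous_fourierChar continuous_inner (-w)).2 hm.1
    simpa using this
  · rw [hK]; exact hm.2.comp_add_right w
  · rw [hK, integral_add_right_eq_self (fun x => ‖𝓕⁻ m x‖) w]
    exact hm.3

theorem KerBound.congr_ae {m m' : V → ℂ} {C : ℝ} (hm : KerBound m C) (h : m =ᵐ[volume] m') :
    KerBound m' C := by
  have hK : 𝓕⁻ m' = 𝓕⁻ m := funext fun x => Real.fourierInv_congr_ae h.symm x
  exact ⟨hm.1.congr h, hK ▸ hm.2, hK ▸ hm.3⟩

theorem kerBound_zero : KerBound (fun _ : V => (0 : ℂ)) 0 := by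
  have h : 𝓕⁻ (fun _ : V => (0 : ℂ)) = fun _ => 0 := by
    funext x; simp [Real.fourierInv_eq]
  refine ⟨integrable_zero _ _ _, ?_, ?_⟩ <;> simp [h]

theorem KerBound.const_mul {m : V → ℂ} {C : ℝ} (hm : KerBound m C) (c : ℂ) :
    KerBound (fun ξ => c * m ξ) (‖c‖ * C) := by
  have h : 𝓕⁻ (fun ξ => c * m ξ) = fun x => c * 𝓕⁻ m x := by
    funext x
    rw [Real.fourierInv_eq, Real.fourierInv_eq, ← integral_const_mul]
    congr 1; funext ξ
    rw [Circle.smul_def, Circle.smul_def, smul_eq_mul, smul_eq_mul]; ring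
  refine ⟨hm.1.const_mul c, ?_, ?_⟩
  · rw [h]; exact hm.2.const_mul c
  · rw [h]; simp_rw [norm_mul, integral_const_mul]
    exact mul_le_mul_of_nonneg_left hm.3 (norm_nonneg c)

theorem KerBound.add {m m' : V → ℂ} {C C' : ℝ} (hm : KerBound m C) (hm' : KerBound m' C') :
    KerBound (fun ξ => m ξ + m' ξ) (C + C') := by
  have hi : ∀ {f : V → ℂ}, Integrable f → ∀ x,
      Integrable fun ξ => Real.fourierChar (inner ℝ ξ x) • f ξ := fun {f} hf x => by
    have := (VectorFourier.fourierIntegral_convergent_iff (L := innerₗ V) (μ := volume) (f := f)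
      Real.continuous_fourierChar continuous_inner (-x)).2 hf
    simpa using this
  have h : 𝓕⁻ (fun ξ => m ξ + m' ξ) = fun x => 𝓕⁻ m x + 𝓕⁻ m' x := by
    funext x
    rw [Real.fourierInv_eq, Real.fourierInv_eq, Real.fourierInv_eq,
      ← integral_add (hi hm.1 x) (hi hm'.1 x)]
    simp_rw [smul_add]
  refine ⟨hm.1.add hm'.1, ?_, ?_⟩
  · rw [h]; exact hm.2.add hm'.2
  · rw [h]
    calc _ ≤ ∫ x, (‖𝓕⁻ m x‖ + ‖𝓕⁻ m' x‖) :=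
          integral_mono_of_nonneg (ae_of_all _ fun x => norm_nonneg _)
            (hm.2.norm.add hm'.2.norm) (ae_of_all _ fun x => norm_add_le _ _)
      _ = _ := integral_add hm.2.norm hm'.2.norm
      _ ≤ _ := add_le_add hm.3 hm'.3

/-- An integral of symbols with integrable kernels has an integrable kernel. -/
theorem KerBound.integral {Ω : Type*} [MeasurableSpace Ω] {μ : Measure Ω} [SFinite μ]
    {m : Ω → V → ℂ} {A : Ω → ℝ} (hmm : StronglyMeasurable (Function.uncurry m))
    (hmi : Integrable (Function.uncurry m) (μ.prod volume)) (hA : Integrable A μ)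
    (hm : ∀ᵐ ν ∂μ, KerBound (m ν) (A ν)) : KerBound (fun ξ => ∫ ν, m ν ξ ∂μ) (∫ ν, A ν ∂μ) := by
  have hkm : StronglyMeasurable (Function.uncurry fun ν x => 𝓕⁻ (m ν) x) := by
    have h1 : StronglyMeasurable (Function.uncurry fun (z : Ω × V) (ξ : V) =>
        Real.fourierChar (inner ℝ ξ z.2) • m z.1 ξ) := by
      have h2 : Continuous fun z : V × V => Real.fourierChar (inner ℝ z.2 z.1) :=
        Real.continuous_fourierChar.comp (continuous_snd.inner continuous_fst)
      have h3 : StronglyMeasurable fun z : (Ω × V) × V =>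
          Real.fourierChar (inner ℝ z.2 z.1.2) :=
        h2.stronglyMeasurable.comp_measurable
          ((measurable_snd.comp measurable_fst).prodMk measurable_snd)
      have h4 : StronglyMeasurable fun z : (Ω × V) × V => m z.1.1 z.2 :=
        hmm.comp_measurable ((measurable_fst.comp measurable_fst).prodMk measurable_snd)
      exact h3.smul h4
    have h5 := StronglyMeasurable.integral_prod_right (ν := (volume : Measure V)) h1
    simpa [Function.uncurry_def, Real.fourierInv_eq] using h5
  have hki : Integrable (Function.uncurry fun ν x => 𝓕⁻ (m ν) x) (μ.prod volume) := by
    rw [integrable_prod_iff hkm.aestronglyMeasurable]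
    refine ⟨hm.mono fun ν h => h.2, hA.mono' ?_ ?_⟩
    · exact (hkm.norm.integral_prod_right (f := fun ν x => ‖𝓕⁻ (m ν) x‖)).aestronglyMeasurable
    · refine hm.mono fun ν h => ?_
      rw [Real.norm_of_nonneg (integral_nonneg fun _ => norm_nonneg _)]
      exact h.3
  have hK : 𝓕⁻ (fun ξ => ∫ ν, m ν ξ ∂μ) = fun x => ∫ ν, 𝓕⁻ (m ν) x ∂μ := by
    funext x
    simp_rw [Real.fourierInv_eq]
    rw [integral_integral_swap]
    · congr 1; funext ξ
      simp_rw [Circle.smul_def]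
      rw [integral_smul]
    · have h2 : Continuous fun ξ : V => Real.fourierChar (inner ℝ ξ x) :=
        Real.continuous_fourierChar.comp (continuous_id.inner continuous_const)
      refine hmi.mono ?_ (ae_of_all _ fun z => ?_)
      · exact ((h2.stronglyMeasurable.comp_measurable measurable_snd).smul hmm).aestronglyMeasurable
      · simp only [Function.uncurry, Circle.norm_smul]; exact le_rfl
  refine ⟨hmi.integral_prod_right, ?_, ?_⟩
  · rw [hK]; exact hki.integral_prod_right
  · rw [hK]
    calc _ ≤ ∫ x, ∫ ν, ‖𝓕⁻ (m ν) x‖ ∂μ :=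
          integral_mono_of_nonneg (ae_of_all _ fun x => norm_nonneg _) hki.norm.integral_prod_right
            (ae_of_all _ fun x => norm_integral_le_integral_norm _)
      _ = ∫ ν, (∫ x, ‖𝓕⁻ (m ν) x‖) ∂μ := 
          (integral_integral_swap (f := fun ν x => ‖𝓕⁻ (m ν) x‖) hki.norm).symm
      _ ≤ _ := integral_mono_ae hki.norm.integral_prod_left hA (hm.mono fun ν h => h.3)

variable (V) in
/-- Kernel bounds for compactly supported symbols with bounded derivatives. -/
theorem exists_kerBound_of_iteratedFDeriv_le (ρ : ℝ) : ∃ (N : ℕ) (C : ℝ), 0 ≤ C ∧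
    ∀ m : V → ℂ, ContDiff ℝ ∞ m → (∀ ξ, ρ < ‖ξ‖ → m ξ = 0) → ∀ M : ℝ,
      (∀ n ≤ N, ∀ ξ, ‖iteratedFDeriv ℝ n m ξ‖ ≤ M) → KerBound m (C * M) := by
  classical
  -- The inverse Fourier transform is continuous from `𝓢` to `L¹`, hence dominated by finitely many
  -- Schwartz seminorms. These determine `N` and `C`, and the polynomial weights are bounded on the
  -- support by powers of `R`.
  set T : 𝓢(V, ℂ) →L[ℂ] Lp ℂ 1 (volume : Measure V) :=
    (SchwartzMap.toLpCLM ℂ ℂ 1 volume) ∘L (FourierTransform.fourierInvCLM ℂ 𝓢(V, ℂ)) with hT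
  obtain ⟨s, C, -, hC⟩ := Seminorm.bound_of_continuous (schwartz_withSeminorms ℂ V ℂ)
    ((normSeminorm ℂ (Lp ℂ 1 (volume : Measure V))).comp T.toLinearMap)
    (continuous_norm.comp T.continuous)
  set R : ℝ := max ρ 1 with hR
  have hR1 : 1 ≤ R := le_max_right _ _
  refine ⟨s.sup Prod.snd, C * R ^ (s.sup Prod.fst), by positivity, fun m hm hs M hM => ?_⟩
  have hsupp : tsupport m ⊆ Metric.closedBall 0 ρ := by
    refine closure_minimal (fun ξ hξ => ?_) Metric.isClosed_closedBall
    rw [mem_closedBall_zero_iff]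
    by_contra h
    exact hξ (hs ξ (not_le.1 h))
  have hcomp : HasCompactSupport m :=
    (isCompact_closedBall _ _).of_isClosed_subset (isClosed_tsupport _) hsupp
  set u : 𝓢(V, ℂ) := hcomp.toSchwartzMap hm with hu
  have huc : (u : V → ℂ) = m := rfl
  have hM0 : 0 ≤ M := (norm_nonneg _).trans (hM 0 (Nat.zero_le _) 0)
  have hsem : ∀ i ∈ s, schwartzSeminormFamily ℂ V ℂ i u ≤ R ^ (s.sup Prod.fst) * M := by
    rintro ⟨k, n⟩ hi
    refine SchwartzMap.seminorm_le_bound ℂ k n u (by positivity) fun x => ?_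
    rw [huc]
    by_cases hx : x ∈ Metric.closedBall (0 : V) ρ
    · rw [mem_closedBall_zero_iff] at hx
      have h1 : ‖x‖ ^ k ≤ R ^ (s.sup Prod.fst) :=
        (pow_le_pow_left₀ (norm_nonneg _) (hx.trans (le_max_left _ _)) k).trans
          (pow_le_pow_right₀ hR1 (Finset.le_sup (f := Prod.fst) hi))
      exact mul_le_mul h1 (hM n (Finset.le_sup (f := Prod.snd) hi) x) (norm_nonneg _)
        (by positivity)
    · have : iteratedFDeriv ℝ n m x = 0 := by
        by_contra h
        exact hx (hsupp (support_iteratedFDeriv_subset n h))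
      rw [this, norm_zero, mul_zero]; positivity
  have h1 : ‖T u‖ ≤ C * (R ^ (s.sup Prod.fst) * M) := by
    refine (hC u).trans ?_
    rw [smul_apply, NNReal.smul_def, smul_eq_mul]
    gcongr
    exact Seminorm.finset_sup_apply_le (by positivity) hsem
  have h2 : ‖T u‖ = ∫ x, ‖𝓕⁻ m x‖ := by
    have h3 : T u = (𝓕⁻ u : 𝓢(V, ℂ)).toLp 1 volume := rfl
    rw [h3, L1.norm_eq_integral_norm]
    refine integral_congr_ae ?_
    filter_upwards [(𝓕⁻ u : 𝓢(V, ℂ)).coeFn_toLp 1 volume] with x hx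
    rw [hx, SchwartzMap.fourierInv_coe, huc]
  refine ⟨huc ▸ u.integrable, ?_, ?_⟩
  · have := (𝓕⁻ u : 𝓢(V, ℂ)).integrable (μ := volume)
    rwa [SchwartzMap.fourierInv_coe, huc] at this
  · rw [← h2, mul_assoc]; exact h1

/-- The source of all uniform kernel bounds: after rescaling, every parameter of the problem ranges
over a compact set on which the symbol is jointly smooth, degenerate values included. -/
theorem exists_kerBound_of_isCompact {W : Type*} [NormedAddCommGroup W] [NormedSpace ℝ W]
    {F : W × V → ℂ} (hF : ContDiff ℝ ∞ F) {S : Set W} (hS : IsCompact S) {ρ : ℝ}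
    (hsupp : ∀ w ∈ S, ∀ ξ, ρ < ‖ξ‖ → F (w, ξ) = 0) :
    ∃ C : ℝ, 0 ≤ C ∧ ∀ w ∈ S, KerBound (fun ξ => F (w, ξ)) C := by
  obtain ⟨N, C, hC, H⟩ := exists_kerBound_of_iteratedFDeriv_le V ρ
  choose M hM using fun n => exists_iteratedFDeriv_le_of_isCompact hF hS (ρ + 1) n
  set M' : ℝ := ∑ n ∈ Finset.range (N + 1), |M n| with hM'
  refine ⟨C * M', mul_nonneg hC (Finset.sum_nonneg fun _ _ => abs_nonneg _), fun w hw => ?_⟩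
  have hsm : ContDiff ℝ ∞ fun ξ => F (w, ξ) := hF.comp (contDiff_const.prodMk contDiff_id)
  refine H _ hsm (hsupp w hw) M' fun n hn ξ => ?_
  by_cases hξ : ‖ξ‖ ≤ ρ + 1
  · refine (hM n w hw ξ hξ).trans ((le_abs_self _).trans ?_)
    exact Finset.single_le_sum (f := fun n => |M n|) (fun _ _ => abs_nonneg _)
      (Finset.mem_range.2 (Nat.lt_succ_of_le hn))
  · have : iteratedFDeriv ℝ n (fun ξ => F (w, ξ)) ξ = 0 := by
      by_contra h
      have h1 := support_iteratedFDeriv_subset n h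
      have h2 : tsupport (fun ξ => F (w, ξ)) ⊆ Metric.closedBall 0 ρ := by
        refine closure_minimal (fun ξ hξ => ?_) Metric.isClosed_closedBall
        rw [mem_closedBall_zero_iff]
        by_contra h
        exact hξ (hsupp w hw ξ (not_le.1 h))
      have h3 := mem_closedBall_zero_iff.1 (h2 h1)
      linarith
    rw [this, norm_zero]
    exact Finset.sum_nonneg fun _ _ => abs_nonneg _

end KerBound

/-! ### Smoothness lemmas -/

section Calculus

variable {X G : Type*} [NormedAddCommGroup X] [NormedSpace ℝ X] [NormedAddCommGroup G]
  [NormedSpace ℝ G]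

theorem contDiff_smul_of_tsupport_subset {f : X → ℝ} {g : X → G} {U : Set X} (hU : IsOpen U)
    (hf : ContDiff ℝ ∞ f) (hg : ContDiffOn ℝ ∞ g U) (h : tsupport f ⊆ U) :
    ContDiff ℝ ∞ fun x => f x • g x := by
  rw [contDiff_iff_contDiffAt]
  intro x
  by_cases hx : x ∈ U
  · exact hf.contDiffAt.smul (hg.contDiffAt (hU.mem_nhds hx))
  · have h1 : f =ᶠ[nhds x] 0 := notMem_tsupport_iff_eventuallyEq.1 fun h' => hx (h h')
    have h2 : (fun x => f x • g x) =ᶠ[nhds x] fun _ => 0 := by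
      filter_upwards [h1] with y hy
      rw [hy, Pi.zero_apply, zero_smul]
    exact contDiffAt_const.congr_of_eventuallyEq h2

/-- The integral is a convolution in the variable `s`, evaluated at zero, of the indicator of `(0,
1]` with `f (x, -·)`. The bump function `χ` supplies compact support and equals one where it
matters. -/
theorem contDiff_intervalIntegral_param {f : X × ℝ → G} (hf : ContDiff ℝ ∞ f) :
    ContDiff ℝ ∞ fun x => ∫ s in (0 : ℝ)..1, f (x, s) := by
  let χ : ContDiffBump (0 : ℝ) := ⟨2, 3, by norm_num, by norm_num⟩
  have hg : ContDiff ℝ ∞ (Function.uncurry fun (x : X) (τ : ℝ) => χ τ • f (x, -τ)) := by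
    have h1 : ContDiff ℝ ∞ fun z : X × ℝ => χ z.2 := χ.contDiff.comp contDiff_snd
    have h2 : ContDiff ℝ ∞ fun z : X × ℝ => f (z.1, -z.2) :=
      hf.comp (contDiff_fst.prodMk contDiff_snd.neg)
    exact h1.smul h2
  have key := contDiffOn_convolution_right_with_param_comp (μ := (volume : Measure ℝ))
    (n := ⊤) (ContinuousLinearMap.lsmul ℝ ℝ : ℝ →L[ℝ] G →L[ℝ] G) (s := Set.univ)
    (v := fun _ : X => (0 : ℝ)) contDiffOn_const
    (f := Set.indicator (Set.Ioc (0 : ℝ) 1) fun _ => (1 : ℝ))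
    (g := fun (x : X) (τ : ℝ) => χ τ • f (x, -τ)) isOpen_univ
    (isCompact_closedBall (0 : ℝ) 3) (fun x τ _ hτ => by
      rw [χ.zero_of_le_dist (le_of_lt (not_le.1 hτ)), zero_smul])
    ((integrable_indicator_iff measurableSet_Ioc).2
      (integrableOn_const (by simp))).locallyIntegrable hg.contDiffOn
  rw [contDiffOn_univ] at key
  convert key using 1
  funext x
  rw [convolution_def, intervalIntegral.integral_of_le zero_le_one, ← integral_indicator
    measurableSet_Ioc]
  congr 1
  funext s
  by_cases hs : s ∈ Set.Ioc (0 : ℝ) 1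
  · have : χ (-s) = 1 := χ.one_of_mem_closedBall (by
      rw [mem_closedBall_zero_iff, Real.norm_eq_abs, abs_neg, abs_of_pos hs.1]
      exact hs.2.trans one_le_two)
    simp [Set.indicator_of_mem hs, this]
  · simp [Set.indicator_of_notMem hs]

/-- Hadamard's lemma. -/
theorem exists_hadamard [CompleteSpace G] {f : X → G} (hf : ContDiff ℝ ∞ f) :
    ∃ K : X × X → X →L[ℝ] G, ContDiff ℝ ∞ K ∧ ∀ x h, f (x + h) - f x = K (x, h) h := by
  have hf' : ContDiff ℝ ∞ (fderiv ℝ f) := hf.fderiv_right (mod_cast le_top)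
  have hs : ContDiff ℝ ∞ fun z : (X × X) × ℝ => fderiv ℝ f (z.1.1 + z.2 • z.1.2) :=
    hf'.comp (by fun_prop)
  refine ⟨fun z => ∫ s in (0 : ℝ)..1, fderiv ℝ f (z.1 + s • z.2),
    contDiff_intervalIntegral_param hs, fun x h => ?_⟩
  have hc : Continuous fun s : ℝ => fderiv ℝ f (x + s • h) :=
    hf'.continuous.comp (by fun_prop)
  have h1 : ∀ s ∈ Set.uIcc (0 : ℝ) 1, HasDerivAt (fun s : ℝ => f (x + s • h))
      (fderiv ℝ f (x + s • h) h) s := fun s _ => by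
    have h2 : HasDerivAt (fun s : ℝ => x + s • h) h s := by
      simpa using ((hasDerivAt_id s).smul_const h).const_add x
    exact ((hf.differentiable (by simp)) (x + s • h)).hasFDerivAt.comp_hasDerivAt s h2
  have h3 := intervalIntegral.integral_eq_sub_of_hasDerivAt h1
    ((hc.clm_apply continuous_const).intervalIntegrable _ _)
  simp only [one_smul, zero_smul, add_zero] at h3
  rw [← h3, ContinuousLinearMap.intervalIntegral_apply (hc.intervalIntegrable _ _)]

/-- Second-order Taylor expansion with a smooth remainder. -/
theorem exists_taylor_two {f : X → ℝ} (hf : ContDiff ℝ ∞ f) :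
    ∃ (K : X → X →L[ℝ] ℝ) (H : X × ℝ × X → ℝ), ContDiff ℝ ∞ H ∧ ∀ x (δ : ℝ) u,
      f (x + δ • u) = f x + δ * K x u + δ ^ 2 * H (x, δ, u) := by
  obtain ⟨K, hK, h1⟩ := exists_hadamard hf
  obtain ⟨K₂, hK₂, h2⟩ := exists_hadamard hK
  -- Hadamard's lemma for `f` and then for `K`. The remainder is smooth in the scale `δ` up to `δ =
  -- 0`, which keeps it bounded as the caps shrink.
  refine ⟨fun x => K (x, 0), fun z => K₂ ((z.1, 0), (0, z.2.1 • z.2.2)) (0, z.2.2) z.2.2, ?_,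
    fun x δ u => ?_⟩
  · have : ContDiff ℝ ∞ fun z : X × ℝ × X => K₂ ((z.1, 0), ((0 : X), z.2.1 • z.2.2)) :=
      hK₂.comp (by fun_prop)
    exact (this.clm_apply (by fun_prop)).clm_apply (by fun_prop)
  · have e1 := h1 x (δ • u)
    have e2 := h2 (x, 0) (0, δ • u)
    simp only [Prod.mk_add_mk, add_zero, zero_add] at e2
    have e3 : ((0 : X), δ • u) = δ • ((0 : X), u) := by simp
    have e4 : K (x, δ • u) u = K (x, 0) u + δ * K₂ ((x, 0), (0, δ • u)) (0, u) u := by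
      have := congrArg (fun L : X →L[ℝ] ℝ => L u) e2
      simp only [_root_.sub_apply] at this
      conv_rhs at this => rw [show K₂ ((x, 0), (0, δ • u)) (0, δ • u) =
        δ • K₂ ((x, 0), (0, δ • u)) (0, u) by rw [← map_smul, ← e3]]
      simp only [_root_.smul_apply, smul_eq_mul] at this
      linarith
    rw [map_smul, smul_eq_mul, e4] at e1
    linear_combination e1

end Calculus

/-! ### Symbols localised to a cap -/

section Cap

variable {V : Type*} [NormedAddCommGroup V] [InnerProductSpace ℝ V]

theorem exists_contDiff_eq_of_le_norm {Φ : V → ℝ} (hΦ : ContDiffOn ℝ ∞ Φ {0}ᶜ) {r : ℝ}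
    (hr : 0 < r) : ∃ Ψ : V → ℝ, ContDiff ℝ ∞ Ψ ∧ ∀ x, r ≤ ‖x‖ → Ψ x = Φ x := by
  let χ : ℝ → ℝ := fun s => Real.smoothTransition (2 * (r ^ 2)⁻¹ * s - 1)
  have hχ : ContDiff ℝ ∞ fun x : V => χ (‖x‖ ^ 2) :=
    Real.smoothTransition.contDiff.comp (by
      have := contDiff_norm_sq ℝ (E := V) (n := ∞)
      fun_prop)
  refine ⟨fun x => χ (‖x‖ ^ 2) • Φ x, contDiff_smul_of_tsupport_subset isOpen_compl_singleton
    hχ hΦ fun x hx => ?_, fun x hx => ?_⟩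
  · rintro rfl
    refine notMem_tsupport_iff_eventuallyEq.2 ?_ hx
    have h1 : Continuous fun x : V => 2 * (r ^ 2)⁻¹ * ‖x‖ ^ 2 - 1 := by fun_prop
    have h2 : ∀ᶠ x : V in nhds 0, 2 * (r ^ 2)⁻¹ * ‖x‖ ^ 2 - 1 < 0 :=
      h1.continuousAt.eventually_lt continuousAt_const (by simp)
    filter_upwards [h2] with x hx
    exact Real.smoothTransition.zero_of_nonpos hx.le
  · have h1 : r ^ 2 ≤ ‖x‖ ^ 2 := by gcongr
    have h2 : 1 ≤ (r ^ 2)⁻¹ * ‖x‖ ^ 2 := by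
      rw [inv_mul_eq_div]; exact (one_le_div (by positivity)).2 h1
    have : χ (‖x‖ ^ 2) = 1 := Real.smoothTransition.one_of_one_le (by linarith)
    simp only [this, one_smul]

/-- The affine chart of the half space `⟪ξ, θ⟫ > 0` of directions, centred at the unit vector
`θ`. -/
noncomputable def capChart (θ ξ : V) : V := (inner ℝ ξ θ)⁻¹ • ξ - θ

variable [FiniteDimensional ℝ V]

/-- This map carries a region of unit size to the cap of centre `y` and size `δ` at frequency `R`:
in the chart, the image of `η` is `y + δ · η_⊥ / ⟪η, θ⟫`. Injectivity follows by pairing with `θ`.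
-/
theorem exists_linearEquiv_cap {θ y : V} (hθ : ‖θ‖ = 1) (hy : inner ℝ y θ = 0) {R δ : ℝ}
    (hR : R ≠ 0) (hδ : δ ≠ 0) : ∃ A : V ≃ₗ[ℝ] V, ∀ η, A η =
      R • (inner ℝ η θ • (θ + y) + δ • (η - inner ℝ η θ • θ)) := by
  let f : V →ₗ[ℝ] V :=
    { toFun := fun η => R • (inner ℝ η θ • (θ + y) + δ • (η - inner ℝ η θ • θ))
      map_add' := fun x z => by simp only [inner_add_left]; module
      map_smul' := fun c x => by
        simp only [inner_smul_left, RingHom.id_apply, RCLike.conj_to_real]; module }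
  have hθθ : inner ℝ θ θ = 1 := by rw [real_inner_self_eq_norm_sq, hθ, one_pow]
  have hf : Function.Injective f := by
    rw [← LinearMap.ker_eq_bot, LinearMap.ker_eq_bot']
    intro η h
    have h0 : inner ℝ η θ • (θ + y) + δ • (η - inner ℝ η θ • θ) = 0 :=
      (smul_eq_zero.1 h).resolve_left hR
    have h1 := congrArg (fun x => inner ℝ x θ) h0
    simp only [inner_add_left, inner_smul_left, inner_sub_left, hy, hθθ, inner_zero_left,
      RCLike.conj_to_real] at h1
    have h2 : inner ℝ η θ = 0 := by linarith
    rw [h2] at h0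
    simpa [hδ] using h0
  exact ⟨LinearEquiv.ofInjectiveEndo f hf, fun η => rfl⟩

variable [MeasurableSpace V] [BorelSpace V]

/-- The symbol of a propagator, localised to a cap of angular size `δ` on which its phase is
linear up to a bounded error, has a kernel bounded in `L^1`. -/
theorem exists_kerBound_cap {Φ : V → ℝ} (hΦ : ContDiffOn ℝ ∞ Φ {0}ᶜ)
    (hΦh : ∀ (r : ℝ) (ξ : V), 0 < r → ξ ≠ 0 → Φ (r • ξ) = r * Φ ξ)
    {W : Type*} [NormedAddCommGroup W] [NormedSpace ℝ W] {G : W × V → ℂ} (hG : ContDiff ℝ ∞ G)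
    {S : Set W} (hS : IsCompact S) {X : ℝ → ℝ} (hX : ContDiff ℝ ∞ X) {l L : ℝ} (hl : 0 < l)
    (hXs : ∀ a, a ∉ Set.Icc l L → X a = 0) {b : V → ℝ} (hb : ContDiff ℝ ∞ b)
    (hbs : ∀ z, 2 < ‖z‖ → b z = 0) (Y₀ : ℝ) :
    ∃ C : ℝ, 0 ≤ C ∧ ∀ w ∈ S, ∀ θ y : V, ‖θ‖ = 1 → inner ℝ y θ = 0 → ‖y‖ ≤ Y₀ →
      ∀ R δ t : ℝ, 0 < R → 0 < δ → δ ≤ 1 → |t| * R * δ ^ 2 ≤ 1 →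
      KerBound (fun ξ => (X (R⁻¹ * inner ℝ ξ θ) : ℂ) * G (w, R⁻¹ • ξ) *
        b (δ⁻¹ • (capChart θ ξ - y)) * Complex.exp (Complex.I * t * Φ ξ)) C := by
  -- The phase will only be evaluated at points `x` with `⟪x, θ⟫ = 1`, hence `‖x‖ ≥ 1`, so its
  -- singularity at the origin can be removed.
  obtain ⟨Ψ, hΨ, hΨΦ⟩ := exists_contDiff_eq_of_le_norm hΦ one_pos
  obtain ⟨K, H, hH, hT⟩ := exists_taylor_two hΨ
  let E := (W × V × V × ℝ × ℝ) × V
  let α : E → ℝ := fun z => inner ℝ z.2 z.1.2.1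
  let ζ : E → V := fun z => z.2 - α z • z.1.2.1
  have hα : ContDiff ℝ ∞ α := ContDiff.inner ℝ (by fun_prop) (by fun_prop)
  have hζ : ContDiff ℝ ∞ ζ := by fun_prop
  let U : Set E := {z | 0 < α z}
  have hU : IsOpen U := isOpen_lt continuous_const hα.continuous
  have hαi : ContDiffOn ℝ ∞ (fun z => (α z)⁻¹) U :=
    hα.contDiffOn.inv fun z hz => ne_of_gt hz
  have hu : ContDiffOn ℝ ∞ (fun z => (α z)⁻¹ • ζ z) U := hαi.smul hζ.contDiffOn
  -- The localised symbol in rescaled coordinates, without its linear phase. The parameters are `(w,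
  -- θ, y, δ, τ)`, with `τ = t R δ²`.
  let g : E → ℂ := fun z =>
    G (z.1.1, α z • (z.1.2.1 + z.1.2.2.1) + z.1.2.2.2.1 • ζ z) * b ((α z)⁻¹ • ζ z) *
      Complex.exp (Complex.I * ((z.1.2.2.2.2 * α z *
        H (z.1.2.1 + z.1.2.2.1, z.1.2.2.2.1, (α z)⁻¹ • ζ z) : ℝ) : ℂ))
  have hg : ContDiffOn ℝ ∞ g U := by
    have e1 : ContDiff ℝ ∞ fun z : E =>
        G (z.1.1, α z • (z.1.2.1 + z.1.2.2.1) + z.1.2.2.2.1 • ζ z) := hG.comp (by fun_prop)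
    have e2 : ContDiffOn ℝ ∞ (fun z : E => ((b ((α z)⁻¹ • ζ z) : ℝ) : ℂ)) U :=
      Complex.ofRealCLM.contDiff.comp_contDiffOn (hb.comp_contDiffOn hu)
    have e3 : ContDiffOn ℝ ∞ (fun z : E =>
        H (z.1.2.1 + z.1.2.2.1, z.1.2.2.2.1, (α z)⁻¹ • ζ z)) U := by
      refine hH.comp_contDiffOn (ContDiffOn.prodMk ?_ (ContDiffOn.prodMk ?_ hu))
      · exact ContDiff.contDiffOn (by fun_prop)
      · exact ContDiff.contDiffOn (by fun_prop)
    have e4 : ContDiffOn ℝ ∞ (fun z : E => z.1.2.2.2.2 * α z *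
        H (z.1.2.1 + z.1.2.2.1, z.1.2.2.2.1, (α z)⁻¹ • ζ z)) U :=
      (ContDiff.contDiffOn (by fun_prop)).mul e3
    have e5 : ContDiff ℝ ∞ fun s : ℝ => Complex.exp (Complex.I * (s : ℂ)) := by
      have := Complex.ofRealCLM.contDiff (n := ∞)
      exact Complex.contDiff_exp.comp (contDiff_const.mul this)
    exact (e1.contDiffOn.mul e2).mul (e5.comp_contDiffOn e4)
  have hXα : ContDiff ℝ ∞ fun z => X (α z) := hX.comp hα
  have hF : ContDiff ℝ ∞ fun z => X (α z) • g z := by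
    refine contDiff_smul_of_tsupport_subset hU hXα hg fun z hz => ?_
    have h1 : tsupport (fun z => X (α z)) ⊆ {z | l ≤ α z} := by
      refine closure_minimal (fun z hz => ?_) (isClosed_le continuous_const hα.continuous)
      by_contra h
      exact hz (hXs _ fun h' => h h'.1)
    exact hl.trans_le (h1 hz)
  -- The value `δ = 0` belongs to the compact parameter set. The support radius is `3L` because `‖η‖
  -- ≤ ‖ζ‖ + α`, with `α ≤ L` and `‖ζ‖ ≤ 2α`.
  obtain ⟨C, hC, hker⟩ := exists_kerBound_of_isCompact hF
    (S := S ×ˢ Metric.sphere (0 : V) 1 ×ˢ Metric.closedBall (0 : V) Y₀ ×ˢ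
      Set.Icc (0 : ℝ) 1 ×ˢ Set.Icc (-1 : ℝ) 1)
    (hS.prod ((isCompact_sphere _ _).prod ((isCompact_closedBall _ _).prod
      (isCompact_Icc.prod isCompact_Icc)))) (ρ := 3 * L) (by
    rintro ⟨w, θ, y, δ, τ⟩ ⟨-, hθ, -⟩ η hη
    have hθ1 : ‖θ‖ = 1 := mem_sphere_zero_iff_norm.1 hθ
    by_cases ha : α ((w, θ, y, δ, τ), η) ∈ Set.Icc l L
    · have ha0 : 0 < α ((w, θ, y, δ, τ), η) := hl.trans_le ha.1
      have h1 : 2 < ‖(α ((w, θ, y, δ, τ), η))⁻¹ • ζ ((w, θ, y, δ, τ), η)‖ := by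
        rw [norm_smul, norm_inv, Real.norm_of_nonneg ha0.le, inv_mul_eq_div, lt_div_iff₀ ha0]
        have h2 : ‖η‖ ≤ ‖ζ ((w, θ, y, δ, τ), η)‖ + α ((w, θ, y, δ, τ), η) := by
          have : η = ζ ((w, θ, y, δ, τ), η) + α ((w, θ, y, δ, τ), η) • θ := by simp [ζ]
          calc ‖η‖ = ‖ζ ((w, θ, y, δ, τ), η) + α ((w, θ, y, δ, τ), η) • θ‖ := by rw [← this]
            _ ≤ _ := norm_add_le _ _
            _ = _ := by rw [norm_smul, hθ1, mul_one, Real.norm_of_nonneg ha0.le]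
        have := ha.2
        linarith
      simp only [g, hbs _ h1, Complex.ofReal_zero, mul_zero, zero_mul, smul_zero]
    · simp only [hXs _ ha, zero_smul])
  refine ⟨C, hC, fun w hw θ y hθ hy hyY R δ t hR hδ hδ1 htR => ?_⟩
  obtain ⟨A, hA⟩ := exists_linearEquiv_cap hθ hy hR.ne' hδ.ne'
  have hθθ : inner ℝ θ θ = 1 := by rw [real_inner_self_eq_norm_sq, hθ, one_pow]
  refine KerBound.of_comp_linearEquiv A ?_
  have hτ : t * R * δ ^ 2 ∈ Set.Icc (-1 : ℝ) 1 := by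
    refine abs_le.1 ?_
    rwa [abs_mul, abs_mul, abs_of_pos hR, abs_of_nonneg (sq_nonneg δ)]
  have h0 := hker (w, θ, y, δ, t * R * δ ^ 2)
    ⟨hw, mem_sphere_zero_iff_norm.2 hθ, mem_closedBall_zero_iff.2 hyY, ⟨hδ.le, hδ1⟩, hτ⟩
  set v : V := (InnerProductSpace.toDual ℝ V).symm (K (θ + y)) with hv
  have hKv : ∀ x, K (θ + y) x = inner ℝ v x := fun x => by
    rw [hv, InnerProductSpace.toDual_symm_apply]
  refine (h0.modulate ((t * R) • (Ψ (θ + y) • θ + δ • (v - inner ℝ v θ • θ)))).congr_ae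
    (Filter.Eventually.of_forall fun η => ?_)
  have e1 : inner ℝ (A η) θ = R * inner ℝ η θ := by
    rw [hA]
    simp only [inner_smul_left, inner_add_left, inner_sub_left, hθθ, hy, RCLike.conj_to_real]
    ring
  have e2 : R⁻¹ * inner ℝ (A η) θ = inner ℝ η θ := by rw [e1, inv_mul_cancel_left₀ hR.ne']
  by_cases ha : inner ℝ η θ ∈ Set.Icc l L
  · have ha0 : 0 < inner ℝ η θ := hl.trans_le ha.1
    have e3 : R⁻¹ • A η = inner ℝ η θ • (θ + y) + δ • (η - inner ℝ η θ • θ) := by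
      rw [hA, smul_smul, inv_mul_cancel₀ hR.ne', one_smul]
    have e4 : δ⁻¹ • (capChart θ (A η) - y) = (inner ℝ η θ)⁻¹ • (η - inner ℝ η θ • θ) := by
      rw [capChart, e1, mul_inv, mul_comm, ← smul_smul, e3, smul_add, smul_smul,
        inv_mul_cancel₀ ha0.ne', one_smul, smul_comm _ δ]
      rw [show θ + y + δ • (inner ℝ η θ)⁻¹ • (η - inner ℝ η θ • θ) - θ - y =
        δ • (inner ℝ η θ)⁻¹ • (η - inner ℝ η θ • θ) by abel, smul_smul, inv_mul_cancel₀ hδ.ne',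
        one_smul]
    have e5 : A η = (R * inner ℝ η θ) •
        ((θ + y) + δ • (inner ℝ η θ)⁻¹ • (η - inner ℝ η θ • θ)) := by
      have : δ • (η - inner ℝ η θ • θ) =
          inner ℝ η θ • δ • (inner ℝ η θ)⁻¹ • (η - inner ℝ η θ • θ) := by
        rw [smul_comm _ δ, smul_smul (inner ℝ η θ), mul_inv_cancel₀ ha0.ne', one_smul]
      rw [hA, this, ← smul_add, smul_smul]
    set x := (θ + y) + δ • (inner ℝ η θ)⁻¹ • (η - inner ℝ η θ • θ) with hx
    have e6 : inner ℝ x θ = 1 := by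
      rw [hx]
      simp only [inner_smul_left, inner_add_left, inner_sub_left, hθθ, hy, RCLike.conj_to_real]
      ring
    have e7 : 1 ≤ ‖x‖ := by
      have := real_inner_le_norm x θ
      rw [e6, hθ, mul_one] at this
      exact this
    have e8 : Φ (A η) = (R * inner ℝ η θ) * Ψ x := by
      rw [e5, hΦh _ _ (mul_pos hR ha0) (norm_pos_iff.1 (one_pos.trans_le e7)), hΨΦ x e7]
    -- By homogeneity `tΦ(Aη) = tR ⟪η, θ⟫ Ψ(x)`. The factor `⟪η, θ⟫` cancels the denominator in the
    -- first-order Taylor term, so the first two terms are exactly linear in `η`.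
    have e9 : t * Φ (A η) = inner ℝ η ((t * R) • (Ψ (θ + y) • θ + δ • (v - inner ℝ v θ • θ))) +
        t * R * δ ^ 2 * inner ℝ η θ *
          H (θ + y, δ, (inner ℝ η θ)⁻¹ • (η - inner ℝ η θ • θ)) := by
      rw [e8, hx, hT, map_smul, hKv]
      simp only [inner_smul_right, inner_add_right, inner_sub_right, smul_eq_mul]
      rw [real_inner_comm v η]
      field_simp
    have e10 : Complex.I * t * Φ (A η) = Complex.I * ((t * Φ (A η) : ℝ) : ℂ) := by
      push_cast; ring
    beta_reduce
    rw [e10, e9, e2, e3, e4]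
    simp only [α, ζ, g, Complex.real_smul]
    rw [Complex.ofReal_add, mul_add, Complex.exp_add]
    ring
  · simp only [α, e2, hXs _ ha, zero_smul, mul_zero, Complex.ofReal_zero, zero_mul]

end Cap

/-! ### Averages of translated cut-off functions -/

section Average

variable {F : Type*} [NormedAddCommGroup F]

/-- A radial cut-off function, equal to `1` on the unit ball. -/
noncomputable def radialCutoff (x : F) : ℝ := Real.smoothTransition (2 - ‖x‖ ^ 2)

theorem radialCutoff_nonneg (x : F) : 0 ≤ radialCutoff x := Real.smoothTransition.nonneg _

theorem radialCutoff_le_one (x : F) : radialCutoff x ≤ 1 := Real.smoothTransition.le_one _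

theorem radialCutoff_one {x : F} (hx : ‖x‖ ≤ 1) : radialCutoff x = 1 :=
  Real.smoothTransition.one_of_one_le (by nlinarith [norm_nonneg x])

theorem radialCutoff_zero {x : F} (hx : 2 ≤ ‖x‖ ^ 2) : radialCutoff x = 0 :=
  Real.smoothTransition.zero_of_nonpos (by linarith)

theorem radialCutoff_zero_of_two_le {x : F} (hx : 2 ≤ ‖x‖) : radialCutoff x = 0 :=
  radialCutoff_zero (by nlinarith)

variable [InnerProductSpace ℝ F]

theorem contDiff_radialCutoff : ContDiff ℝ ∞ (radialCutoff : F → ℝ) :=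
  Real.smoothTransition.contDiff.comp (contDiff_const.sub (contDiff_norm_sq ℝ))

theorem radialCutoff_map {F' : Type*} [NormedAddCommGroup F'] [InnerProductSpace ℝ F']
    (J : F →ₗᵢ[ℝ] F') (x : F) : radialCutoff (J x) = radialCutoff x := by
  rw [radialCutoff, J.norm_map, radialCutoff]

theorem norm_sub_lt_of_radialCutoff_ne {δ : ℝ} (hδ : 0 < δ) {x : F}
    (h : radialCutoff (δ⁻¹ • x) ≠ 0) : ‖x‖ < 2 * δ := by
  by_contra h'
  refine h (radialCutoff_zero_of_two_le ?_)
  rw [norm_smul, norm_inv, Real.norm_of_nonneg hδ.le, inv_mul_eq_div, le_div_iff₀ hδ]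
  exact not_lt.1 h'

variable [FiniteDimensional ℝ F]

theorem hasCompactSupport_radialCutoff_smul {δ : ℝ} (hδ : 0 < δ) :
    HasCompactSupport fun x : F => radialCutoff (δ⁻¹ • x) := by
  refine HasCompactSupport.of_support_subset_isCompact (isCompact_closedBall (0 : F) (2 * δ))
    fun x hx => ?_
  rw [mem_closedBall_zero_iff]
  by_contra h
  refine hx (radialCutoff_zero_of_two_le ?_)
  rw [norm_smul, norm_inv, Real.norm_of_nonneg hδ.le, inv_mul_eq_div, le_div_iff₀ hδ]
  exact (not_le.1 h).le

variable [MeasurableSpace F] [BorelSpace F]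

theorem integrable_radialCutoff_smul {δ : ℝ} (hδ : 0 < δ) :
    Integrable fun x : F => radialCutoff (δ⁻¹ • x) :=
  (contDiff_radialCutoff.continuous.comp (continuous_const_smul _)).integrable_of_hasCompactSupport
    (hasCompactSupport_radialCutoff_smul hδ)

/-- The average over a ball of the translates of the cut-off function of scale `δ`. -/
noncomputable def ballAverage (δ Y : ℝ) (w : F) : ℝ :=
  (∫ y : F, radialCutoff (δ⁻¹ • y))⁻¹ *
    ∫ y in Metric.closedBall (0 : F) Y, radialCutoff (δ⁻¹ • (w - y))

theorem volume_ball_le_integral_radialCutoff {δ : ℝ} (hδ : 0 < δ) :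
    δ ^ Module.finrank ℝ F * volume.real (Metric.closedBall (0 : F) 1) ≤
      ∫ y : F, radialCutoff (δ⁻¹ • y) := by
  rw [Measure.integral_comp_inv_smul_of_nonneg _ _ hδ.le, smul_eq_mul]
  gcongr
  have h1 : Integrable (radialCutoff : F → ℝ) := by
    simpa using integrable_radialCutoff_smul (F := F) one_pos
  calc volume.real (Metric.closedBall (0 : F) 1)
      = ∫ x in Metric.closedBall (0 : F) 1, radialCutoff x := by
        rw [setIntegral_congr_fun (g := fun _ => (1 : ℝ)) measurableSet_closedBall
          fun x hx => radialCutoff_one (mem_closedBall_zero_iff.1 hx)]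
        simp
    _ ≤ _ := setIntegral_le_integral h1 (Filter.Eventually.of_forall radialCutoff_nonneg)

theorem integral_radialCutoff_pos {δ : ℝ} (hδ : 0 < δ) :
    0 < ∫ y : F, radialCutoff (δ⁻¹ • y) := by
  refine lt_of_lt_of_le ?_ (volume_ball_le_integral_radialCutoff hδ)
  have : 0 < volume.real (Metric.closedBall (0 : F) 1) :=
    ENNReal.toReal_pos (Metric.measure_closedBall_pos _ _ one_pos).ne' measure_closedBall_lt_top.ne
  positivity

/-- This quotient counts the caps of size `δ` needed to fill a ball of radius `Y`. -/
theorem volume_closedBall_div_le {δ Y : ℝ} (hδ : 0 < δ) (hY : 0 < Y) :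
    (∫ y : F, radialCutoff (δ⁻¹ • y))⁻¹ * volume.real (Metric.closedBall (0 : F) Y) ≤
      (Y / δ) ^ Module.finrank ℝ F := by
  have h1 : volume.real (Metric.closedBall (0 : F) Y) =
      Y ^ Module.finrank ℝ F * volume.real (Metric.closedBall (0 : F) 1) := by
    rw [Measure.real, Measure.addHaar_closedBall' volume 0 hY.le, ENNReal.toReal_mul,
      ENNReal.toReal_ofReal (by positivity), Measure.real]
  rw [h1, inv_mul_le_iff₀ (integral_radialCutoff_pos hδ)]
  have h2 := volume_ball_le_integral_radialCutoff (F := F) hδ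
  calc _ = (δ ^ Module.finrank ℝ F * volume.real (Metric.closedBall (0 : F) 1)) *
        (Y / δ) ^ Module.finrank ℝ F := by rw [div_pow]; field_simp
    _ ≤ _ := by gcongr

theorem ballAverage_nonneg (δ Y : ℝ) (w : F) : 0 ≤ ballAverage δ Y w :=
  mul_nonneg (inv_nonneg.2 (integral_nonneg fun _ => radialCutoff_nonneg _))
    (integral_nonneg fun _ => radialCutoff_nonneg _)

theorem ballAverage_le_one {δ : ℝ} (hδ : 0 < δ) (Y : ℝ) (w : F) : ballAverage δ Y w ≤ 1 := by
  rw [ballAverage, inv_mul_le_iff₀ (integral_radialCutoff_pos hδ), mul_one,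
    ← integral_sub_left_eq_self (fun y : F => radialCutoff (δ⁻¹ • y)) volume w]
  exact setIntegral_le_integral ((integrable_radialCutoff_smul hδ).comp_sub_left w)
    (Filter.Eventually.of_forall fun _ => radialCutoff_nonneg _)

/-- The translates that meet `w` have centres within `2δ` of it, hence in the ball, and the
truncated integral is the full one. -/
theorem ballAverage_one {δ Y : ℝ} (hδ : 0 < δ) {w : F} (h : ‖w‖ + 2 * δ ≤ Y) :
    ballAverage δ Y w = 1 := by
  rw [ballAverage, setIntegral_eq_integral_of_forall_compl_eq_zero,
    integral_sub_left_eq_self (fun y : F => radialCutoff (δ⁻¹ • y)) volume w,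
    inv_mul_cancel₀ (integral_radialCutoff_pos hδ).ne']
  intro y hy
  by_contra h'
  have h1 := norm_sub_lt_of_radialCutoff_ne hδ h'
  rw [mem_closedBall_zero_iff] at hy
  have h2 : ‖y‖ ≤ ‖w‖ + ‖w - y‖ := by
    simpa using norm_sub_le w (w - y)
  linarith

theorem contDiff_ballAverage {δ : ℝ} (hδ : 0 < δ) (Y : ℝ) :
    ContDiff ℝ ∞ (ballAverage δ Y : F → ℝ) := by
  refine contDiff_const.mul ?_
  have h1 : ContDiff ℝ ∞ fun x : F => radialCutoff (δ⁻¹ • x) :=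
    contDiff_radialCutoff.comp (contDiff_const_smul _)
  have h2 : LocallyIntegrable (Set.indicator (Metric.closedBall (0 : F) Y) fun _ => (1 : ℝ)) :=
    ((integrable_indicator_iff measurableSet_closedBall).2
      (integrableOn_const measure_closedBall_lt_top.ne)).locallyIntegrable
  have := (hasCompactSupport_radialCutoff_smul hδ).contDiff_convolution_right (n := ⊤)
    (ContinuousLinearMap.lsmul ℝ ℝ : ℝ →L[ℝ] ℝ →L[ℝ] ℝ) h2 h1
  have e : (fun w : F => ∫ y in Metric.closedBall (0 : F) Y, radialCutoff (δ⁻¹ • (w - y))) =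
      convolution ((Metric.closedBall (0 : F) Y).indicator fun _ => (1 : ℝ))
        (fun x => radialCutoff (δ⁻¹ • x)) (ContinuousLinearMap.lsmul ℝ ℝ) volume := by
    funext w
    rw [convolution_def, ← integral_indicator measurableSet_closedBall]
    congr 1
    funext y
    by_cases hy : y ∈ Metric.closedBall (0 : F) Y
    · simp [Set.indicator_of_mem hy]
    · simp [Set.indicator_of_notMem hy]
  rw [e]
  exact this

end Average

/-! ### Sectors as averages of caps -/

section Sector

variable {V : Type*} [NormedAddCommGroup V] [InnerProductSpace ℝ V]

theorem exists_linearIsometry_orthogonal {n : ℕ} (hn : Module.finrank ℝ V = n + 1) {θ : V}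
    (hθ : ‖θ‖ = 1) : ∃ J : EuclideanSpace ℝ (Fin n) →ₗᵢ[ℝ] V, (∀ y, inner ℝ (J y) θ = 0) ∧
      ∀ x, inner ℝ x θ = 0 → ∃ y, J y = x := by
  have : Fact (Module.finrank ℝ V = n + 1) := ⟨hn⟩
  have h0 : θ ≠ 0 := fun h => by simp [h] at hθ
  let e := (OrthonormalBasis.fromOrthogonalSpanSingleton n h0 (𝕜 := ℝ)).repr
  refine ⟨(ℝ ∙ θ)ᗮ.subtypeₗᵢ.comp e.symm.toLinearIsometry, fun y => ?_, fun x hx => ?_⟩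
  · exact Submodule.mem_orthogonal_singleton_iff_inner_left.1 (e.symm y).2
  · refine ⟨e ⟨x, Submodule.mem_orthogonal_singleton_iff_inner_left.2 hx⟩, ?_⟩
    simp

theorem inner_capChart {θ ξ : V} (hθ : ‖θ‖ = 1) (hξ : inner ℝ ξ θ ≠ 0) :
    inner ℝ (capChart θ ξ) θ = 0 := by
  rw [capChart, inner_sub_left, inner_smul_left, real_inner_self_eq_norm_sq, hθ,
    RCLike.conj_to_real, inv_mul_cancel₀ hξ]
  norm_num

theorem contDiffOn_capChart (θ : V) : ContDiffOn ℝ ∞ (capChart θ) {ξ | 0 < inner ℝ ξ θ} := by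
  have h1 : ContDiff ℝ ∞ fun ξ : V => inner ℝ ξ θ := contDiff_id.inner ℝ contDiff_const
  exact ((h1.contDiffOn.inv fun ξ hξ => ne_of_gt hξ).smul contDiffOn_id).sub contDiffOn_const

variable [FiniteDimensional ℝ V] [MeasurableSpace V] [BorelSpace V]

/-- The symbol of a propagator, localised to a sector of angular size `Y`, has a kernel
whose `L^1` norm is controlled by the number of caps of size `δ` in the sector, if the phase is
linear on each of the caps up to a bounded error. -/
theorem exists_kerBound_sector {n : ℕ} (hn : Module.finrank ℝ V = n + 1) {Φ : V → ℝ}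
    (hΦ : ContDiffOn ℝ ∞ Φ {0}ᶜ)
    (hΦh : ∀ (r : ℝ) (ξ : V), 0 < r → ξ ≠ 0 → Φ (r • ξ) = r * Φ ξ)
    {W : Type*} [NormedAddCommGroup W] [NormedSpace ℝ W] {G : W × V → ℂ} (hG : ContDiff ℝ ∞ G)
    {S : Set W} (hS : IsCompact S) {ρ : ℝ} (hGs : ∀ w ∈ S, ∀ ξ, ρ < ‖ξ‖ → G (w, ξ) = 0)
    {X : ℝ → ℝ} (hX : ContDiff ℝ ∞ X) {l L : ℝ} (hl : 0 < l)
    (hXs : ∀ a, a ∉ Set.Icc l L → X a = 0) (Y₀ : ℝ) :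
    ∃ C : ℝ, 0 ≤ C ∧ ∀ θ : V, ‖θ‖ = 1 → ∀ δ Y : ℝ, 0 < δ → δ ≤ 1 → 0 < Y → Y ≤ Y₀ →
      ∃ Q : V → ℝ, (∀ ξ, 0 ≤ Q ξ) ∧ (∀ ξ, Q ξ ≤ 1) ∧
        (∀ ξ, 0 < inner ℝ ξ θ → ‖capChart θ ξ‖ + 2 * δ ≤ Y → Q ξ = 1) ∧
        ContDiffOn ℝ ∞ Q {ξ | 0 < inner ℝ ξ θ} ∧
        ∀ w ∈ S, ∀ R t : ℝ, 0 < R → |t| * R * δ ^ 2 ≤ 1 →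
        KerBound (fun ξ => (X (R⁻¹ * inner ℝ ξ θ) : ℂ) * G (w, R⁻¹ • ξ) * Q ξ *
          Complex.exp (Complex.I * t * Φ ξ)) (C * (Y / δ) ^ n) := by
  obtain ⟨C, hC, hker⟩ := exists_kerBound_cap hΦ hΦh hG hS hX hl hXs
    (contDiff_radialCutoff (F := V)) (fun z hz => radialCutoff_zero_of_two_le hz.le) Y₀
  refine ⟨C, hC, fun θ hθ δ Y hδ hδ1 hY hYY => ?_⟩
  obtain ⟨J, hJ, hJs⟩ := exists_linearIsometry_orthogonal hn hθ
  -- The adjoint of `J` inverts it on the hyperplane orthogonal to `θ`, which contains the values of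
  -- the chart. Averaging thus takes place in dimension `n`, one less than that of `V`.
  set q : V → EuclideanSpace ℝ (Fin n) :=
    fun ξ => J.toContinuousLinearMap.adjoint (capChart θ ξ) with hq
  have hJq : ∀ ξ, inner ℝ ξ θ ≠ 0 → J (q ξ) = capChart θ ξ := fun ξ hξ => by
    obtain ⟨y, hy⟩ := hJs _ (inner_capChart hθ hξ)
    have : q ξ = y := by
      refine ext_inner_right ℝ fun z => ?_
      rw [hq, ContinuousLinearMap.adjoint_inner_left, ← hy]
      exact J.inner_map_map y z
    rw [this, hy]
  refine ⟨fun ξ => ballAverage δ Y (q ξ), fun ξ => ballAverage_nonneg _ _ _,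
    fun ξ => ballAverage_le_one hδ _ _, fun ξ hξ h => ?_, ?_, fun w hw R t hR htR => ?_⟩
  · refine ballAverage_one hδ ?_
    rwa [← J.norm_map, hJq ξ hξ.ne']
  · exact (contDiff_ballAverage hδ Y).comp_contDiffOn
      (J.toContinuousLinearMap.adjoint.contDiff.comp_contDiffOn (contDiffOn_capChart θ))
  set M : V → ℂ := fun ξ => (X (R⁻¹ * inner ℝ ξ θ) : ℂ) * G (w, R⁻¹ • ξ) *
    Complex.exp (Complex.I * t * Φ ξ) with hM
  have hΦm : Measurable Φ := measurable_of_continuousOn_compl_singleton 0 hΦ.continuousOn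
  have hexp : Measurable fun ξ => Complex.exp (Complex.I * t * Φ ξ) := by fun_prop
  have hXG : Continuous fun ξ : V => (X (R⁻¹ * inner ℝ ξ θ) : ℂ) * G (w, R⁻¹ • ξ) := by
    have h1 := hX.continuous
    have h2 := hG.continuous
    fun_prop
  have hMm : Measurable M := hXG.measurable.mul hexp
  have hMi : Integrable M := by
    refine (hXG.integrable_of_hasCompactSupport ?_).mul_bdd (c := 1) hexp.aestronglyMeasurable
      (Filter.Eventually.of_forall fun ξ => ?_)
    · refine HasCompactSupport.of_support_subset_isCompact (isCompact_closedBall (0 : V) (R * ρ))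
        fun ξ hξ => ?_
      rw [mem_closedBall_zero_iff]
      by_contra h
      refine hξ ?_
      beta_reduce
      rw [hGs w hw (R⁻¹ • ξ), mul_zero]
      rw [norm_smul, norm_inv, Real.norm_of_nonneg hR.le, inv_mul_eq_div, lt_div_iff₀ hR, mul_comm]
      exact not_le.1 h
    · have : Complex.I * t * Φ ξ = ((t * Φ ξ : ℝ) : ℂ) * Complex.I := by push_cast; ring
      rw [this, Complex.norm_exp_ofReal_mul_I]
  set m : EuclideanSpace ℝ (Fin n) → V → ℂ := fun y ξ => (X (R⁻¹ * inner ℝ ξ θ) : ℂ) *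
    G (w, R⁻¹ • ξ) * radialCutoff (δ⁻¹ • (capChart θ ξ - J y)) *
    Complex.exp (Complex.I * t * Φ ξ) with hm
  have hmM : ∀ y ξ, m y ξ = radialCutoff (δ⁻¹ • (capChart θ ξ - J y)) * M ξ := fun y ξ => by
    rw [hm, hM]; ring
  have hcm : Measurable (capChart θ) := by
    have : Measurable fun ξ : V => (inner ℝ ξ θ)⁻¹ :=
      (continuous_id.inner continuous_const).measurable.inv
    exact (this.smul measurable_id).sub measurable_const
  have hbm : Measurable fun z : EuclideanSpace ℝ (Fin n) × V =>
      ((radialCutoff (δ⁻¹ • (capChart θ z.2 - J z.1)) : ℝ) : ℂ) := by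
    have h1 : Measurable fun z : EuclideanSpace ℝ (Fin n) × V =>
        δ⁻¹ • (capChart θ z.2 - J z.1) :=
      ((hcm.comp measurable_snd).sub (J.continuous.measurable.comp measurable_fst)).const_smul _
    exact Complex.measurable_ofReal.comp (contDiff_radialCutoff.continuous.measurable.comp h1)
  have hmm : Measurable (Function.uncurry m) := by
    have : Function.uncurry m = fun z : EuclideanSpace ℝ (Fin n) × V =>
        ((radialCutoff (δ⁻¹ • (capChart θ z.2 - J z.1)) : ℝ) : ℂ) * M z.2 := by
      funext z; exact hmM z.1 z.2
    rw [this]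
    exact hbm.mul (hMm.comp measurable_snd)
  have : IsFiniteMeasure
      (volume.restrict (Metric.closedBall (0 : EuclideanSpace ℝ (Fin n)) Y)) :=
    isFiniteMeasure_restrict.2 measure_closedBall_lt_top.ne
  have hmi : Integrable (Function.uncurry m)
      ((volume.restrict (Metric.closedBall (0 : EuclideanSpace ℝ (Fin n)) Y)).prod volume) := by
    have h1 := (integrable_const (μ := volume.restrict
      (Metric.closedBall (0 : EuclideanSpace ℝ (Fin n)) Y)) (1 : ℂ)).mul_prod hMi
    refine h1.mono hmm.aestronglyMeasurable (Filter.Eventually.of_forall fun z => ?_)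
    rw [Function.uncurry, hmM, norm_mul, norm_mul (1 : ℂ), norm_one, Complex.norm_real,
      Real.norm_of_nonneg (radialCutoff_nonneg _)]
    gcongr
    exact radialCutoff_le_one _
  -- A continuous superposition of caps replaces a partition of unity: the kernel norm is at most
  -- `C` times the volume of centres, and division by `N` gives the count `(Y/δ)^n`.
  have key := KerBound.integral (A := fun _ => C) hmm.stronglyMeasurable hmi (integrable_const C)
    ((ae_restrict_iff' measurableSet_closedBall).2 (Filter.Eventually.of_forall fun y hy =>
      hker w hw θ (J y) hθ (hJ y)
        (by rw [J.norm_map]; exact (mem_closedBall_zero_iff.1 hy).trans hYY) R δ t hR hδ hδ1 htR))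
  set N : ℝ := ∫ y : EuclideanSpace ℝ (Fin n), radialCutoff (δ⁻¹ • y) with hN
  have hN0 : 0 < N := integral_radialCutoff_pos hδ
  refine ((key.const_mul ((N⁻¹ : ℝ) : ℂ)).mono ?_).congr_ae
    (Filter.Eventually.of_forall fun ξ => ?_)
  · rw [integral_const, smul_eq_mul, Complex.norm_real, Real.norm_of_nonneg (inv_pos.2 hN0).le,
      measureReal_restrict_apply_univ, ← mul_assoc, mul_comm]
    have h1 := volume_closedBall_div_le (F := EuclideanSpace ℝ (Fin n)) hδ hY
    rw [finrank_euclideanSpace_fin] at h1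
    gcongr
  · beta_reduce
    -- The chart is meaningless here, but the radial cut-off `X` vanishes.
    by_cases ha : inner ℝ ξ θ = 0
    · have : X (R⁻¹ * inner ℝ ξ θ) = 0 := hXs _ fun h => by
        rw [ha, mul_zero] at h; exact absurd h.1 (not_le.2 hl)
      simp [hm, this]
    · have h1 : ∀ y, m y ξ = M ξ * ((radialCutoff (δ⁻¹ • (q ξ - y)) : ℝ) : ℂ) := fun y => by
        rw [hmM, mul_comm, ← hJq ξ ha, ← map_sub, ← map_smul, radialCutoff_map]
      simp_rw [h1]
      rw [integral_const_mul, integral_complex_ofReal, ballAverage, hM]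
      push_cast
      ring

end Sector

/-! ### The propagator at low frequencies -/

section LowFrequency

variable {V : Type*} [NormedAddCommGroup V] [InnerProductSpace ℝ V]

/-- A cut-off function supported in an annulus. -/
noncomputable def annularCutoff (ζ : V) : ℝ := radialCutoff ζ - radialCutoff ((4 : ℝ) • ζ)

theorem contDiff_annularCutoff : ContDiff ℝ ∞ (annularCutoff : V → ℝ) :=
  contDiff_radialCutoff.sub (contDiff_radialCutoff.comp (contDiff_const_smul _))

theorem le_norm_of_annularCutoff_ne {ζ : V} (h : annularCutoff ζ ≠ 0) :
    1 / 4 ≤ ‖ζ‖ ∧ ‖ζ‖ ≤ 2 := by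
  constructor
  · by_contra hc
    push Not at hc
    refine h ?_
    rw [annularCutoff, radialCutoff_one (by linarith), radialCutoff_one, sub_self]
    rw [norm_smul, Real.norm_of_nonneg (by norm_num)]; linarith
  · by_contra hc
    push Not at hc
    refine h ?_
    rw [annularCutoff, radialCutoff_zero_of_two_le hc.le, radialCutoff_zero_of_two_le, sub_self]
    rw [norm_smul, Real.norm_of_nonneg (by norm_num)]; linarith

theorem tsupport_annularCutoff_subset : tsupport (annularCutoff : V → ℝ) ⊆ {ζ | 1 / 8 < ‖ζ‖} := by
  refine (closure_minimal (t := {ζ : V | 1 / 4 ≤ ‖ζ‖}) (fun ζ hζ =>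
    (le_norm_of_annularCutoff_ne hζ).1) (isClosed_le continuous_const continuous_norm)).trans ?_
  intro ζ (hζ : 1 / 4 ≤ ‖ζ‖)
  exact lt_of_lt_of_le (by norm_num) hζ

theorem tsupport_annularCutoff_snd_subset {W : Type*} [NormedAddCommGroup W] :
    tsupport (fun z : W × V => annularCutoff z.2) ⊆ {z | 1 / 8 < ‖z.2‖} := fun _ hz =>
  tsupport_annularCutoff_subset (tsupport_comp_subset_preimage (annularCutoff : V → ℝ)
    continuous_snd hz)

theorem exists_intervalCutoff {l : ℝ} (hl : 0 < l) : ∃ X : ℝ → ℝ, ContDiff ℝ ∞ X ∧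
    (∀ a, 0 ≤ X a) ∧ (∀ a, X a ≤ 1) ∧ (∀ a, a ∉ Set.Icc (l / 2) 4 → X a = 0) ∧
    ∀ a, l ≤ a → a ≤ 2 → X a = 1 := by
  set X : ℝ → ℝ := fun a => Real.smoothTransition (2 * l⁻¹ * a - 1) * Real.smoothTransition (4 - a)
    with hXd
  have hX : ContDiff ℝ ∞ X := by
    have h : ContDiff ℝ ∞ Real.smoothTransition := Real.smoothTransition.contDiff
    exact (h.comp (by fun_prop)).mul (h.comp (by fun_prop))
  have hXs : ∀ a, a ∉ Set.Icc (l / 2) 4 → X a = 0 := by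
    intro a ha
    by_cases h1 : l / 2 ≤ a
    · have h2 : 4 < a := by
        by_contra h
        exact ha ⟨h1, not_lt.1 h⟩
      rw [hXd, mul_eq_zero]
      exact Or.inr (Real.smoothTransition.zero_of_nonpos (by linarith))
    · rw [hXd, mul_eq_zero]
      refine Or.inl (Real.smoothTransition.zero_of_nonpos ?_)
      have : l⁻¹ * a ≤ l⁻¹ * (l / 2) := by gcongr; exact (not_le.1 h1).le
      have h3 : l⁻¹ * (l / 2) = 1 / 2 := by field_simp
      linarith
  have hX1 : ∀ a, l ≤ a → a ≤ 2 → X a = 1 := by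
    intro a h1 h2
    have h3 : l⁻¹ * l ≤ l⁻¹ * a := by gcongr
    rw [inv_mul_cancel₀ hl.ne'] at h3
    rw [hXd]
    beta_reduce
    rw [Real.smoothTransition.one_of_one_le (by linarith),
      Real.smoothTransition.one_of_one_le (by linarith), mul_one]
  refine ⟨X, hX, fun a => mul_nonneg (Real.smoothTransition.nonneg _)
    (Real.smoothTransition.nonneg _), fun a => mul_le_one₀ (Real.smoothTransition.le_one _)
    (Real.smoothTransition.nonneg _) (Real.smoothTransition.le_one _), hXs, hX1⟩

theorem capChart_smul (θ ξ : V) {r : ℝ} (hr : r ≠ 0) : capChart θ (r • ξ) = capChart θ ξ := by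
  rw [capChart, capChart, inner_smul_left, RCLike.conj_to_real, smul_smul, mul_inv, mul_comm r⁻¹,
    inv_mul_cancel_right₀ hr]

theorem norm_exp_I_mul (t x : ℝ) : ‖Complex.exp (Complex.I * t * x)‖ = 1 := by
  have : Complex.I * t * x = ((t * x : ℝ) : ℂ) * Complex.I := by push_cast; ring
  rw [this, Complex.norm_exp_ofReal_mul_I]

theorem contDiff_annularCutoff_smul {W : Type*} [NormedAddCommGroup W] [NormedSpace ℝ W]
    {g : W × V → ℂ} (hg : ContDiffOn ℝ ∞ g {z | 1 / 8 < ‖z.2‖}) :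
    ContDiff ℝ ∞ fun z : W × V => annularCutoff z.2 • g z :=
  contDiff_smul_of_tsupport_subset (isOpen_lt continuous_const continuous_snd.norm)
    (contDiff_annularCutoff.comp contDiff_snd) hg tsupport_annularCutoff_snd_subset

theorem contDiff_exp_I_mul : ContDiff ℝ ∞ fun s : ℝ => Complex.exp (Complex.I * s) := by
  have := Complex.ofRealCLM.contDiff (n := ∞)
  exact Complex.contDiff_exp.comp (contDiff_const.mul this)

variable [FiniteDimensional ℝ V]

variable (V) in
/-- A smooth partition of unity, away from the origin, into pieces supported in cones around
finitely many directions. -/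
theorem exists_conic_partition : ∃ (l : ℝ) (N : ℕ) (θ : Fin N × Bool → V)
    (κ : Fin N × Bool → V → ℝ), 0 < l ∧ (∀ i, ‖θ i‖ = 1) ∧
      (∀ i, ContDiffOn ℝ ∞ (κ i) {ζ | 1 / 8 < ‖ζ‖}) ∧
      (∀ ζ : V, 1 / 8 < ‖ζ‖ → ∑ i, κ i ζ = 1) ∧ ∀ i ζ, κ i ζ ≠ 0 → l ≤ inner ℝ ζ (θ i) := by
  set N := Module.finrank ℝ V with hN
  set v := stdOrthonormalBasis ℝ V with hv
  -- If every `⟪ζ, ±v i⟫` were at most `1/k`, then `‖ζ‖² ≤ N/k² ≤ 1/256`, contradicting `‖ζ‖ > 1/8`.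
  set k : ℝ := 16 * (N + 1) with hk
  have hk0 : 0 < k := by positivity
  set θ : Fin N × Bool → V := fun i => (if i.2 then (1 : ℝ) else -1) • v i.1 with hθ
  set s : Fin N × Bool → V → ℝ :=
    fun i ζ => Real.smoothTransition (k * inner ℝ ζ (θ i) - 1) with hs
  have hss : ∀ i, ContDiff ℝ ∞ (s i) := fun i => by
    have h1 : ContDiff ℝ ∞ fun ζ : V => inner ℝ ζ (θ i) := contDiff_id.inner ℝ contDiff_const
    exact Real.smoothTransition.contDiff.comp ((contDiff_const.mul h1).sub contDiff_const)
  have hs0 : ∀ i ζ, 0 ≤ s i ζ := fun i ζ => Real.smoothTransition.nonneg _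
  have hpos : ∀ ζ : V, 1 / 8 < ‖ζ‖ → 0 < ∑ i, s i ζ := by
    intro ζ hζ
    by_contra hcon
    have h0 : ∀ i, s i ζ = 0 := fun i =>
      (Finset.sum_eq_zero_iff_of_nonneg fun i _ => hs0 i ζ).1
        (le_antisymm (not_lt.1 hcon) (Finset.sum_nonneg fun i _ => hs0 i ζ)) i (Finset.mem_univ i)
    have h1 : ∀ i, k * inner ℝ ζ (θ i) ≤ 1 := fun i => by
      by_contra h
      exact (Real.smoothTransition.pos_of_pos (x := k * inner ℝ ζ (θ i) - 1)
        (by linarith)).ne' (h0 i)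
    have h2 : ∀ i : Fin N, ‖inner ℝ (v i) ζ‖ ^ 2 ≤ (k⁻¹) ^ 2 := fun i => by
      have ha := h1 (i, true)
      have hb := h1 (i, false)
      simp only [hθ, if_true, one_smul, Bool.false_eq_true, if_false, neg_smul,
        inner_neg_right] at ha hb
      rw [real_inner_comm, Real.norm_eq_abs, sq_abs]
      refine sq_le_sq' ?_ ?_
      · rw [neg_le, ← one_div, le_div_iff₀ hk0]; linarith
      · rw [← one_div, le_div_iff₀ hk0]; linarith
    have h3 : ‖ζ‖ ^ 2 ≤ N * (k⁻¹) ^ 2 := by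
      rw [← v.sum_sq_norm_inner_right ζ]
      refine (Finset.sum_le_sum fun i _ => h2 i).trans ?_
      simp
    have h4 : (N : ℝ) * (k⁻¹) ^ 2 ≤ 1 / 256 := by
      rw [hk, inv_pow, ← div_eq_mul_inv, div_le_iff₀ (by positivity)]
      have : (0 : ℝ) ≤ N := Nat.cast_nonneg N
      nlinarith
    nlinarith
  refine ⟨k⁻¹, N, θ, fun i ζ => s i ζ / ∑ j, s j ζ, inv_pos.2 hk0, fun i => ?_, fun i => ?_,
    fun ζ hζ => ?_, fun i ζ h => ?_⟩
  · rw [hθ, norm_smul, v.norm_eq_one]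
    split_ifs <;> simp
  · exact (hss i).contDiffOn.div (ContDiff.sum fun j _ => hss j).contDiffOn
      fun ζ hζ => (hpos ζ hζ).ne'
  · rw [← Finset.sum_div, div_self (hpos ζ hζ).ne']
  · by_contra hcon
    refine h ?_
    have : s i ζ = 0 := Real.smoothTransition.zero_of_nonpos (by
      have := mul_lt_mul_of_pos_left (not_le.1 hcon) hk0
      rw [mul_inv_cancel₀ hk0.ne'] at this
      linarith)
    beta_reduce
    rw [this, zero_div]

variable [MeasurableSpace V] [BorelSpace V]

/-- Dominated convergence of the symbols gives pointwise convergence of the kernels, and Fatou's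
lemma then preserves the `L¹` bound. -/
theorem KerBound.of_tendsto {m : ℕ → V → ℂ} {m₀ : V → ℂ} {C : ℝ} (hm : ∀ k, KerBound (m k) C)
    {B : V → ℝ} (hB : Integrable B) (hmB : ∀ k ξ, ‖m k ξ‖ ≤ B ξ)
    (h : ∀ᵐ ξ, Filter.Tendsto (fun k => m k ξ) Filter.atTop (nhds (m₀ ξ))) : KerBound m₀ C := by
  have hm₀m : AEStronglyMeasurable m₀ volume :=
    aestronglyMeasurable_of_tendsto_ae _ (fun k => (hm k).1.aestronglyMeasurable) h
  have hm₀ : Integrable m₀ := by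
    refine hB.mono' hm₀m ?_
    filter_upwards [h] with ξ hξ
    exact le_of_tendsto hξ.norm (Filter.Eventually.of_forall fun k => hmB k ξ)
  have hK : ∀ x, Filter.Tendsto (fun k => 𝓕⁻ (m k) x) Filter.atTop (nhds (𝓕⁻ m₀ x)) := by
    intro x
    simp_rw [Real.fourierInv_eq]
    have hc : Continuous fun ξ : V => Real.fourierChar (inner ℝ ξ x) :=
      Real.continuous_fourierChar.comp (continuous_id.inner continuous_const)
    refine tendsto_integral_of_dominated_convergence B (fun k => ?_) hB (fun k => ?_) ?_
    · exact hc.aestronglyMeasurable.smul (hm k).1.aestronglyMeasurable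
    · exact Filter.Eventually.of_forall fun ξ => by rw [Circle.norm_smul]; exact hmB k ξ
    · filter_upwards [h] with ξ hξ
      exact hξ.const_smul _
  have hCn : 0 ≤ C := (hm 0).nonneg
  have hle : ∫⁻ x, ‖𝓕⁻ m₀ x‖ₑ ≤ ENNReal.ofReal C := by
    have h1 : ∀ x, ‖𝓕⁻ m₀ x‖ₑ = Filter.liminf (fun k => ‖𝓕⁻ (m k) x‖ₑ) Filter.atTop :=
      fun x => ((hK x).enorm).liminf_eq.symm
    simp_rw [h1]
    refine (lintegral_liminf_le' fun k => (hm k).2.aestronglyMeasurable.enorm).trans ?_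
    refine Filter.liminf_le_of_le (by isBoundedDefault) fun b hb => ?_
    obtain ⟨k, hk⟩ := hb.exists
    refine hk.trans ?_
    rw [← ofReal_integral_norm_eq_lintegral_enorm (hm k).2]
    exact ENNReal.ofReal_le_ofReal (hm k).3
  have hi : Integrable (𝓕⁻ m₀) :=
    ⟨(continuous_fourierInv_of_integrable hm₀).aestronglyMeasurable,
      hle.trans_lt ENNReal.ofReal_lt_top⟩
  refine ⟨hm₀, hi, ?_⟩
  rw [← ofReal_integral_norm_eq_lintegral_enorm hi] at hle
  exact (ENNReal.ofReal_le_ofReal_iff hCn).1 hle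

theorem KerBound.sum {ι : Type*} (s : Finset ι) {m : ι → V → ℂ} {C : ι → ℝ}
    (h : ∀ i ∈ s, KerBound (m i) (C i)) : KerBound (fun ξ => ∑ i ∈ s, m i ξ) (∑ i ∈ s, C i) := by
  classical
  induction s using Finset.induction_on with
  | empty => simpa using kerBound_zero
  | insert a s ha ih =>
    simp_rw [Finset.sum_insert ha]
    exact (h a (Finset.mem_insert_self _ _)).add
      (ih fun i hi => h i (Finset.mem_insert_of_mem hi))

/-- By Hadamard's lemma `e^{iτΦ} - 1` is `τ` times a smooth function on the annulus, which produces
the gain `|τ|`. The cut-off `χ (R • ζ)` stays in a compact family, as `R` is bounded. -/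
theorem exists_kerBound_annulus_small {Φ : V → ℝ} (hΦ : ContDiffOn ℝ ∞ Φ {0}ᶜ) {χ : V → ℂ}
    (hχ : ContDiff ℝ ∞ χ) (R₀ : ℝ) : ∃ C : ℝ, 0 ≤ C ∧ ∀ R ∈ Set.Icc 0 R₀,
    ∀ τ ∈ Set.Icc (-1 : ℝ) 1, KerBound (fun ζ => χ (R • ζ) * annularCutoff ζ *
      (Complex.exp (Complex.I * τ * Φ ζ) - 1)) (C * |τ|) := by
  obtain ⟨Ψ, hΨ, hΨΦ⟩ := exists_contDiff_eq_of_le_norm hΦ (r := 1 / 8) (by norm_num)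
  obtain ⟨K, hK, hKe⟩ := exists_hadamard contDiff_exp_I_mul
  have hF : ContDiff ℝ ∞ fun z : (ℝ × ℝ) × V => annularCutoff z.2 •
      (χ (z.1.1 • z.2) * Ψ z.2 * K (0, z.1.2 * Ψ z.2) 1) := by
    refine contDiff_annularCutoff_smul (ContDiff.contDiffOn ?_)
    have h1 : ContDiff ℝ ∞ fun z : (ℝ × ℝ) × V => K (0, z.1.2 * Ψ z.2) 1 :=
      (hK.comp (by fun_prop)).clm_apply contDiff_const
    have h2 : ContDiff ℝ ∞ fun z : (ℝ × ℝ) × V => ((Ψ z.2 : ℝ) : ℂ) :=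
      Complex.ofRealCLM.contDiff.comp (hΨ.comp contDiff_snd)
    have h3 : ContDiff ℝ ∞ fun z : (ℝ × ℝ) × V => χ (z.1.1 • z.2) := hχ.comp (by fun_prop)
    exact (h3.mul h2).mul h1
  obtain ⟨C, hC, H⟩ := exists_kerBound_of_isCompact hF
    (isCompact_Icc (a := (0 : ℝ)) (b := R₀) |>.prod (isCompact_Icc (a := (-1 : ℝ)) (b := 1)))
    (ρ := 2) (fun w _ ξ hξ => by
      have : annularCutoff ξ = 0 := by
        by_contra h
        exact absurd (le_norm_of_annularCutoff_ne h).2 (not_le.2 hξ)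
      simp only [this, zero_smul])
  refine ⟨C, hC, fun R hR τ hτ => ?_⟩
  refine (((H (R, τ) ⟨hR, hτ⟩).const_mul (τ : ℂ)).mono ?_).congr_ae
    (Filter.Eventually.of_forall fun ζ => ?_)
  · rw [Complex.norm_real, Real.norm_eq_abs, mul_comm]
  · beta_reduce
    by_cases h : annularCutoff ζ = 0
    · simp [h]
    · have h1 : Ψ ζ = Φ ζ := hΨΦ _ (by linarith [(le_norm_of_annularCutoff_ne h).1])
      have h2 := hKe 0 (τ * Φ ζ)
      have h3 : K (0, τ * Φ ζ) (τ * Φ ζ) = ((τ * Φ ζ : ℝ) : ℂ) * K (0, τ * Φ ζ) 1 := by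
        rw [← Complex.real_smul, ← map_smul, smul_eq_mul, mul_one]
      rw [h3] at h2
      simp only [zero_add, Complex.ofReal_zero, mul_zero, Complex.exp_zero, Complex.ofReal_mul] at h2
      rw [mul_assoc Complex.I, h2, h1, Complex.real_smul]
      ring

/-- Finitely many sectors of fixed aperture cover the annulus, and each is filled with caps of size
`δ = (1+|t|R)^(-1/2)`, for which `|t| R δ² ≤ 1`. -/
theorem exists_kerBound_annulus_large {n : ℕ} (hn : Module.finrank ℝ V = n + 1) {Φ : V → ℝ}
    (hΦ : ContDiffOn ℝ ∞ Φ {0}ᶜ)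
    (hΦh : ∀ (r : ℝ) (ξ : V), 0 < r → ξ ≠ 0 → Φ (r • ξ) = r * Φ ξ) {χ : V → ℂ}
    (hχ : ContDiff ℝ ∞ χ) (R₀ : ℝ) : ∃ C : ℝ, 0 ≤ C ∧ ∀ R, 0 < R → R ≤ R₀ → ∀ t : ℝ,
    KerBound (fun ξ => χ ξ * annularCutoff (R⁻¹ • ξ) * Complex.exp (Complex.I * t * Φ ξ))
      (C * √(1 + |t| * R) ^ n) := by
  obtain ⟨l, N, θ, κ, hl, hθ, hκs, hκ1, hκl⟩ := exists_conic_partition V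
  obtain ⟨X, hX, -, -, hXs, hX1⟩ := exists_intervalCutoff hl
  set G : Fin N × Bool → ℝ × V → ℂ := fun i z => annularCutoff z.2 • (χ (z.1 • z.2) * κ i z.2)
    with hGd
  have hG : ∀ i, ContDiff ℝ ∞ (G i) := fun i => by
    refine contDiff_annularCutoff_smul ?_
    have h1 : ContDiff ℝ ∞ fun z : ℝ × V => χ (z.1 • z.2) := hχ.comp (by fun_prop)
    have h2 : ContDiffOn ℝ ∞ (fun z : ℝ × V => ((κ i z.2 : ℝ) : ℂ)) {z | 1 / 8 < ‖z.2‖} :=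
      Complex.ofRealCLM.contDiff.comp_contDiffOn
        ((hκs i).comp contDiff_snd.contDiffOn fun z hz => hz)
    exact h1.contDiffOn.mul h2
  have hGz : ∀ i R ξ, G i (R, ξ) ≠ 0 → annularCutoff ξ ≠ 0 ∧ κ i ξ ≠ 0 := by
    intro i R ξ h
    refine ⟨fun h0 => h ?_, fun h0 => h ?_⟩ <;> simp [hGd, h0]
  -- The chart is bounded by `2/l + 1` on each conic piece, and `2δ ≤ 2` is the margin required for
  -- `Q = 1`.
  set Y₀ : ℝ := 2 * l⁻¹ + 3 with hY₀
  have hY₀0 : 0 < Y₀ := by positivity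
  choose C hC H using fun i => exists_kerBound_sector hn hΦ hΦh (hG i)
    (isCompact_Icc (a := (0 : ℝ)) (b := R₀)) (ρ := 2) (fun R _ ξ hξ => by
      by_contra h
      exact absurd (le_norm_of_annularCutoff_ne (hGz i R ξ h).1).2 (not_le.2 hξ))
    hX (half_pos hl) hXs Y₀
  refine ⟨∑ i, C i * Y₀ ^ n, Finset.sum_nonneg fun i _ => mul_nonneg (hC i) (by positivity),
    fun R hR hRR t => ?_⟩
  set D : ℝ := √(1 + |t| * R) with hD
  have hx0 : 0 ≤ |t| * R := by positivity
  have hDsq : D ^ 2 = 1 + |t| * R := Real.sq_sqrt (by linarith)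
  have hD1 : 1 ≤ D := by
    rw [hD, Real.one_le_sqrt]; linarith
  have hD0 : 0 < D := one_pos.trans_le hD1
  have hKi : ∀ i, KerBound (fun ξ => G i (R, R⁻¹ • ξ) * Complex.exp (Complex.I * t * Φ ξ))
      (C i * Y₀ ^ n * D ^ n) := by
    intro i
    obtain ⟨Q, -, -, hQ1, -, hQ⟩ := H i (θ i) (hθ i) D⁻¹ Y₀ (inv_pos.2 hD0)
      (inv_le_one_of_one_le₀ hD1) hY₀0 le_rfl
    have h1 := hQ R ⟨hR.le, hRR⟩ R t hR (by
      rw [inv_pow, hDsq, ← div_eq_mul_inv, div_le_one (by linarith)]; linarith)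
    rw [div_inv_eq_mul, mul_pow, ← mul_assoc] at h1
    refine h1.congr_ae (Filter.Eventually.of_forall fun ξ => ?_)
    beta_reduce
    by_cases h : G i (R, R⁻¹ • ξ) = 0
    · simp [h]
    · obtain ⟨ha, hk⟩ := hGz i R _ h
      have h2 := hκl i _ hk
      have h3 := (le_norm_of_annularCutoff_ne ha).2
      have h4 : inner ℝ (R⁻¹ • ξ) (θ i) ≤ 2 := by
        refine (real_inner_le_norm _ _).trans ?_
        rw [hθ, mul_one]; exact h3
      have h5 : inner ℝ (R⁻¹ • ξ) (θ i) = R⁻¹ * inner ℝ ξ (θ i) := by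
        rw [inner_smul_left, RCLike.conj_to_real]
      have h6 : 0 < inner ℝ ξ (θ i) := by
        have := hl.trans_le h2
        rw [h5] at this
        exact pos_of_mul_pos_right this (inv_pos.2 hR).le
      have h7 : ‖capChart (θ i) ξ‖ ≤ 2 * l⁻¹ + 1 := by
        rw [← capChart_smul (θ i) ξ (inv_ne_zero hR.ne'), capChart]
        refine (norm_sub_le _ _).trans ?_
        rw [hθ, norm_smul, norm_inv, Real.norm_of_nonneg (hl.le.trans h2), mul_comm]
        exact add_le_add (mul_le_mul h3 (inv_anti₀ hl h2) (inv_nonneg.2 (hl.le.trans h2))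
          zero_le_two) le_rfl
      rw [hQ1 ξ h6 (by linarith [inv_le_one_of_one_le₀ hD1]), ← h5, hX1 _ h2 h4]
      simp
  have hsum := KerBound.sum Finset.univ fun i _ => hKi i
  rw [← Finset.sum_mul] at hsum
  refine hsum.congr_ae (Filter.Eventually.of_forall fun ξ => ?_)
  beta_reduce
  rw [← Finset.sum_mul]
  congr 1
  simp only [hGd, smul_smul, mul_inv_cancel₀ hR.ne', one_smul, Complex.real_smul]
  rw [← Finset.mul_sum, ← Finset.mul_sum]
  by_cases h : annularCutoff (R⁻¹ • ξ) = 0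
  · simp [h]
  · have h1 := hκ1 (R⁻¹ • ξ) (by linarith [(le_norm_of_annularCutoff_ne h).1])
    rw [← Complex.ofReal_sum, h1, Complex.ofReal_one, mul_one, mul_comm]

/-- Compared with the large-frequency bound, one factor `√(1+|t|R)` has become `√(|t|R)`. It decays
as `R → 0`, so that the annuli can be summed; subtracting `1` from the exponential is what makes
this possible. -/
theorem exists_kerBound_annulus {n : ℕ} (hn : Module.finrank ℝ V = n + 2) {Φ : V → ℝ}
    (hΦ : ContDiffOn ℝ ∞ Φ {0}ᶜ)
    (hΦh : ∀ (r : ℝ) (ξ : V), 0 < r → ξ ≠ 0 → Φ (r • ξ) = r * Φ ξ) {χ : V → ℂ}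
    (hχ : ContDiff ℝ ∞ χ) (R₀ : ℝ) : ∃ C : ℝ, 0 ≤ C ∧ ∀ R, 0 < R → R ≤ R₀ → ∀ t : ℝ,
    KerBound (fun ξ => χ ξ * annularCutoff (R⁻¹ • ξ) *
      (Complex.exp (Complex.I * t * Φ ξ) - 1)) (C * √(|t| * R) * √(1 + |t| * R) ^ n) := by
  obtain ⟨C₁, hC₁, H₁⟩ := exists_kerBound_annulus_small hΦ hχ R₀
  obtain ⟨C₂, hC₂, H₂⟩ := exists_kerBound_annulus_large hn hΦ hΦh hχ R₀
  refine ⟨C₁ + 4 * C₂, by positivity, fun R hR hRR t => ?_⟩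
  have hx0 : 0 ≤ |t| * R := by positivity
  have hD1 : 1 ≤ √(1 + |t| * R) := by rw [Real.one_le_sqrt]; linarith
  rcases le_total (|t| * R) 1 with hx | hx
  · have h1 := H₁ R ⟨hR.le, hRR⟩ (t * R) (abs_le.1 (by rwa [abs_mul, abs_of_pos hR]))
    have h2 := h1.smul_comp (inv_ne_zero hR.ne')
    refine (h2.mono ?_).congr_ae ?_
    · rw [abs_mul, abs_of_pos hR]
      have h3 : |t| * R ≤ √(|t| * R) := by
        conv_lhs => rw [← Real.sq_sqrt hx0]
        have : √(|t| * R) ≤ 1 := Real.sqrt_le_one.2 hx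
        nlinarith [Real.sqrt_nonneg (|t| * R)]
      calc C₁ * (|t| * R) ≤ (C₁ + 4 * C₂) * √(|t| * R) * 1 := by
            rw [mul_one]; gcongr; linarith
        _ ≤ _ := by gcongr; exact one_le_pow₀ hD1
    · have h0 : ∀ᵐ ξ : V, ξ ≠ 0 := by
        have : Nontrivial V := Module.nontrivial_of_finrank_pos (R := ℝ) (by omega)
        exact Measure.ae_ne volume 0
      filter_upwards [h0] with ξ hξ
      rw [smul_smul, mul_inv_cancel₀ hR.ne', one_smul, hΦh _ _ (inv_pos.2 hR) hξ]
      congr 3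
      push_cast
      have : (R : ℂ) ≠ 0 := Complex.ofReal_ne_zero.2 hR.ne'
      field_simp
  · have h1 := H₂ R hR hRR t
    have h2 := H₂ R hR hRR 0
    simp only [abs_zero, zero_mul, add_zero, Real.sqrt_one, one_pow, mul_one, Complex.ofReal_zero,
      mul_zero, Complex.exp_zero] at h2
    refine ((h1.add (h2.const_mul (-1))).mono ?_).congr_ae
      (Filter.Eventually.of_forall fun ξ => by ring)
    rw [norm_neg, norm_one, one_mul]
    have h3 : √(1 + |t| * R) ≤ 2 * √(|t| * R) := by
      rw [Real.sqrt_le_left (by positivity), mul_pow, Real.sq_sqrt hx0]; linarith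
    have h4 : (1 : ℝ) ≤ √(1 + |t| * R) ^ (n + 1) := one_le_pow₀ hD1
    calc C₂ * √(1 + |t| * R) ^ (n + 1) + C₂
        ≤ C₂ * √(1 + |t| * R) ^ (n + 1) + C₂ * √(1 + |t| * R) ^ (n + 1) := by nlinarith
      _ = 2 * C₂ * √(1 + |t| * R) * √(1 + |t| * R) ^ n := by ring
      _ ≤ 2 * C₂ * (2 * √(|t| * R)) * √(1 + |t| * R) ^ n := by gcongr
      _ = 0 + 4 * C₂ * √(|t| * R) * √(1 + |t| * R) ^ n := by ring
      _ ≤ C₁ * √(|t| * R) * √(1 + |t| * R) ^ n +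
          4 * C₂ * √(|t| * R) * √(1 + |t| * R) ^ n := by gcongr; positivity
      _ = _ := by ring

/-- The symbol of the propagator at low frequencies. -/
theorem exists_kerBound_low {n : ℕ} (hn : Module.finrank ℝ V = n + 2) {Φ : V → ℝ}
    (hΦ : ContDiffOn ℝ ∞ Φ {0}ᶜ)
    (hΦh : ∀ (r : ℝ) (ξ : V), 0 < r → ξ ≠ 0 → Φ (r • ξ) = r * Φ ξ) {χ : V → ℂ}
    (hχ : ContDiff ℝ ∞ χ) (hχc : HasCompactSupport χ) : ∃ C : ℝ, 0 ≤ C ∧ ∀ t : ℝ,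
    KerBound (fun ξ => χ ξ * Complex.exp (Complex.I * t * Φ ξ)) (C * √(1 + |t|) ^ (n + 1)) := by
  obtain ⟨ρ, hρ⟩ := hχc.isCompact.isBounded.subset_closedBall 0
  set R₀ : ℝ := max ρ 1 with hR₀
  have hR1 : 1 ≤ R₀ := le_max_right _ _
  have hR0 : 0 < R₀ := one_pos.trans_le hR1
  have hχ0 : ∀ ξ, R₀ < ‖ξ‖ → χ ξ = 0 := fun ξ hξ => by
    by_contra h
    have := mem_closedBall_zero_iff.1 (hρ (subset_tsupport _ h))
    exact absurd (this.trans (le_max_left _ _)) (not_le.2 hξ)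
  obtain ⟨C, hC, H⟩ := exists_kerBound_annulus hn hΦ hΦh hχ R₀
  obtain ⟨C', hC', H'⟩ := exists_kerBound_of_isCompact (W := ℝ) (F := fun z : ℝ × V => χ z.2)
    (hχ.comp contDiff_snd) (isCompact_singleton (x := (0 : ℝ))) (fun w _ ξ hξ => hχ0 ξ hξ)
  have hχK : KerBound χ C' := H' 0 rfl
  refine ⟨2 * C * √R₀ ^ (n + 1) + C', by positivity, fun t => ?_⟩
  set D : ℝ := √(1 + |t| * R₀) with hD
  have hx0 : 0 ≤ |t| * R₀ := by positivity
  have hR : ∀ j : ℕ, 0 < R₀ * (1 / 4 : ℝ) ^ j := fun j => by positivity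
  have hRl : ∀ j : ℕ, R₀ * (1 / 4 : ℝ) ^ j ≤ R₀ := fun j =>
    mul_le_of_le_one_right hR0.le (pow_le_one₀ (by norm_num) (by norm_num))
  -- Radii decrease by the factor `1/4`, so the factor `√(|t|R)` contributes the geometric series of
  -- ratio `1/2`.
  have hpart : ∀ k : ℕ, KerBound (fun ξ => ∑ j ∈ Finset.range k,
      χ ξ * annularCutoff ((R₀ * (1 / 4 : ℝ) ^ j)⁻¹ • ξ) *
        (Complex.exp (Complex.I * t * Φ ξ) - 1)) (2 * C * D ^ (n + 1)) := by
    intro k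
    refine (KerBound.sum _ fun j _ => H _ (hR j) (hRl j) t).mono ?_
    have h1 : ∀ j ∈ Finset.range k, C * √(|t| * (R₀ * (1 / 4) ^ j)) *
        √(1 + |t| * (R₀ * (1 / 4) ^ j)) ^ n ≤ C * D ^ (n + 1) * (1 / 2) ^ j := by
      intro j _
      have h2 : √(|t| * (R₀ * (1 / 4) ^ j)) ≤ D * (1 / 2) ^ j := by
        rw [Real.sqrt_le_left (by positivity), mul_pow, hD, Real.sq_sqrt (by linarith), ← pow_mul,
          mul_comm j 2, pow_mul, ← mul_assoc]
        norm_num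
      have h3 : √(1 + |t| * (R₀ * (1 / 4) ^ j)) ≤ D := by
        refine Real.sqrt_le_sqrt ?_
        gcongr
        exact hRl j
      calc _ ≤ C * (D * (1 / 2) ^ j) * D ^ n := by gcongr
        _ = _ := by ring
    refine (Finset.sum_le_sum h1).trans ?_
    rw [← Finset.mul_sum]
    have h4 : ∑ j ∈ Finset.range k, (1 / 2 : ℝ) ^ j ≤ 2 := sum_geometric_two_le k
    calc _ ≤ C * D ^ (n + 1) * 2 := by gcongr
      _ = _ := by ring
  -- The annular cut-offs telescope, and the outermost radial cut-off equals one on the support of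
  -- `χ`.
  have htel : ∀ (k : ℕ) (ξ : V), ∑ j ∈ Finset.range k,
      χ ξ * annularCutoff ((R₀ * (1 / 4 : ℝ) ^ j)⁻¹ • ξ) *
        (Complex.exp (Complex.I * t * Φ ξ) - 1) =
      χ ξ * ((1 - radialCutoff ((R₀ * (1 / 4 : ℝ) ^ k)⁻¹ • ξ) : ℝ) : ℂ) *
        (Complex.exp (Complex.I * t * Φ ξ) - 1) := by
    intro k ξ
    rw [← Finset.sum_mul, ← Finset.mul_sum, ← Complex.ofReal_sum]
    by_cases hξ : χ ξ = 0
    · simp [hξ]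
    congr 4
    have h1 : ∀ j : ℕ, annularCutoff ((R₀ * (1 / 4 : ℝ) ^ j)⁻¹ • ξ) =
        radialCutoff ((R₀ * (1 / 4 : ℝ) ^ j)⁻¹ • ξ) -
          radialCutoff ((R₀ * (1 / 4 : ℝ) ^ (j + 1))⁻¹ • ξ) := fun j => by
      rw [annularCutoff, smul_smul]
      congr 3
      rw [pow_succ]
      field_simp
    simp_rw [h1]
    rw [Finset.sum_range_sub']
    congr 1
    refine radialCutoff_one ?_
    rw [pow_zero, mul_one, norm_smul, norm_inv, Real.norm_of_nonneg hR0.le, inv_mul_le_iff₀ hR0,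
      mul_one]
    by_contra h
    exact hξ (hχ0 ξ (not_le.1 h))
  have hlim : KerBound (fun ξ => χ ξ * (Complex.exp (Complex.I * t * Φ ξ) - 1))
      (2 * C * D ^ (n + 1)) := by
    refine KerBound.of_tendsto hpart (B := fun ξ => ‖χ ξ‖ * 2) (hχK.1.norm.mul_const 2) ?_ ?_
    · intro k ξ
      rw [htel, norm_mul, norm_mul, Complex.norm_real, Real.norm_of_nonneg
        (sub_nonneg.2 (radialCutoff_le_one _)), mul_assoc]
      gcongr
      have h1 : ‖Complex.exp (Complex.I * t * Φ ξ) - 1‖ ≤ 2 := by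
        refine (norm_sub_le _ _).trans ?_
        rw [norm_exp_I_mul, norm_one]; norm_num
      calc _ ≤ 1 * (2 : ℝ) := by
            gcongr
            linarith [radialCutoff_nonneg ((R₀ * (1 / 4 : ℝ) ^ k)⁻¹ • ξ)]
        _ = 2 := one_mul 2
    · have h0 : ∀ᵐ ξ : V, ξ ≠ 0 := by
        have : Nontrivial V := Module.nontrivial_of_finrank_pos (R := ℝ) (by omega)
        exact Measure.ae_ne volume 0
      filter_upwards [h0] with ξ hξ
      simp_rw [htel]
      refine tendsto_const_nhds.congr' ?_
      have h1 : Filter.Tendsto (fun k : ℕ => R₀ * (1 / 4 : ℝ) ^ k) Filter.atTop (nhds (R₀ * 0)) :=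
        (tendsto_pow_atTop_nhds_zero_of_lt_one (by norm_num) (by norm_num)).const_mul _
      rw [mul_zero] at h1
      filter_upwards [h1.eventually_lt_const (half_pos (norm_pos_iff.2 hξ))] with k hk
      rw [radialCutoff_zero_of_two_le]
      · simp
      · rw [norm_smul, norm_inv, Real.norm_of_nonneg (hR k).le, inv_mul_eq_div,
          le_div_iff₀ (hR k)]
        linarith
  refine ((hlim.add hχK).mono ?_).congr_ae (Filter.Eventually.of_forall fun ξ => by ring)
  have h5 : D ≤ √R₀ * √(1 + |t|) := by
    rw [hD, ← Real.sqrt_mul hR0.le]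
    refine Real.sqrt_le_sqrt ?_
    linarith
  have h6 : (1 : ℝ) ≤ √(1 + |t|) ^ (n + 1) := one_le_pow₀ (by
    rw [Real.one_le_sqrt]; linarith [abs_nonneg t])
  calc 2 * C * D ^ (n + 1) + C' ≤ 2 * C * (√R₀ * √(1 + |t|)) ^ (n + 1) +
        C' * √(1 + |t|) ^ (n + 1) := by
        gcongr
        exact le_mul_of_one_le_right hC' h6
    _ = _ := by rw [mul_pow]; ring

end LowFrequency

/-! ### Temperate growth of symbols -/

section TemperateGrowth

theorem hasTemperateGrowth_exp_I_mul (t : ℝ) :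
    (fun s : ℝ => Complex.exp (Complex.I * t * s)).HasTemperateGrowth := by
  have hd : ∀ (c : ℂ) (s : ℝ), HasDerivAt (fun s : ℝ => c * Complex.exp (Complex.I * t * s))
      (c * (Complex.I * t) * Complex.exp (Complex.I * t * s)) s := fun c s => by
    have h1 : HasDerivAt (fun s : ℝ => Complex.I * t * (s : ℂ)) (Complex.I * t * 1) s :=
      (Complex.ofRealCLM.hasDerivAt (x := s)).const_mul _
    have h2 := (h1.cexp).const_mul c
    exact h2.congr_deriv (by ring)
  have hi : ∀ n, iteratedDeriv n (fun s : ℝ => Complex.exp (Complex.I * t * s)) =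
      fun s : ℝ => (Complex.I * t) ^ n * Complex.exp (Complex.I * t * s) := by
    intro n
    induction n with
    | zero => simp
    | succ n ih =>
      rw [iteratedDeriv_succ, ih]
      funext s
      rw [(hd _ s).deriv, pow_succ]
  refine ⟨?_, fun n => ⟨0, |t| ^ n, fun s => ?_⟩⟩
  · have := Complex.ofRealCLM.contDiff (n := ∞)
    exact Complex.contDiff_exp.comp (contDiff_const.mul this)
  · rw [norm_iteratedFDeriv_eq_norm_iteratedDeriv, hi, norm_mul, norm_exp_I_mul, norm_pow,
      norm_mul, Complex.norm_I, one_mul, Complex.norm_real, Real.norm_eq_abs]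
    simp

variable {V : Type*} [NormedAddCommGroup V] [InnerProductSpace ℝ V]

theorem hasTemperateGrowth_of_hasCompactSupport {m : V → ℂ} (hm : ContDiff ℝ ∞ m)
    (hc : HasCompactSupport m) : m.HasTemperateGrowth :=
  (hc.toSchwartzMap hm).hasTemperateGrowth

variable [FiniteDimensional ℝ V]

/-- A smooth function which is homogeneous of degree one off a ball has temperate growth. -/
theorem hasTemperateGrowth_of_homogeneous {Φ Ψ : V → ℝ} (hΨ : ContDiff ℝ ∞ Ψ)
    (hΦh : ∀ (r : ℝ) (ξ : V), 0 < r → ξ ≠ 0 → Φ (r • ξ) = r * Φ ξ) {r : ℝ} (hr : 0 < r)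
    (hΨΦ : ∀ x, r ≤ ‖x‖ → Ψ x = Φ x) : Ψ.HasTemperateGrowth := by
  refine ⟨hΨ, fun n => ?_⟩
  have hc : Continuous fun x => ‖iteratedFDeriv ℝ n Ψ x‖ :=
    (hΨ.continuous_iteratedFDeriv (mod_cast le_top)).norm
  obtain ⟨M, hM⟩ := (isCompact_closedBall (0 : V) (2 * r)).bddAbove_image hc.continuousOn
  have hM' : ∀ x, ‖x‖ ≤ 2 * r → ‖iteratedFDeriv ℝ n Ψ x‖ ≤ M := fun x hx =>
    hM ⟨x, mem_closedBall_zero_iff.2 hx, rfl⟩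
  have hM0 : 0 ≤ M := (norm_nonneg _).trans (hM' 0 (by simp [hr.le]))
  refine ⟨1, M * (1 + (2 * r)⁻¹), fun x => ?_⟩
  rw [pow_one]
  have hr2 : 0 < (2 * r)⁻¹ := by positivity
  by_cases hx : ‖x‖ ≤ 2 * r
  · refine (hM' x hx).trans ?_
    rw [mul_assoc]
    refine le_mul_of_one_le_right hM0 ?_
    nlinarith [norm_nonneg x, mul_nonneg hr2.le (norm_nonneg x)]
  -- The point is rescaled to the sphere of radius `2r` rather than `r`, so that the homogeneity
  -- relation holds in a neighbourhood and may be differentiated.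
  push Not at hx
  set a : ℝ := (2 * r)⁻¹ * ‖x‖ with ha
  have ha1 : 1 ≤ a := by
    rw [ha, inv_mul_eq_div, one_le_div (by positivity)]; exact hx.le
  have ha0 : 0 < a := one_pos.trans_le ha1
  have hu : ‖a⁻¹ • x‖ = 2 * r := by
    have hx0 : ‖x‖ ≠ 0 := by linarith
    rw [norm_smul, norm_inv, Real.norm_of_nonneg ha0.le, ha]
    field_simp
  have hev : (fun z => Ψ (a • z)) =ᶠ[nhds (a⁻¹ • x)] fun z => a • Ψ z := by
    have : ∀ᶠ z in nhds (a⁻¹ • x), r < ‖z‖ :=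
      continuous_norm.continuousAt.eventually_const_lt
        (show r < ‖a⁻¹ • x‖ by rw [hu]; linarith)
    filter_upwards [this] with z hz
    have hz0 : z ≠ 0 := norm_pos_iff.1 (hr.trans hz)
    rw [hΨΦ z hz.le, hΨΦ, hΦh _ _ ha0 hz0, smul_eq_mul]
    rw [norm_smul, Real.norm_of_nonneg ha0.le]
    nlinarith
  have hn : ContDiff ℝ n Ψ := hΨ.of_le (mod_cast le_top)
  have h1 := (hev.iteratedFDeriv (𝕜 := ℝ) n).eq_of_nhds
  rw [iteratedFDeriv_comp_const_smul a hn, iteratedFDeriv_const_smul_apply' hn.contDiffAt] at h1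
  have h2 : a ^ n * ‖iteratedFDeriv ℝ n Ψ x‖ = a * ‖iteratedFDeriv ℝ n Ψ (a⁻¹ • x)‖ := by
    have h3 := congrArg norm h1
    beta_reduce at h3
    rwa [smul_smul, mul_inv_cancel₀ ha0.ne', one_smul, norm_smul, norm_smul, norm_pow,
      Real.norm_of_nonneg ha0.le] at h3
  calc ‖iteratedFDeriv ℝ n Ψ x‖ ≤ a ^ n * ‖iteratedFDeriv ℝ n Ψ x‖ :=
        le_mul_of_one_le_left (norm_nonneg _) (one_le_pow₀ ha1)
    _ = a * ‖iteratedFDeriv ℝ n Ψ (a⁻¹ • x)‖ := h2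
    _ ≤ a * M := by gcongr; exact hM' _ hu.le
    _ ≤ M * (1 + (2 * r)⁻¹) * (1 + ‖x‖) := by
      rw [ha]
      have := mul_nonneg hM0 (norm_nonneg x)
      have h3 := mul_nonneg hM0 hr2.le
      nlinarith

theorem hasTemperateGrowth_one_sub_mul_exp {Φ : V → ℝ} (hΦ : ContDiffOn ℝ ∞ Φ {0}ᶜ)
    (hΦh : ∀ (r : ℝ) (ξ : V), 0 < r → ξ ≠ 0 → Φ (r • ξ) = r * Φ ξ) {χ : V → ℂ}
    (hχ : ContDiff ℝ ∞ χ) (hχc : HasCompactSupport χ) {r : ℝ} (hr : 0 < r)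
    (hχ1 : ∀ ξ, ‖ξ‖ ≤ r → χ ξ = 1) (t : ℝ) :
    (fun ξ => (1 - χ ξ) * Complex.exp (Complex.I * t * Φ ξ)).HasTemperateGrowth := by
  obtain ⟨Ψ, hΨ, hΨΦ⟩ := exists_contDiff_eq_of_le_norm hΦ hr
  have h1 := (hasTemperateGrowth_exp_I_mul t).comp (hasTemperateGrowth_of_homogeneous hΨ hΦh hr hΨΦ)
  have h2 := (Function.HasTemperateGrowth.const (1 : ℂ)).sub
    (hasTemperateGrowth_of_hasCompactSupport hχ hχc)
  have h3 := h2.mul h1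
  have e : (fun ξ => (1 - χ ξ) * Complex.exp (Complex.I * t * Φ ξ)) =
      ((fun _ => 1) - χ) * (fun s : ℝ => Complex.exp (Complex.I * t * s)) ∘ Ψ := by
    funext ξ
    rcases le_total ‖ξ‖ r with h | h
    · simp [hχ1 ξ h]
    · simp [hΨΦ ξ h]
  rw [e]
  exact h3

end TemperateGrowth

/-! ### The propagator on a single sector -/

section Packet

variable {V : Type*} [NormedAddCommGroup V] [InnerProductSpace ℝ V]

/-- For unit vectors `⟪u, θ⟫ = 1 - ‖u - θ‖²/2 ≥ 7/8`, so the affine chart and the chordal distance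
are comparable near `θ`. -/
theorem norm_capChart_le {θ ξ : V} (hθ : ‖θ‖ = 1) (hξ : ξ ≠ 0) {ε : ℝ} (hε : ε ≤ 1 / 2)
    (h : ‖‖ξ‖⁻¹ • ξ - θ‖ ≤ ε) : ‖ξ‖ / 2 ≤ inner ℝ ξ θ ∧ ‖capChart θ ξ‖ ≤ 2 * ε := by
  have hn : 0 < ‖ξ‖ := norm_pos_iff.2 hξ
  set u := ‖ξ‖⁻¹ • ξ with hu
  have hu1 : ‖u‖ = 1 := by
    rw [hu, norm_smul, norm_inv, norm_norm, inv_mul_cancel₀ hn.ne']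
  have h1 : ‖u - θ‖ ^ 2 = 2 - 2 * inner ℝ u θ := by
    rw [norm_sub_sq_real, hu1, hθ]; ring
  set e := ‖u - θ‖ with he
  have he0 : 0 ≤ e := norm_nonneg _
  set a := inner ℝ u θ with ha
  have ha1 : a = 1 - e ^ 2 / 2 := by linarith
  have ha2 : 7 / 8 ≤ a := by nlinarith
  have ha0 : 0 < a := by linarith
  have hξu : ξ = ‖ξ‖ • u := by rw [hu, smul_smul, mul_inv_cancel₀ hn.ne', one_smul]
  constructor
  · have : inner ℝ ξ θ = ‖ξ‖ * a := by
      conv_lhs => rw [hξu]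
      rw [inner_smul_left, RCLike.conj_to_real]
    rw [this]; nlinarith
  · have h2 : capChart θ ξ = a⁻¹ • ((u - θ) + (1 - a) • θ) := by
      have h3 : inner ℝ ξ θ = ‖ξ‖ * a := by
        conv_lhs => rw [hξu]
        rw [inner_smul_left, RCLike.conj_to_real]
      rw [capChart, h3, mul_inv, mul_comm, ← smul_smul, ← hu,
        show (u - θ) + (1 - a) • θ = u - a • θ by module, smul_sub, smul_smul a⁻¹ a θ,
        inv_mul_cancel₀ ha0.ne', one_smul]
    rw [h2, norm_smul, norm_inv, Real.norm_of_nonneg ha0.le, inv_mul_le_iff₀ ha0]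
    have h3 : ‖(u - θ) + (1 - a) • θ‖ ≤ e + e ^ 2 / 2 := by
      refine (norm_add_le _ _).trans ?_
      rw [norm_smul, hθ, mul_one, Real.norm_of_nonneg (by nlinarith), ← he]
      linarith
    nlinarith

theorem contDiffOn_exp_I_mul {Φ : V → ℝ} {U : Set V} (hΦ : ContDiffOn ℝ ∞ Φ U) (t : ℝ) :
    ContDiffOn ℝ ∞ (fun ξ => Complex.exp (Complex.I * t * Φ ξ)) U :=
  (hasTemperateGrowth_exp_I_mul t).1.comp_contDiffOn hΦ

variable [FiniteDimensional ℝ V] [MeasurableSpace V] [BorelSpace V]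

/-- A smooth localisation of the propagator to a parabolic sector at frequency `R`. -/
theorem exists_sectorSymbol {n : ℕ} (hn : Module.finrank ℝ V = n + 2) {Φ : V → ℝ}
    (hΦ : ContDiffOn ℝ ∞ Φ {0}ᶜ)
    (hΦh : ∀ (r : ℝ) (ξ : V), 0 < r → ξ ≠ 0 → Φ (r • ξ) = r * Φ ξ) :
    ∃ C : ℝ, 0 ≤ C ∧ ∀ R : ℝ, 16 ≤ R → ∀ θ : V, ‖θ‖ = 1 → ∀ t : ℝ, ∃ E : V → ℂ,
      ContDiff ℝ ∞ E ∧ HasCompactSupport E ∧ (∀ ξ, ‖E ξ‖ ≤ 1) ∧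
      KerBound E (C * √(1 + |t|) ^ (n + 1)) ∧
      ∀ ξ, R / 2 ≤ ‖ξ‖ → ‖ξ‖ ≤ 2 * R → ‖‖ξ‖⁻¹ • ξ - θ‖ ≤ √(2 / ‖ξ‖) →
        E ξ = Complex.exp (Complex.I * t * Φ ξ) := by
  obtain ⟨X, hX, hX0, hXle, hXs, hX1⟩ := exists_intervalCutoff (l := 1 / 4) (by norm_num)
  have hG : ContDiff ℝ ∞ fun z : ℝ × V => ((radialCutoff ((1 / 2 : ℝ) • z.2) : ℝ) : ℂ) :=
    Complex.ofRealCLM.contDiff.comp (contDiff_radialCutoff.comp (contDiff_snd.const_smul _))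
  have hGs : ∀ ξ : V, 4 < ‖ξ‖ → radialCutoff ((1 / 2 : ℝ) • ξ) = 0 := fun ξ hξ =>
    radialCutoff_zero_of_two_le (by
      rw [norm_smul, Real.norm_of_nonneg (by norm_num)]; linarith)
  obtain ⟨C, hC, H⟩ := exists_kerBound_sector hn hΦ hΦh hG (isCompact_singleton (x := (0 : ℝ)))
    (ρ := 4) (fun w _ ξ hξ => by simp only [hGs ξ hξ, Complex.ofReal_zero]) hX (by norm_num) hXs
    (3 / 2)
  refine ⟨C * 6 ^ (n + 1), by positivity, fun R hR θ hθ t => ?_⟩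
  have hR0 : 0 < R := by linarith
  set D : ℝ := √(1 + |t|) with hD
  have hDsq : D ^ 2 = 1 + |t| := Real.sq_sqrt (by positivity)
  have hD1 : 1 ≤ D := by rw [hD, Real.one_le_sqrt]; linarith [abs_nonneg t]
  have hD0 : 0 < D := one_pos.trans_le hD1
  -- The angular width of a packet at frequency `R`. The condition `R ≥ 16` gives `r ≤ 1/4`, hence
  -- `2r ≤ 1/2` for `norm_capChart_le` and `6r ≤ 3/2` for the aperture.
  set r : ℝ := (√R)⁻¹ with hr
  have hsR : 4 ≤ √R := by
    rw [show (4 : ℝ) = √16 by rw [show (16 : ℝ) = 4 ^ 2 by norm_num]; simp]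
    exact Real.sqrt_le_sqrt hR
  have hr0 : 0 < r := inv_pos.2 (by linarith)
  have hr4 : r ≤ 1 / 4 := by
    rw [hr, inv_le_comm₀ (by linarith) (by norm_num)]; norm_num; exact hsR
  have hrsq : R * r ^ 2 = 1 := by
    rw [hr, inv_pow, Real.sq_sqrt hR0.le, mul_inv_cancel₀ hR0.ne']
  have hδr : r / D ≤ r := div_le_self hr0.le hD1
  -- With `δ = r/D` one has `|t| R δ² = |t|/(1+|t|) ≤ 1`. The aperture `6r` covers `‖capChart‖ ≤ 4r`
  -- plus the margin `2δ ≤ 2r`, and `6r/δ = 6D` gives the cap count.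
  obtain ⟨Q, hQ0, hQle, hQ1, hQs, hQ⟩ := H θ hθ (r / D) (6 * r) (by positivity) (by linarith)
    (by positivity) (by linarith)
  have hker := hQ 0 rfl R t hR0 (by
    have : |t| * R * (r / D) ^ 2 = |t| / (1 + |t|) := by
      rw [div_pow, hDsq, mul_assoc, ← mul_div_assoc, hrsq, mul_one_div]
    rw [this]
    exact (div_le_one (by positivity)).2 (by linarith))
  have hYδ : 6 * r / (r / D) = 6 * D := by field_simp
  rw [hYδ, mul_pow, ← mul_assoc] at hker
  set f : V → ℝ := fun ξ => X (R⁻¹ * inner ℝ ξ θ) * radialCutoff ((1 / 2 : ℝ) • R⁻¹ • ξ) with hf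
  have hfs : ContDiff ℝ ∞ f := by
    have h1 : ContDiff ℝ ∞ fun ξ : V => inner ℝ ξ θ := contDiff_id.inner ℝ contDiff_const
    exact (hX.comp (contDiff_const.mul h1)).mul
      (contDiff_radialCutoff.comp ((contDiff_id.const_smul _).const_smul _))
  have hE : (fun ξ => (X (R⁻¹ * inner ℝ ξ θ) : ℂ) *
      ((radialCutoff ((1 / 2 : ℝ) • R⁻¹ • ξ) : ℝ) : ℂ) * Q ξ *
        Complex.exp (Complex.I * t * Φ ξ)) =
      fun ξ => f ξ • ((Q ξ : ℂ) * Complex.exp (Complex.I * t * Φ ξ)) := by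
    funext ξ
    rw [hf, Complex.real_smul]; push_cast; ring
  have hsupp : tsupport f ⊆ {ξ | 0 < inner ℝ ξ θ} := by
    have h1 : tsupport f ⊆ {ξ | R / 8 ≤ inner ℝ ξ θ} := by
      refine closure_minimal (fun ξ hξ => ?_)
        (isClosed_le continuous_const (continuous_id.inner continuous_const))
      have h2 : X (R⁻¹ * inner ℝ ξ θ) ≠ 0 := fun h => hξ (by simp only [hf, h, zero_mul])
      have h3 : R⁻¹ * inner ℝ ξ θ ∈ Set.Icc (1 / 4 / 2 : ℝ) 4 := by
        by_contra h; exact h2 (hXs _ h)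
      have h4 := h3.1
      rw [inv_mul_eq_div, le_div_iff₀ hR0] at h4
      show R / 8 ≤ inner ℝ ξ θ
      linarith
    intro ξ hξ
    have h2 : R / 8 ≤ inner ℝ ξ θ := h1 hξ
    show 0 < inner ℝ ξ θ
    linarith
  refine ⟨_, ?_, ?_, fun ξ => ?_, hker, fun ξ h1 h2 h3 => ?_⟩
  · rw [hE]
    refine contDiff_smul_of_tsupport_subset
      (isOpen_lt continuous_const (continuous_id.inner continuous_const)) hfs ?_ hsupp
    refine (Complex.ofRealCLM.contDiff.comp_contDiffOn hQs).mul
      (contDiffOn_exp_I_mul (hΦ.mono fun ξ hξ => ?_) t)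
    rintro rfl
    simp at hξ
  · refine HasCompactSupport.of_support_subset_isCompact (isCompact_closedBall (0 : V) (4 * R))
      fun ξ hξ => ?_
    rw [mem_closedBall_zero_iff]
    by_contra h
    refine hξ ?_
    beta_reduce
    rw [hGs, Complex.ofReal_zero, mul_zero, zero_mul, zero_mul]
    rw [norm_smul, norm_inv, Real.norm_of_nonneg hR0.le, inv_mul_eq_div, lt_div_iff₀ hR0]
    exact not_le.1 h
  · rw [norm_mul, norm_mul, norm_mul, norm_exp_I_mul, mul_one, Complex.norm_real,
      Complex.norm_real, Complex.norm_real, Real.norm_of_nonneg (hX0 _),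
      Real.norm_of_nonneg (hQ0 _), Real.norm_of_nonneg (radialCutoff_nonneg _)]
    exact mul_le_one₀ (mul_le_one₀ (hXle _) (radialCutoff_nonneg _) (radialCutoff_le_one _))
      (hQ0 _) (hQle _)
  · have hξ0 : 0 < ‖ξ‖ := by linarith
    have h4 : √(2 / ‖ξ‖) ≤ 2 * r := by
      rw [Real.sqrt_le_left (by positivity), mul_pow, div_le_iff₀ hξ0]
      have : R / 2 * r ^ 2 ≤ ‖ξ‖ * r ^ 2 := by gcongr
      linarith
    obtain ⟨h5, h6⟩ := norm_capChart_le hθ (norm_pos_iff.1 hξ0) (by linarith) (h3.trans h4)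
    have h7 : inner ℝ ξ θ ≤ ‖ξ‖ := by
      have := real_inner_le_norm ξ θ
      rwa [hθ, mul_one] at this
    have h8 : X (R⁻¹ * inner ℝ ξ θ) = 1 := by
      rw [inv_mul_eq_div]
      refine hX1 _ ?_ ?_
      · rw [le_div_iff₀ hR0]; linarith
      · rw [div_le_iff₀ hR0]; linarith
    have h9 : radialCutoff ((1 / 2 : ℝ) • R⁻¹ • ξ) = 1 := radialCutoff_one (by
      rw [norm_smul, norm_smul, norm_inv, Real.norm_of_nonneg hR0.le, inv_mul_eq_div,
        Real.norm_of_nonneg (by norm_num)]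
      have : ‖ξ‖ / R ≤ 2 := by rw [div_le_iff₀ hR0]; linarith
      linarith)
    rw [h8, h9, hQ1 ξ (by linarith) (by linarith)]
    simp

end Packet

namespace AdaptedBesov

/-! ### Wave packets -/

section Packets

variable {d : ℕ}

/-- The symbol of a wave packet is supported in a parabolic region around its direction. -/
theorem packet_support (c : Cutoffs d) (θ : Sph d) {ξ : Eucl d} (h : packet c θ ξ ≠ 0) :
    1 / 8 ≤ ‖ξ‖ ∧ ‖‖ξ‖⁻¹ • ξ - (θ : Eucl d)‖ ≤ √(2 / ‖ξ‖) := by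
  by_contra hcon
  refine h ?_
  rw [packet, intervalIntegral.integral_of_le (by norm_num)]
  refine setIntegral_eq_zero_of_forall_eq_zero fun σ hσ => ?_
  by_contra hne
  refine hcon ?_
  have hσ0 : 0 < σ := hσ.1
  have h1 : c.psi (σ • ξ) ≠ 0 := fun h0 => hne (by rw [h0, zero_mul, zero_div])
  have h2 : angCut c θ σ ξ ≠ 0 := fun h0 => hne (by rw [h0, mul_zero, zero_div])
  have h3 : ‖σ • ξ‖ ∈ Set.Icc (1 / 2 : ℝ) 2 := by
    by_contra h0; exact h1 (c.psi_support _ h0)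
  rw [norm_smul, Real.norm_of_nonneg hσ0.le] at h3
  have hξ : ξ ≠ 0 := fun h0 => h2 (by rw [angCut, if_pos h0])
  have hξ0 : 0 < ‖ξ‖ := norm_pos_iff.2 hξ
  refine ⟨?_, ?_⟩
  · have : σ * ‖ξ‖ ≤ 4 * ‖ξ‖ := by gcongr; exact hσ.2
    linarith [h3.1]
  · rw [angCut, if_neg hξ] at h2
    have h4 : ‖(√σ)⁻¹ • (‖ξ‖⁻¹ • ξ - (θ : Eucl d))‖ ≤ 1 := by
      by_contra h0
      exact h2 (by rw [c.phi_support _ (not_le.1 h0), mul_zero])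
    have hs : 0 < √σ := Real.sqrt_pos.2 hσ0
    rw [norm_smul, norm_inv, Real.norm_of_nonneg hs.le, inv_mul_le_iff₀ hs, mul_one] at h4
    refine h4.trans (Real.sqrt_le_sqrt ?_)
    rw [le_div_iff₀ hξ0]
    exact h3.2

theorem norm_sphere (θ : Sph d) : ‖(θ : Eucl d)‖ = 1 := mem_sphere_zero_iff_norm.1 θ.2

/-- A smooth localisation of the propagator to the support of a dyadic piece of a wave packet. -/
theorem exists_packetSymbol {n : ℕ} (c : Cutoffs (n + 2)) {φ : Eucl (n + 2) → ℝ}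
    (hφ : ContDiffOn ℝ ∞ φ {0}ᶜ)
    (hφh : ∀ (r : ℝ) (ξ : Eucl (n + 2)), 0 < r → ξ ≠ 0 → φ (r • ξ) = r * φ ξ) :
    ∃ C : ℝ, 0 ≤ C ∧ ∀ (k : ℕ) (θ : Sph (n + 2)) (t : ℝ), ∃ E : Eucl (n + 2) → ℂ,
      ContDiff ℝ ∞ E ∧ HasCompactSupport E ∧ (∀ ξ, ‖E ξ‖ ≤ 1) ∧
      KerBound E (C * √(1 + |t|) ^ (n + 1)) ∧
      ∀ ξ, c.lp k ξ ≠ 0 → packet c θ ξ ≠ 0 → E ξ = propSymbol t φ ξ := by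
  have hfr : Module.finrank ℝ (Eucl (n + 2)) = n + 2 := finrank_euclideanSpace_fin
  obtain ⟨C₁, hC₁, H₁⟩ := exists_sectorSymbol hfr hφ hφh
  choose ρ hρ using fun k => (c.lp_compact k).isCompact.isBounded.subset_closedBall 0
  set ρ₀ : ℝ := 1 + ∑ k ∈ Finset.range 4, |ρ k| with hρ₀
  have hρ1 : 1 ≤ ρ₀ := le_add_of_nonneg_right (Finset.sum_nonneg fun _ _ => abs_nonneg _)
  have hρ0 : 0 < ρ₀ := one_pos.trans_le hρ1
  have hlow : ∀ k < 4, ∀ ξ, c.lp k ξ ≠ 0 → ‖ξ‖ ≤ ρ₀ := fun k hk ξ hξ => by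
    have h1 := mem_closedBall_zero_iff.1 (hρ k (subset_tsupport _ hξ))
    have h2 : |ρ k| ≤ ∑ k ∈ Finset.range 4, |ρ k| :=
      Finset.single_le_sum (f := fun k => |ρ k|) (fun _ _ => abs_nonneg _) (Finset.mem_range.2 hk)
    linarith [le_abs_self (ρ k)]
  set χ : Eucl (n + 2) → ℝ :=
    fun ξ => radialCutoff (ρ₀⁻¹ • ξ) - radialCutoff ((16 : ℝ) • ξ) with hχ
  have hχs : ContDiff ℝ ∞ χ := (contDiff_radialCutoff.comp (contDiff_const_smul _)).sub
    (contDiff_radialCutoff.comp (contDiff_const_smul _))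
  have hχz : ∀ ξ, χ ξ ≠ 0 → 1 / 16 ≤ ‖ξ‖ ∧ ‖ξ‖ ≤ 2 * ρ₀ := by
    intro ξ h
    constructor
    · by_contra hc
      push Not at hc
      refine h ?_
      rw [hχ]
      beta_reduce
      rw [radialCutoff_one, radialCutoff_one, sub_self]
      · rw [norm_smul, Real.norm_of_nonneg (by norm_num)]; linarith
      · rw [norm_smul, norm_inv, Real.norm_of_nonneg hρ0.le, inv_mul_le_iff₀ hρ0]; linarith
    · by_contra hc
      push Not at hc
      refine h ?_
      rw [hχ]
      beta_reduce
      rw [radialCutoff_zero_of_two_le, radialCutoff_zero_of_two_le, sub_self]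
      · rw [norm_smul, Real.norm_of_nonneg (by norm_num)]; linarith
      · rw [norm_smul, norm_inv, Real.norm_of_nonneg hρ0.le, inv_mul_eq_div, le_div_iff₀ hρ0]
        exact hc.le
  have hχc : HasCompactSupport fun ξ => (χ ξ : ℂ) := by
    refine HasCompactSupport.of_support_subset_isCompact
      (isCompact_closedBall (0 : Eucl (n + 2)) (2 * ρ₀)) fun ξ hξ => ?_
    rw [mem_closedBall_zero_iff]
    exact (hχz ξ fun h => hξ (by simp only [h, Complex.ofReal_zero])).2
  have hχt : tsupport χ ⊆ {0}ᶜ := by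
    have h1 : tsupport χ ⊆ {ξ | 1 / 16 ≤ ‖ξ‖} :=
      closure_minimal (fun ξ hξ => (hχz ξ hξ).1) (isClosed_le continuous_const continuous_norm)
    rintro ξ hξ rfl
    have h2 : (1 / 16 : ℝ) ≤ ‖(0 : Eucl (n + 2))‖ := h1 hξ
    norm_num at h2
  obtain ⟨C₂, hC₂, H₂⟩ := exists_kerBound_low hfr hφ hφh (χ := fun ξ => (χ ξ : ℂ))
    (Complex.ofRealCLM.contDiff.comp hχs) hχc
  refine ⟨C₁ + C₂, by positivity, fun k θ t => ?_⟩
  have hD : (0 : ℝ) ≤ √(1 + |t|) ^ (n + 1) := by positivity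
  -- The sector construction needs `2^k ≥ 16`. For the finitely many smaller `k` the frequencies are
  -- bounded above, and bounded below by `1/8` on the packet, so the low-frequency estimate applies.
  by_cases hk : k < 4
  · refine ⟨fun ξ => (χ ξ : ℂ) * Complex.exp (Complex.I * t * φ ξ), ?_, hχc.mul_right,
      fun ξ => ?_, (H₂ t).mono ?_, fun ξ h1 h2 => ?_⟩
    · exact contDiff_smul_of_tsupport_subset isOpen_compl_singleton hχs
        (contDiffOn_exp_I_mul hφ t) hχt
    · rw [norm_mul, norm_exp_I_mul, mul_one, Complex.norm_real, Real.norm_eq_abs, abs_le]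
      have a1 := radialCutoff_nonneg (ρ₀⁻¹ • ξ)
      have a2 := radialCutoff_le_one (ρ₀⁻¹ • ξ)
      have a3 := radialCutoff_nonneg ((16 : ℝ) • ξ)
      have a4 := radialCutoff_le_one ((16 : ℝ) • ξ)
      constructor <;> simp only [hχ] <;> linarith
    · gcongr; linarith
    · have h3 := (packet_support c θ h2).1
      have h4 := hlow k hk ξ h1
      have h5 : χ ξ = 1 := by
        rw [hχ]
        beta_reduce
        rw [radialCutoff_one, radialCutoff_zero_of_two_le, sub_zero]
        · rw [norm_smul, Real.norm_of_nonneg (by norm_num)]; linarith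
        · rw [norm_smul, norm_inv, Real.norm_of_nonneg hρ0.le, inv_mul_le_iff₀ hρ0]; linarith
      beta_reduce
      rw [h5, Complex.ofReal_one, one_mul, propSymbol]
  · push Not at hk
    have h16 : (16 : ℝ) ≤ 2 ^ k := by
      calc (16 : ℝ) = 2 ^ 4 := by norm_num
        _ ≤ 2 ^ k := pow_le_pow_right₀ (by norm_num) hk
    obtain ⟨E, hE, hEc, hE1, hEK, hEe⟩ := H₁ (2 ^ k) h16 θ (norm_sphere θ) t
    refine ⟨E, hE, hEc, hE1, hEK.mono (by gcongr; linarith), fun ξ h1 h2 => ?_⟩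
    obtain ⟨h3, h4⟩ := c.lp_support k (by omega) ξ h1
    rw [zpow_sub_one₀ two_ne_zero, zpow_natCast] at h3
    rw [zpow_add_one₀ two_ne_zero, zpow_natCast] at h4
    exact hEe ξ (by linarith) (by linarith) (packet_support c θ h2).2

end Packets

/-! ### The propagator as a Fourier multiplier -/

section Multipliers

variable {d : ℕ} {p : ℝ≥0∞} [hp : Fact (1 ≤ p)]

theorem hasTemperateGrowth_dilate {m : Eucl d → ℂ} (hm : m.HasTemperateGrowth) (r : ℝ) :
    (fun x => m (r • x)).HasTemperateGrowth :=
  hm.comp ((r • ContinuousLinearMap.id ℝ (Eucl d)).hasTemperateGrowth)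

theorem mult_apply (m : Eucl d → ℂ) (f : 𝓢'(Eucl d, ℂ)) (u : 𝓢(Eucl d, ℂ)) :
    mult m f u =
      f (𝓕 (SchwartzMap.smulLeftCLM ℂ (fun x => m ((2 * Real.pi) • x)) (𝓕⁻ u))) := rfl

/-- For a symbol without temperate growth the multiplier takes its default value zero. The
commutation and support lemmas hold in this case too, so smoothness of the packet symbols is never
needed. -/
theorem smulLeftCLM_eq_zero {m : Eucl d → ℂ} (hm : ¬ m.HasTemperateGrowth) :
    SchwartzMap.smulLeftCLM ℂ m = (0 : 𝓢(Eucl d, ℂ) →L[ℂ] 𝓢(Eucl d, ℂ)) := dif_neg hm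

theorem smulLeftCLM_comm (a b : Eucl d → ℂ) (u : 𝓢(Eucl d, ℂ)) :
    SchwartzMap.smulLeftCLM ℂ a (SchwartzMap.smulLeftCLM ℂ b u) =
      SchwartzMap.smulLeftCLM ℂ b (SchwartzMap.smulLeftCLM ℂ a u) := by
  by_cases ha : a.HasTemperateGrowth
  · by_cases hb : b.HasTemperateGrowth
    · rw [SchwartzMap.smulLeftCLM_smulLeftCLM_apply ha hb,
        SchwartzMap.smulLeftCLM_smulLeftCLM_apply hb ha, mul_comm]
    · simp [smulLeftCLM_eq_zero hb]
  · simp [smulLeftCLM_eq_zero ha]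

theorem mult_comm (a b : Eucl d → ℂ) (f : 𝓢'(Eucl d, ℂ)) :
    mult a (mult b f) = mult b (mult a f) := by
  ext u
  rw [mult_apply, mult_apply, mult_apply, mult_apply, FourierTransform.fourierInv_fourier_eq,
    FourierTransform.fourierInv_fourier_eq, smulLeftCLM_comm]

theorem support_smulLeftCLM {a : Eucl d → ℂ} {u : 𝓢(Eucl d, ℂ)} {x : Eucl d}
    (h : SchwartzMap.smulLeftCLM ℂ a u x ≠ 0) : a x ≠ 0 ∧ u x ≠ 0 := by
  by_cases ha : a.HasTemperateGrowth
  · rw [SchwartzMap.smulLeftCLM_apply_apply ha, smul_eq_mul] at h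
    exact mul_ne_zero_iff.1 h
  · simp [smulLeftCLM_eq_zero ha] at h

theorem integrable_mul_schwartzMap (h : Lp ℂ p (volume : Measure (Eucl d)))
    (u : 𝓢(Eucl d, ℂ)) : Integrable fun x => h x * u x := by
  have hpq : ENNReal.HolderConjugate p (1 - p⁻¹)⁻¹ :=
    ENNReal.HolderConjugate.inv_one_sub_inv' hp.out
  exact (Lp.memLp h).integrable_mul (q := (1 - p⁻¹)⁻¹) (u.memLp _ volume)

theorem toTemperedDistribution_apply_mul (h : Lp ℂ p (volume : Measure (Eucl d)))
    (u : 𝓢(Eucl d, ℂ)) : Lp.toTemperedDistribution h u = ∫ x, h x * u x := by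
  rw [Lp.toTemperedDistribution_apply]
  simp only [smul_eq_mul, mul_comm]

theorem multTranspose_eq {m a : Eucl d → ℂ} (ha : a.HasTemperateGrowth) {u : 𝓢(Eucl d, ℂ)}
    (h : ∀ x, (𝓕⁻ u : 𝓢(Eucl d, ℂ)) x ≠ 0 → m ((2 * Real.pi) • x) = a ((2 * Real.pi) • x)) :
    multTranspose m u =
      (𝓕 (SchwartzMap.smulLeftCLM ℂ (fun x => a ((2 * Real.pi) • x)) (𝓕⁻ u)) :
        𝓢(Eucl d, ℂ)) := by
  rw [SchwartzMap.fourier_coe, multTranspose]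
  congr 1
  funext x
  rw [SchwartzMap.smulLeftCLM_apply_apply (hasTemperateGrowth_dilate ha _), smul_eq_mul]
  by_cases hx : (𝓕⁻ u : 𝓢(Eucl d, ℂ)) x = 0
  · rw [hx, mul_zero, mul_zero]
  · rw [h x hx]

variable {c : Cutoffs d}

theorem hasTemperateGrowth_rho (c : Cutoffs d) : c.rho.HasTemperateGrowth :=
  hasTemperateGrowth_of_hasCompactSupport c.rho_smooth c.rho_compact

/-- On test functions with spectrum in a region where `m` agrees with a regular symbol `a`, the
distribution `m(D) f` is `a(D) f`. -/
theorem IsMultOf.apply_eq {m a : Eucl d → ℂ} {f g : 𝓢'(Eucl d, ℂ)} (hg : IsMultOf c p m f g)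
    (hm : (fun ξ => (1 - c.rho ξ) * m ξ).HasTemperateGrowth) (ha : a.HasTemperateGrowth)
    {u : 𝓢(Eucl d, ℂ)}
    (h : ∀ x, (𝓕⁻ u : 𝓢(Eucl d, ℂ)) x ≠ 0 → m ((2 * Real.pi) • x) = a ((2 * Real.pi) • x)) :
    g u = mult a f u := by
  obtain ⟨h₀, hh₀, H⟩ := hg
  rw [(H u).2, multTranspose_eq ha h, ← toTemperedDistribution_apply_mul, hh₀, mult_apply,
    mult_apply, mult_apply, FourierTransform.fourierInv_fourier_eq, ← map_add,
    ← FourierTransform.fourier_add]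
  congr 2
  ext x
  rw [add_apply,
    SchwartzMap.smulLeftCLM_apply_apply (hasTemperateGrowth_dilate hm _),
    SchwartzMap.smulLeftCLM_apply_apply (hasTemperateGrowth_dilate (hasTemperateGrowth_rho c) _),
    SchwartzMap.smulLeftCLM_apply_apply (hasTemperateGrowth_dilate ha _)]
  simp only [smul_eq_mul]
  by_cases hx : (𝓕⁻ u : 𝓢(Eucl d, ℂ)) x = 0
  · simp [hx]
  · rw [h x hx]; ring

/-- After transposition the two localisations restrict the spectrum of the test function to the set
where both `b₁` and `b₂` are nonzero; only there must the regular symbol agree with `m`. -/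
theorem IsMultOf.mult_mult_eq {m a b₁ b₂ : Eucl d → ℂ} {f g : 𝓢'(Eucl d, ℂ)}
    (hg : IsMultOf c p m f g) (hm : (fun ξ => (1 - c.rho ξ) * m ξ).HasTemperateGrowth)
    (ha : a.HasTemperateGrowth) (h : ∀ ξ, b₁ ξ ≠ 0 → b₂ ξ ≠ 0 → a ξ = m ξ) :
    mult b₁ (mult b₂ g) = mult a (mult b₁ (mult b₂ f)) := by
  rw [mult_comm a, mult_comm a]
  ext u
  rw [mult_apply, mult_apply, mult_apply b₁ (mult b₂ (mult a f)), mult_apply b₂ (mult a f)]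
  refine hg.apply_eq hm ha fun x hx => ?_
  rw [FourierTransform.fourierInv_fourier_eq] at hx
  obtain ⟨h2, h3⟩ := support_smulLeftCLM hx
  rw [FourierTransform.fourierInv_fourier_eq] at h3
  exact (h _ (support_smulLeftCLM h3).1 h2).symm

theorem IsMultOf.unique {m : Eucl d → ℂ} {f g g' : 𝓢'(Eucl d, ℂ)} (hg : IsMultOf c p m f g)
    (hg' : IsMultOf c p m f g') : g = g' := by
  obtain ⟨h, hh, H⟩ := hg
  obtain ⟨h', hh', H'⟩ := hg'
  obtain rfl : h = h' := toTemperedDistribution_injective (hh.trans hh'.symm)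
  ext u
  rw [(H u).2, (H' u).2]

theorem integrable_of_norm_le_one_mul {m : Eucl d → ℂ} (hm : Measurable m)
    (hm1 : ∀ ξ, ‖m ξ‖ ≤ 1) (v : 𝓢(Eucl d, ℂ)) : Integrable fun x => m x * v x :=
  v.integrable.bdd_mul hm.aestronglyMeasurable (Filter.Eventually.of_forall hm1)

/-- The splitting of the transpose of `m(D)` into its low- and high-frequency parts. -/
theorem multTranspose_eq_add {m : Eucl d → ℂ} (hmm : Measurable m) (hm1 : ∀ ξ, ‖m ξ‖ ≤ 1)
    (hm : (fun ξ => (1 - c.rho ξ) * m ξ).HasTemperateGrowth) (u : 𝓢(Eucl d, ℂ)) (x : Eucl d) :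
    multTranspose m u x =
      𝓕 (fun ξ => c.rho ((2 * Real.pi) • ξ) * m ((2 * Real.pi) • ξ) * 𝓕⁻ (u : Eucl d → ℂ) ξ) x +
      (𝓕 (SchwartzMap.smulLeftCLM ℂ (fun x => (1 - c.rho ((2 * Real.pi) • x)) *
        m ((2 * Real.pi) • x)) (𝓕⁻ u)) : 𝓢(Eucl d, ℂ)) x := by
  have hm' : Measurable fun ξ : Eucl d => m ((2 * Real.pi) • ξ) :=
    hmm.comp (measurable_const_smul _)
  have i1 : Integrable fun ξ => c.rho ((2 * Real.pi) • ξ) * m ((2 * Real.pi) • ξ) *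
      𝓕⁻ (u : Eucl d → ℂ) ξ := by
    have h1 := integrable_of_norm_le_one_mul hm' (fun ξ => hm1 _)
      (SchwartzMap.smulLeftCLM ℂ (fun x => c.rho ((2 * Real.pi) • x)) (𝓕⁻ u))
    refine h1.congr (Filter.Eventually.of_forall fun ξ => ?_)
    beta_reduce
    rw [SchwartzMap.smulLeftCLM_apply_apply (hasTemperateGrowth_dilate (hasTemperateGrowth_rho c) _),
      smul_eq_mul, SchwartzMap.fourierInv_coe]
    ring
  have i2 := (SchwartzMap.smulLeftCLM ℂ (fun x => (1 - c.rho ((2 * Real.pi) • x)) *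
        m ((2 * Real.pi) • x)) (𝓕⁻ u)).integrable (μ := volume)
  rw [SchwartzMap.fourier_coe, ← Pi.add_apply]
  refine Eq.trans ?_ (congr_fun (VectorFourier.fourierIntegral_add Real.continuous_fourierChar
    (L := innerₗ (Eucl d)) continuous_inner i1 i2) x)
  refine congr_fun (congr_arg 𝓕 (funext fun ξ => ?_)) x
  rw [Pi.add_apply, SchwartzMap.smulLeftCLM_apply_apply (hasTemperateGrowth_dilate hm _),
    smul_eq_mul, SchwartzMap.fourierInv_coe]
  ring

/-- Existence of `m(D) f`, with a bound for its low-frequency part. -/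
theorem exists_isMultOf {m : Eucl d → ℂ} (hmm : Measurable m) (hm1 : ∀ ξ, ‖m ξ‖ ≤ 1)
    (hm : (fun ξ => (1 - c.rho ξ) * m ξ).HasTemperateGrowth) {A : ℝ}
    (hA : MultBound p (fun x => c.rho ((2 * Real.pi) • x) * m ((2 * Real.pi) • x)) A)
    {f : 𝓢'(Eucl d, ℂ)} (hf : lpNorm p (mult c.rho f) < ⊤) : ∃ g, IsMultOf c p m f g := by
  obtain ⟨h, hh, -⟩ := exists_of_lpNorm_lt_top hf
  obtain ⟨h', -, H⟩ := hA h
  -- With `h = ρ(D) f`, the term `m(D) h` is itself split into `(ρm)(D) h`, given by the bound `hA`,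
  -- and `((1-ρ)m)(D) h`, which has a regular symbol.
  refine ⟨mult (fun ξ => (1 - c.rho ξ) * m ξ) f + (Lp.toTemperedDistribution h' +
    mult (fun ξ => (1 - c.rho ξ) * m ξ) (Lp.toTemperedDistribution h)), h, hh, fun u => ?_⟩
  simp_rw [multTranspose_eq_add hmm hm1 hm, mul_add]
  have i2 := integrable_mul_schwartzMap h
    (𝓕 (SchwartzMap.smulLeftCLM ℂ (fun x => (1 - c.rho ((2 * Real.pi) • x)) *
      m ((2 * Real.pi) • x)) (𝓕⁻ u)))
  refine ⟨(H u).1.add i2, ?_⟩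
  rw [integral_add (H u).1 i2, ← (H u).2, ← toTemperedDistribution_apply_mul,
    ← toTemperedDistribution_apply_mul]
  rfl

/-- The low-frequency part of `m(D) f`. -/
theorem IsMultOf.lpNorm_rho_le {m a : Eucl d → ℂ}
    (hm : (fun ξ => (1 - c.rho ξ) * m ξ).HasTemperateGrowth) {A B : ℝ} (hA0 : 0 ≤ A)
    (hB0 : 0 ≤ B)
    (hA : MultBound p (fun x => c.rho ((2 * Real.pi) • x) * m ((2 * Real.pi) • x)) A)
    (ha : a.HasTemperateGrowth)
    (hB : MultBound p (fun x => a ((2 * Real.pi) • x)) B)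
    (ham : ∀ ξ, c.rho ξ ≠ 0 → a ξ = (1 - c.rho ξ) * m ξ) {f g : 𝓢'(Eucl d, ℂ)}
    (hg : IsMultOf c p m f g) :
    lpNorm p (mult c.rho g) ≤ ENNReal.ofReal (A + B) * lpNorm p (mult c.rho f) := by
  obtain ⟨h, hh, H⟩ := hg
  obtain ⟨h', hh', H'⟩ := hA h
  have hρ := hasTemperateGrowth_rho c
  -- `ρ(D) g = (ρm)(D) h + ((1-ρ)m)(D) ρ(D) f`, and on the support of `ρ` the second symbol may be
  -- replaced by `a`, which is bounded on `L^p`.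
  have key : mult c.rho g = Lp.toTemperedDistribution h' + mult a (mult c.rho f) := by
    ext u
    set w : 𝓢(Eucl d, ℂ) :=
      𝓕 (SchwartzMap.smulLeftCLM ℂ (fun x => c.rho ((2 * Real.pi) • x)) (𝓕⁻ u)) with hw
    have hwi : (𝓕⁻ w : 𝓢(Eucl d, ℂ)) =
        SchwartzMap.smulLeftCLM ℂ (fun x => c.rho ((2 * Real.pi) • x)) (𝓕⁻ u) :=
      FourierTransform.fourierInv_fourier_eq _
    have h1 : multTranspose m w = 𝓕 (fun ξ => c.rho ((2 * Real.pi) • ξ) *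
        m ((2 * Real.pi) • ξ) * 𝓕⁻ (u : Eucl d → ℂ) ξ) := by
      rw [multTranspose, hwi]
      congr 1
      funext x
      rw [SchwartzMap.smulLeftCLM_apply_apply (hasTemperateGrowth_dilate hρ _), smul_eq_mul,
        SchwartzMap.fourierInv_coe]
      ring
    have h2 : mult c.rho g u = g w := rfl
    have h3 : mult (fun ξ => (1 - c.rho ξ) * m ξ) f w = mult a (mult c.rho f) u := by
      rw [mult_comm a, mult_apply c.rho (mult a f), ← hw, mult_apply, mult_apply]
      congr 2
      ext x
      rw [SchwartzMap.smulLeftCLM_apply_apply (hasTemperateGrowth_dilate hm _),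
        SchwartzMap.smulLeftCLM_apply_apply (hasTemperateGrowth_dilate ha _)]
      by_cases hx : c.rho ((2 * Real.pi) • x) = 0
      · rw [hwi, SchwartzMap.smulLeftCLM_apply_apply (hasTemperateGrowth_dilate hρ _), hx,
          zero_smul, smul_zero, smul_zero]
      · rw [ham _ hx]
    rw [h2, (H w).2, h3, h1, ← (H' u).2, ← toTemperedDistribution_apply_mul, add_comm]
    rfl
  have hfin : lpNorm p (mult c.rho f) < ⊤ := by
    rw [← hh, lpNorm_toTemperedDistribution]
    exact enorm_lt_top
  rw [key, ENNReal.ofReal_add hA0 hB0, add_mul]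
  refine (lpNorm_add_le _ _).trans (add_le_add ?_ ?_)
  · rw [lpNorm_toTemperedDistribution, ← hh, lpNorm_toTemperedDistribution, ← ofReal_norm,
      ← ofReal_norm, ← ENNReal.ofReal_mul hA0]
    exact ENNReal.ofReal_le_ofReal hh'
  · exact lpNorm_fourierMultiplier_le hB hB0 (hasTemperateGrowth_dilate ha _) _ hfin

end Multipliers

end AdaptedBesov

namespace AdaptedBesov

/-! ### From frequency-localised bounds to the adapted norm -/

section Boundedness

variable {p : ℝ≥0∞} [hp : Fact (1 ≤ p)]

/-- Interpolation of the kernel bound `√(1+|t|)^(d-1)` with the trivial `L²` bound. -/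
theorem multBound_dilate_of_kerBound {n : ℕ} {E : Eucl (n + 2) → ℂ} {C B t : ℝ} (hC : 0 ≤ C)
    (hB : 0 ≤ B) (h : KerBound E (C * √(1 + |t|) ^ (n + 1))) (hE : ∀ ξ, ‖E ξ‖ ≤ B) :
    MultBound p (fun x => E ((2 * Real.pi) • x))
      (C ^ |1 - 2 * (p⁻¹).toReal| * B ^ (1 - |1 - 2 * (p⁻¹).toReal|) *
        (1 + |t|) ^ (2 * sExp (n + 2) p)) := by
  have h1 := (h.smul_comp Real.two_pi_pos.ne').multBound (p := p) hB
    (Filter.Eventually.of_forall fun ξ => hE _)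
  refine h1.mono (le_of_eq ?_)
  have ht : (0 : ℝ) ≤ 1 + |t| := by positivity
  have h2 : |1 / 2 - (p⁻¹).toReal| = |1 - 2 * (p⁻¹).toReal| / 2 := by
    rw [show (1 : ℝ) - 2 * (p⁻¹).toReal = 2 * (1 / 2 - (p⁻¹).toReal) by ring, abs_mul,
      abs_of_pos (two_pos : (0 : ℝ) < 2)]
    ring
  rw [Real.mul_rpow hC (by positivity), Real.sqrt_eq_rpow, ← Real.rpow_natCast, ← Real.rpow_mul ht,
    ← Real.rpow_mul ht, sExp, h2]
  push_cast
  ring_nf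

theorem tsum_mul_rpow_le_mul {a b w : ℕ → ℝ≥0∞} {K : ℝ≥0∞} {q : ℝ} (hq : 0 < q)
    (h : ∀ k, a k ≤ K * b k) :
    (∑' k, w k * a k ^ q) ^ (1 / q) ≤ K * (∑' k, w k * b k ^ q) ^ (1 / q) := by
  calc (∑' k, w k * a k ^ q) ^ (1 / q) ≤ (∑' k, K ^ q * (w k * b k ^ q)) ^ (1 / q) := by
        refine ENNReal.rpow_le_rpow (ENNReal.tsum_le_tsum fun k => ?_) (by positivity)
        rw [mul_left_comm, ← ENNReal.mul_rpow_of_nonneg _ _ hq.le]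
        gcongr
        exact h k
    _ = _ := by
        rw [ENNReal.tsum_mul_left, ENNReal.mul_rpow_of_nonneg _ _ (by positivity),
          ← ENNReal.rpow_mul, mul_one_div_cancel hq.ne', ENNReal.rpow_one]

/-- Finiteness of `K` lets the constant leave the integral without measurability of the integrands,
so measurability in `θ` of the Besov norms is not required. -/
theorem lintegral_rpow_le_mul {Ω : Type*} [MeasurableSpace Ω] {μ : Measure Ω}
    {a b : Ω → ℝ≥0∞} {K : ℝ≥0∞} (hK : K ≠ ⊤) {q : ℝ} (hq : 0 < q) (h : ∀ x, a x ≤ K * b x) :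
    (∫⁻ x, a x ^ q ∂μ) ^ (1 / q) ≤ K * (∫⁻ x, b x ^ q ∂μ) ^ (1 / q) := by
  calc (∫⁻ x, a x ^ q ∂μ) ^ (1 / q) ≤ (∫⁻ x, K ^ q * b x ^ q ∂μ) ^ (1 / q) := by
        gcongr with x
        rw [← ENNReal.mul_rpow_of_nonneg _ _ hq.le]
        gcongr
        exact h x
    _ = _ := by
        rw [lintegral_const_mul' _ _ (ENNReal.rpow_ne_top_of_nonneg hq.le hK),
          ENNReal.mul_rpow_of_nonneg _ _ (by positivity),
          ← ENNReal.rpow_mul, mul_one_div_cancel hq.ne', ENNReal.rpow_one]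

variable {d : ℕ} {c : Cutoffs d}

/-- A frequency-localised multiplier bound controls the norm of `m(D) f`. -/
theorem IsMultOf.adaptedNorm_le {m : Eucl d → ℂ} {f g : 𝓢'(Eucl d, ℂ)} (hg : IsMultOf c p m f g)
    (hm : (fun ξ => (1 - c.rho ξ) * m ξ).HasTemperateGrowth) {s q K L : ℝ} (hq : 0 < q)
    (hK : 0 < K) (hL : 0 ≤ L)
    (hlow : lpNorm p (mult c.rho g) ≤ ENNReal.ofReal L * lpNorm p (mult c.rho f))
    (H : ∀ (k : ℕ) (θ : Sph d), ∃ E : Eucl d → ℂ, E.HasTemperateGrowth ∧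
      MultBound p (fun x => E ((2 * Real.pi) • x)) K ∧
      ∀ ξ, c.lp k ξ ≠ 0 → packet c θ ξ ≠ 0 → E ξ = m ξ) :
    adaptedNorm c s p q q g ≤ ENNReal.ofReal (L + K) * adaptedNorm c s p q q f := by
  have h1 : ∀ (k : ℕ) (θ : Sph d),
      lpNorm p (mult (c.lp k) (mult (fun ξ => (packet c θ ξ : ℂ)) g)) ≤
        ENNReal.ofReal K * lpNorm p (mult (c.lp k) (mult (fun ξ => (packet c θ ξ : ℂ)) f)) := by
    intro k θ
    obtain ⟨E, hE, hEK, hEm⟩ := H k θ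
    -- An infinite norm on the right is harmless because `K > 0`; with `K = 0` the product would be
    -- zero.
    rcases eq_or_ne (lpNorm p (mult (c.lp k) (mult (fun ξ => (packet c θ ξ : ℂ)) f))) ⊤ with h | h
    · rw [h, ENNReal.mul_top (ENNReal.ofReal_pos.2 hK).ne']
      exact le_top
    · rw [hg.mult_mult_eq hm hE fun ξ h1 h2 => hEm ξ h1 (by exact_mod_cast h2)]
      exact lpNorm_fourierMultiplier_le hEK hK.le (hasTemperateGrowth_dilate hE _) _
        (lt_top_iff_ne_top.2 h)
  have h2 : ∀ θ : Sph d, besovNorm c s p q (mult (fun ξ => (packet c θ ξ : ℂ)) g) ≤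
      ENNReal.ofReal K * besovNorm c s p q (mult (fun ξ => (packet c θ ξ : ℂ)) f) := fun θ =>
    tsum_mul_rpow_le_mul hq fun k => h1 k θ
  have h3 := lintegral_rpow_le_mul (μ := surf d) ENNReal.ofReal_ne_top hq h2
  rw [ENNReal.ofReal_add hL hK.le, adaptedNorm, adaptedNorm]
  calc _ ≤ _ := add_le_add hlow h3
    _ ≤ _ := by
      rw [mul_add]
      gcongr
      · exact le_self_add
      · exact le_add_self

theorem measurable_propSymbol {φ : Eucl d → ℝ} (hφ : ContDiffOn ℝ ∞ φ {0}ᶜ) (t : ℝ) :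
    Measurable (propSymbol t φ) :=
  measurable_of_continuousOn_compl_singleton 0 (contDiffOn_exp_I_mul hφ t).continuousOn

theorem hasTemperateGrowth_one_sub_rho_mul_propSymbol (c : Cutoffs d) {φ : Eucl d → ℝ}
    (hφ : ContDiffOn ℝ ∞ φ {0}ᶜ)
    (hφh : ∀ (r : ℝ) (ξ : Eucl d), 0 < r → ξ ≠ 0 → φ (r • ξ) = r * φ ξ) (t : ℝ) :
    (fun ξ => (1 - c.rho ξ) * propSymbol t φ ξ).HasTemperateGrowth :=
  hasTemperateGrowth_one_sub_mul_exp hφ hφh c.rho_smooth c.rho_compact two_pos c.rho_one t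

/-- A smooth cut-off equal to one on the support of a compactly supported function. -/
theorem exists_cutoff_eq_one {χ : Eucl d → ℂ} (hχ : HasCompactSupport χ) :
    ∃ η : Eucl d → ℂ, ContDiff ℝ ∞ η ∧ HasCompactSupport η ∧ (∀ ξ, χ ξ ≠ 0 → η ξ = 1) := by
  obtain ⟨r, hr⟩ := hχ.isCompact.isBounded.subset_closedBall 0
  have hr0 : 0 < max r 1 := lt_max_of_lt_right one_pos
  refine ⟨fun ξ => (radialCutoff ((max r 1)⁻¹ • ξ) : ℂ), ?_, ?_, fun ξ hξ => ?_⟩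
  · exact Complex.ofRealCLM.contDiff.comp (contDiff_radialCutoff.comp (contDiff_const_smul _))
  · exact (hasCompactSupport_radialCutoff_smul hr0).comp_left Complex.ofReal_zero
  · have h1 := mem_closedBall_zero_iff.1 (hr (subset_tsupport _ hξ))
    beta_reduce
    rw [radialCutoff_one, Complex.ofReal_one]
    rw [norm_smul, norm_inv, Real.norm_of_nonneg hr0.le, inv_mul_le_iff₀ hr0, mul_one]
    exact h1.trans (le_max_left _ _)

/-- A compactly supported localisation of the propagator is bounded on `L^p`. -/
theorem exists_multBound_low {n : ℕ} {φ : Eucl (n + 2) → ℝ} (hφ : ContDiffOn ℝ ∞ φ {0}ᶜ)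
    (hφh : ∀ (r : ℝ) (ξ : Eucl (n + 2)), 0 < r → ξ ≠ 0 → φ (r • ξ) = r * φ ξ)
    {χ : Eucl (n + 2) → ℂ} (hχ : ContDiff ℝ ∞ χ) (hχc : HasCompactSupport χ) :
    ∃ K : ℝ, 0 ≤ K ∧ ∀ t : ℝ, MultBound p
      (fun x => χ ((2 * Real.pi) • x) * propSymbol t φ ((2 * Real.pi) • x))
      (K * (1 + |t|) ^ (2 * sExp (n + 2) p)) := by
  obtain ⟨C, hC, h⟩ := exists_kerBound_low finrank_euclideanSpace_fin hφ hφh hχ hχc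
  obtain ⟨B, hB⟩ := hχ.continuous.bounded_above_of_compact_support hχc
  have hB0 : 0 ≤ B := (norm_nonneg _).trans (hB 0)
  refine ⟨C ^ |1 - 2 * (p⁻¹).toReal| * B ^ (1 - |1 - 2 * (p⁻¹).toReal|), by positivity,
    fun t => multBound_dilate_of_kerBound (E := fun ξ => χ ξ * propSymbol t φ ξ) hC hB0 (h t)
      fun ξ => ?_⟩
  rw [norm_mul, propSymbol, norm_exp_I_mul, mul_one]
  exact hB ξ

/-- Localised to a packet at a dyadic frequency, the propagator is bounded on `L^p`. -/
theorem exists_multBound_packet {n : ℕ} (c : Cutoffs (n + 2)) {φ : Eucl (n + 2) → ℝ}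
    (hφ : ContDiffOn ℝ ∞ φ {0}ᶜ)
    (hφh : ∀ (r : ℝ) (ξ : Eucl (n + 2)), 0 < r → ξ ≠ 0 → φ (r • ξ) = r * φ ξ) :
    ∃ K : ℝ, 0 < K ∧ ∀ (t : ℝ) (k : ℕ) (θ : Sph (n + 2)), ∃ E : Eucl (n + 2) → ℂ,
      E.HasTemperateGrowth ∧
      MultBound p (fun x => E ((2 * Real.pi) • x)) (K * (1 + |t|) ^ (2 * sExp (n + 2) p)) ∧
      ∀ ξ, c.lp k ξ ≠ 0 → packet c θ ξ ≠ 0 → E ξ = propSymbol t φ ξ := by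
  obtain ⟨C, hC, h⟩ := exists_packetSymbol c hφ hφh
  -- The summand `1` only secures strict positivity of the constant, which `IsMultOf.adaptedNorm_le`
  -- requires.
  refine ⟨C ^ |1 - 2 * (p⁻¹).toReal| + 1, by positivity, fun t k θ => ?_⟩
  obtain ⟨E, hE, hEc, hE1, hEK, hEm⟩ := h k θ t
  refine ⟨E, hasTemperateGrowth_of_hasCompactSupport hE hEc, ?_, hEm⟩
  refine (multBound_dilate_of_kerBound hC zero_le_one hEK hE1).mono ?_
  rw [Real.one_rpow, mul_one]
  gcongr
  linarith

end Boundedness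

end AdaptedBesov

/-! ### The propagator on the adapted Besov space -/

theorem mainTheorem3 (d : ℕ) (hd : 2 ≤ d) (c : AdaptedBesov.Cutoffs d)
    (φ : AdaptedBesov.Eucl d → ℝ)
    (hφ_smooth : ContDiffOn ℝ ∞ φ {0}ᶜ)
    (hφ_hom : ∀ (r : ℝ) (ξ : AdaptedBesov.Eucl d), 0 < r → ξ ≠ 0 → φ (r • ξ) = r * φ ξ)
    (p : ℝ≥0∞) [Fact (1 ≤ p)] (q : ℝ) (hq : 1 ≤ q) (s : ℝ) :
    ∃ C : ℝ≥0, ∀ t : ℝ, ∀ f ∈ AdaptedBesov.adaptedSpace c s p q q,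
      (∃! g, AdaptedBesov.IsMultOf c p (AdaptedBesov.propSymbol t φ) f g) ∧
      ∀ g, AdaptedBesov.IsMultOf c p (AdaptedBesov.propSymbol t φ) f g →
        g ∈ AdaptedBesov.adaptedSpace c s p q q ∧
        AdaptedBesov.adaptedNorm c s p q q g ≤
          (C : ℝ≥0∞) * ENNReal.ofReal ((1 + |t|) ^ (2 * AdaptedBesov.sExp d p)) *
            AdaptedBesov.adaptedNorm c s p q q f := by
  open AdaptedBesov in
  obtain ⟨n, rfl⟩ : ∃ n, d = n + 2 := ⟨d - 2, by omega⟩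
  obtain ⟨A, hA0, hA⟩ := exists_multBound_low (p := p) hφ_smooth hφ_hom c.rho_smooth c.rho_compact
  -- The symbol `(1-ρ)e^{itφ}` is not compactly supported. The cut-off `η`, equal to one where `ρ ≠
  -- 0`, makes it so without changing its action on `ρ(D) f`, and the low-frequency bound applies
  -- again.
  obtain ⟨η, hη, hηc, hη1⟩ := exists_cutoff_eq_one c.rho_compact
  have hηρ : ContDiff ℝ ∞ fun ξ => η ξ * (1 - c.rho ξ) :=
    hη.mul (contDiff_const.sub c.rho_smooth)
  obtain ⟨B, hB0, hB⟩ := exists_multBound_low (p := p) hφ_smooth hφ_hom hηρ hηc.mul_right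
  obtain ⟨K, hK0, hK⟩ := exists_multBound_packet (p := p) c hφ_smooth hφ_hom
  refine ⟨(A + B + K).toNNReal, fun t f hf => ?_⟩
  have hm := hasTemperateGrowth_one_sub_rho_mul_propSymbol c hφ_smooth hφ_hom t
  set D : ℝ := (1 + |t|) ^ (2 * sExp (n + 2) p) with hD
  have hD0 : 0 < D := by positivity
  have ha : (fun ξ => η ξ * (1 - c.rho ξ) * propSymbol t φ ξ).HasTemperateGrowth := by
    simp_rw [mul_assoc]
    exact (hasTemperateGrowth_of_hasCompactSupport hη hηc).mul hm
  refine ⟨?_, fun g hg => ?_⟩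
  · obtain ⟨g, hg⟩ := exists_isMultOf (measurable_propSymbol hφ_smooth t)
      (fun ξ => (norm_exp_I_mul _ _).le) hm (hA t) (lt_of_le_of_lt le_self_add hf)
    exact ⟨g, hg, fun g' hg' => hg'.unique hg⟩
  · have hlow := hg.lpNorm_rho_le hm (A := A * D) (B := B * D) (by positivity) (by positivity)
      (hA t) ha (hB t) fun ξ hξ => by rw [hη1 ξ hξ, one_mul]
    have h := hg.adaptedNorm_le hm (s := s) (q := q) (K := K * D) (by positivity) (by positivity)
      (by positivity) hlow (hK t)
    rw [← add_mul, ← add_mul, ENNReal.ofReal_mul (by positivity)] at h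
    exact ⟨h.trans_lt (ENNReal.mul_lt_top
      (ENNReal.mul_lt_top ENNReal.ofReal_lt_top ENNReal.ofReal_lt_top) hf), h⟩
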